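/- **Model.** A quantum algorithm with oracle access to two vectors in $\mathbb R^d$ is a circuit on finitely many qubits and finitely many registers holding exact real numbers (the quantum arithmetic model), started in the all-zero state and followed by a measurement in the computational basis; its output is the number found in a designated real register. The elementary gates are one-qubit unitaries with at most two control qubits, reversible additions to (or subtractions from) a real register of a constant, of the value of a qubit, or of the sum, difference, product or quotient of two real registers, and flips of a qubit conditioned on a comparison of two real registers. An input oracle for $u\in\mathbb R^d$ is any unitary $O_u$, acting on an index register of $\lceil\log_2 d\rceil$ qubits and a real register, with $O_u|j\rangle|0\rangle=|j\rangle|u_j\rangle$ for all $d$ indices $j$; every application of $O_u,O_u^\dagger,O_v,O_v^\dagger$ is one query. The algorithm is chosen before the vectors and may depend only on $d,\epsilon,\delta$ and on known upper bounds $A\ge\|u\|_\infty$, $B\ge\|v\|_1$ (for instance the norms themselves). **Lemma (Quantum inner product estimation).** There are universal constants $K>0$ and $k\in\mathbb N$ such that for all $d\in\mathbb N$, $\epsilon,\delta\in(0,1)$ and $A,B>0$ there is such an algorithm which uses at most $$K\cdot\frac{A\,B\,\sqrt d}{\epsilon}\,\log\frac1\delta$$ queries and at most $$K\cdot\frac{A\,B\,\sqrt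 d}{\epsilon}\,\log\frac2\delta\cdot\Bigl(\log\bigl(2+d+\tfrac{AB}{\epsilon}+\tfrac1\delta\bigr)\Bigr)^{k}$$ elementary gates, and which, for all nonzero $u,v\in\mathbb R^d$ with $\|u\|_\infty\le A$ and $\|v\|_1\le B$ and for all input oracles $O_u$ for $u$ and $O_v$ for $v$, outputs a number $\widetilde{IP}$ with $|\widetilde{IP}-u\cdot v|\le\epsilon$ with probability at least $1-\delta$. In particular, for $A=\|u\|_\infty$ and $B=\|v\|_1$ it uses $O\bigl(\frac{\|u\|_\infty\|v\|_1\sqrt d}{\epsilon}\log\frac1\delta\bigr)$ queries and, for $\delta\le\frac12$, $\tilde O\bigl(\frac{\|u\|_\infty\|v\|_1\sqrt d}{\epsilon}\log\frac1\delta\bigr)$ gates, where $\tilde O$ hides factors polylogarithmic in $d$, $\|u\|_\infty\|v\|_1/\epsilon$ and $1/\delta$. -/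

import Mathlib

/-!  Quantum query circuits in the quantum arithmetic model.

The memory consists of `n` qubits and `m` registers that hold real numbers exactly; the
computational basis is labelled by the joint contents of all registers.  Elementary gates are
one-qubit unitaries with at most two control qubits, and elementary arithmetic operations and
comparisons on the real registers, performed reversibly.  Input vectors are accessed only through
their oracles. -/

namespace QuantumIP

/-- The label of a computational basis state: the contents of `n` qubits and `m` real registers. -/
abbrev Label (n m : ℕ) : Type := (Fin n → Bool) × (Fin m → ℝ)

/-- A state, given by its amplitudes in the computational basis. -/
abbrev State (n m : ℕ) : Type := Label n m → ℂ

/-- The initial state, in which every qubit and every real register is zero. -/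
noncomputable def initial (n m : ℕ) : State n m := by
  classical
  exact Pi.single (fun _ => false, fun _ => 0) 1

/-- The number of qubits of an index register for `d` indices. -/
abbrev indexBits (d : ℕ) : ℕ := Nat.clog 2 d

/-- The binary representation of an index. -/
def encode {d : ℕ} (j : Fin d) : Fin (indexBits d) → Bool := fun i => (j : ℕ).testBit i

/-- Basis labels `(j, y)` of the registers on which an input oracle acts. -/
abbrev OracleLabel (d : ℕ) : Type := (Fin (indexBits d) → Bool) × ℝ

/-- The Hilbert space on which an input oracle acts: an index register and a real register. -/
abbrev OracleSpace (d : ℕ) : Type := lp (fun _ : OracleLabel d => ℂ) 2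

/-- The basis vector `|j⟩|y⟩`. -/
noncomputable def ket {d : ℕ} (j : Fin (indexBits d) → Bool) (y : ℝ) : OracleSpace d := by
  classical
  exact lp.single 2 (j, y) (1 : ℂ)

/-- `O` is an input oracle for `u`: a unitary operator with `O |j⟩|0⟩ = |j⟩|u_j⟩` for every index
`j`.  Nothing is assumed about its action on other basis vectors. -/
def IsInputOracle {d : ℕ} (O : OracleSpace d ≃ₗᵢ[ℂ] OracleSpace d) (u : Fin d → ℝ) : Prop :=
  ∀ j : Fin d, O (ket (encode j) 0) = ket (encode j) (u j)

/-- The real quantities that one elementary operation computes. -/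
inductive Operation (n m : ℕ) : Type
  /-- a constant -/
  | const (c : ℝ)
  /-- the value `0` or `1` of a qubit -/
  | bit (q : Fin n)
  | add (i j : Fin m)
  | sub (i j : Fin m)
  | mul (i j : Fin m)
  | div (i j : Fin m)

namespace Operation

variable {n m : ℕ}

/-- The value of an operation on the register contents `b`. -/
noncomputable def value (b : Label n m) : Operation n m → ℝ
  | const c => c
  | bit q => if b.1 q then 1 else 0
  | add i j => b.2 i + b.2 j
  | sub i j => b.2 i - b.2 j
  | mul i j => b.2 i * b.2 j
  | div i j => b.2 i / b.2 j

/-- The operation does not read the real register `k`. -/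
def Avoids (k : Fin m) : Operation n m → Prop
  | const _ => True
  | bit _ => True
  | add i j => i ≠ k ∧ j ≠ k
  | sub i j => i ≠ k ∧ j ≠ k
  | mul i j => i ≠ k ∧ j ≠ k
  | div i j => i ≠ k ∧ j ≠ k

end Operation

/-- The instructions of a circuit with oracle access to two vectors in `ℝ^d`. -/
inductive Gate (d n m : ℕ) : Type
  /-- the unitary `U` on the qubit `t`, controlled on the qubits in `C` (at most two) -/
  | qubit (U : Matrix.unitaryGroup Bool ℂ) (C : Finset (Fin n)) (t : Fin n)
      (hC : C.card ≤ 2) (ht : t ∉ C)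
  /-- add the value of `f` to the real register `k` -/
  | addTo (f : Operation n m) (k : Fin m) (hf : f.Avoids k)
  /-- subtract the value of `f` from the real register `k` -/
  | subFrom (f : Operation n m) (k : Fin m) (hf : f.Avoids k)
  /-- flip the qubit `t` if the content of register `i` is at most that of register `j` -/
  | compare (i j : Fin m) (t : Fin n)
  /-- apply the oracle of the first (`second = false`) or second (`second = true`) vector, or its
  inverse (`inv = true`), to the index register formed by the qubits `w` and the real
  register `k` -/
  | query (second inv : Bool) (w : Fin (indexBits d) ↪ Fin n) (k : Fin m)

/-- Whether an instruction is an oracle query. -/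
def Gate.isQuery {d n m : ℕ} : Gate d n m → Bool
  | .query _ _ _ _ => true
  | _ => false

open Classical in
/-- The operator `O` on the index register `w` and the real register `k`, tensored with the identity
on all other registers.  The slice of `ψ` is the vector in the oracle space obtained by fixing the
contents of all other registers.  Slices of square-summable states are square-summable and the
result is again square-summable, so on quantum states the `else` branch is never taken. -/
noncomputable def applyOracle {d n m : ℕ} (O : OracleSpace d ≃ₗᵢ[ℂ] OracleSpace d)
    (w : Fin (indexBits d) ↪ Fin n) (k : Fin m) (ψ : State n m) : State n m := fun b =>
  let slice : OracleLabel d → ℂ := fun p =>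
    ψ (Function.extend w p.1 b.1, Function.update b.2 k p.2)
  if h : Memℓp slice 2 then (O (⟨slice, h⟩ : OracleSpace d)) (fun a => b.1 (w a), b.2 k) else 0

open Classical in
/-- The action of an instruction on states, for oracles `Ou` and `Ov`. -/
noncomputable def Gate.apply {d n m : ℕ} (Ou Ov : OracleSpace d ≃ₗᵢ[ℂ] OracleSpace d) :
    Gate d n m → State n m → State n m
  | .qubit U C t _ _, ψ => fun b =>
      if ∀ c ∈ C, b.1 c = true then
        ∑ s : Bool, (U : Matrix Bool Bool ℂ) (b.1 t) s * ψ (Function.update b.1 t s, b.2)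
      else ψ b
  | .addTo f k _, ψ => fun b => ψ (b.1, Function.update b.2 k (b.2 k - f.value b))
  | .subFrom f k _, ψ => fun b => ψ (b.1, Function.update b.2 k (b.2 k + f.value b))
  | .compare i j t, ψ => fun b =>
      if b.2 i ≤ b.2 j then ψ (Function.update b.1 t (!b.1 t), b.2) else ψ b
  | .query second inv w k, ψ =>
      let O := if second then Ov else Ou
      applyOracle (if inv then O.symm else O) w k ψ

/-- A quantum algorithm with oracle access to two vectors in `ℝ^d`: a circuit, which is run on the
all-zero state and followed by a measurement of all registers in the computational basis.  The
output is the number found in the real register `out`. -/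
structure Algorithm (d : ℕ) : Type where
  qubits : ℕ
  registers : ℕ
  circuit : List (Gate d qubits registers)
  out : Fin registers

namespace Algorithm

variable {d : ℕ}

/-- The number of oracle queries. -/
def queryCount (𝒜 : Algorithm d) : ℕ := 𝒜.circuit.countP (fun g => g.isQuery)

/-- The number of elementary gates (all instructions other than queries). -/
def gateCount (𝒜 : Algorithm d) : ℕ := 𝒜.circuit.countP (fun g => !g.isQuery)

/-- The state before the measurement. -/
noncomputable def finalState (𝒜 : Algorithm d) (Ou Ov : OracleSpace d ≃ₗᵢ[ℂ] OracleSpace d) :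
    State 𝒜.qubits 𝒜.registers :=
  𝒜.circuit.foldl (fun ψ g => g.apply Ou Ov ψ) (initial 𝒜.qubits 𝒜.registers)

open Classical in
/-- The probability that the output lies in the set `S`. -/
noncomputable def outputProb (𝒜 : Algorithm d) (Ou Ov : OracleSpace d ≃ₗᵢ[ℂ] OracleSpace d)
    (S : Set ℝ) : ℝ :=
  ∑' b : Label 𝒜.qubits 𝒜.registers,
    if b.2 𝒜.out ∈ S then ‖𝒜.finalState Ou Ov b‖ ^ 2 else 0

end Algorithm

/-- The `ℓ¹` norm.  (The norm of `Fin d → ℝ` is the maximum norm.) -/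
def l1Norm {d : ℕ} (v : Fin d → ℝ) : ℝ := ∑ j, |v j|

end QuantumIP

/-! The inner product is encoded as a difference of two densities, and both are measured by
amplitude estimation. With `h = A * B / 2 ^ b`, a pair of an index `j < d` and a grid point `k < 2 ^
b` is marked for the sign `±` if `(k + 1) * h ≤ ± u j * v j`. Of the `2 ^ (indexBits d + b)` pairs,
`∑ j, ⌊± u j * v j / h⌋₊` are marked, so the difference of the two densities, times `2 ^ indexBits d
* (A * B)`, is the inner product up to `d * h` (`density_sub_density`). Hölder's inequality bounds
each density by `1 / 2 ^ indexBits d` (`density_markedPoint_le`). A phase known to precision `1 / M`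
gives a density `p` up to `O(√p / M + 1 / M ^ 2)`; after rescaling the error is `O(A * B * √d / M)`,
so `M` of order `A * B * √d / ε` suffices. The smallness of the densities is what turns `d` into
`√d`.

The uniform superposition is a sum of two orthogonal eigenvectors of the Grover iteration with
phases `±2θ`, where `sin θ ^ 2` is the density (`exists_grover_eigenvectors`). Hadamard tests of its
powers yield the binary digits of the phase from the lowest upwards, each test being corrected by
the digits already found (`testOp_apply`, `testsOp_apply`). Eigenvectors survive the tests, so all
`r` rounds share the same two search registers. Given a pair of eigenvectors the rounds are
independent, and the law of the digits is a mixture over the four pairs (`exists_mixture`). A round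
misses one of its phases by more than `32 / 2 ^ t` with probability at most `1 / 6`
(`sum_chain_far`, `sum_pair_bound`), a majority of the rounds is good except with probability `(3 /
4) ^ r` (`majority_bound`), and a cluster mean combines the rounds (`abs_clusterMean_sub_le`).

The oracles are specified only on valid indices with a zero answer register. The circuits copy an
index to the oracle's register only if it is valid, so that queries meet only such inputs and
inverse queries only their images; there the oracles act as permutations of basis labels
(`applyOracle_eq`, `run_markCircuit`).

For `δ` near `1` the budget `log (1 / δ)`, of order `1 - δ`, does not pay for one round at full
precision. A single round with precision `2 ^ g * ε`, whose result is shifted by one of `2 ^ g`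
random offsets, needs `2 ^ g` times fewer queries and still succeeds with probability at least `1 /
4 / 2 ^ g`; one takes `2 ^ g` close to `1 / (4 * (1 - δ))` (`exists_algorithm_of_gt`). -/

namespace QuantumIP

/-! ### Running circuits, and the instructions that permute basis labels. -/

section Semantics

variable {d n m : ℕ}

/-- The state obtained by running a list of instructions. -/
noncomputable def run (Ou Ov : OracleSpace d ≃ₗᵢ[ℂ] OracleSpace d) (C : List (Gate d n m))
    (ψ : State n m) : State n m :=
  C.foldl (fun ψ g => g.apply Ou Ov ψ) ψ

theorem run_nil (Ou Ov : OracleSpace d ≃ₗᵢ[ℂ] OracleSpace d) (ψ : State n m) :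
    run Ou Ov [] ψ = ψ := rfl

theorem run_cons (Ou Ov : OracleSpace d ≃ₗᵢ[ℂ] OracleSpace d) (g : Gate d n m)
    (C : List (Gate d n m)) (ψ : State n m) :
    run Ou Ov (g :: C) ψ = run Ou Ov C (g.apply Ou Ov ψ) := rfl

theorem run_append (Ou Ov : OracleSpace d ≃ₗᵢ[ℂ] OracleSpace d) (C C' : List (Gate d n m))
    (ψ : State n m) : run Ou Ov (C ++ C') ψ = run Ou Ov C' (run Ou Ov C ψ) := by
  simp [run]

/-- The unitary matrix that exchanges the two basis states of a qubit. -/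
noncomputable def pauliX : Matrix.unitaryGroup Bool ℂ :=
  ⟨Matrix.of fun a b => if a = b then 0 else 1, by
    rw [Matrix.mem_unitaryGroup_iff]
    ext a b
    cases a <;> cases b <;> simp [Matrix.mul_apply, Matrix.star_apply]⟩

/-- A diagonal one-qubit unitary. -/
noncomputable def phaseGate (f : Bool → ℂ) (hf : ∀ s, ‖f s‖ = 1) : Matrix.unitaryGroup Bool ℂ :=
  ⟨Matrix.diagonal f, by
    rw [Matrix.mem_unitaryGroup_iff, Matrix.star_eq_conjTranspose, Matrix.diagonal_conjTranspose,
      Matrix.diagonal_mul_diagonal, ← Matrix.diagonal_one]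
    congr 1
    ext s
    simp [Complex.mul_conj, Complex.normSq_eq_norm_sq, hf]⟩

/-- The Hadamard matrix. -/
noncomputable def hadamardGate : Matrix.unitaryGroup Bool ℂ :=
  ⟨Matrix.of fun a b => if a && b then -(1 / (Real.sqrt 2 : ℂ)) else 1 / (Real.sqrt 2 : ℂ), by
    rw [Matrix.mem_unitaryGroup_iff]
    have h : ((Real.sqrt 2 : ℂ))⁻¹ * ((Real.sqrt 2 : ℂ))⁻¹ = 1 / 2 := by
      rw [← mul_inv, ← Complex.ofReal_mul, Real.mul_self_sqrt (by norm_num)]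
      norm_num
    ext a b
    cases a <;> cases b <;> (simp [Matrix.mul_apply, Matrix.star_apply, h]; try norm_num)⟩

/-- Instructions that permute the computational basis. -/
inductive CGate (n m : ℕ) : Type
  | add (f : Operation n m) (k : Fin m) (hf : f.Avoids k)
  | sub (f : Operation n m) (k : Fin m) (hf : f.Avoids k)
  | cmp (i j : Fin m) (t : Fin n)
  | flip (C : Finset (Fin n)) (t : Fin n) (hC : C.card ≤ 2) (ht : t ∉ C)

/-- This makes addition and subtraction inverse to each other: the summand is unaffected by the
register being changed. -/
theorem Operation.value_update {f : Operation n m} {k : Fin m} (hf : f.Avoids k) (b : Label n m)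
    (y : ℝ) : f.value (b.1, Function.update b.2 k y) = f.value b := by
  cases f <;> simp_all [Operation.Avoids, Operation.value]

namespace CGate

/-- The instruction. -/
noncomputable def toGate : CGate n m → Gate d n m
  | add f k hf => .addTo f k hf
  | sub f k hf => .subFrom f k hf
  | cmp i j t => .compare i j t
  | flip C t hC ht => .qubit pauliX C t hC ht

/-- The inverse instruction. -/
def inv : CGate n m → CGate n m
  | add f k hf => sub f k hf
  | sub f k hf => add f k hf
  | cmp i j t => cmp i j t
  | flip C t hC ht => flip C t hC ht

open Classical in
/-- The action on basis labels. -/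
noncomputable def act : CGate n m → Label n m → Label n m
  | add f k _, b => (b.1, Function.update b.2 k (b.2 k + f.value b))
  | sub f k _, b => (b.1, Function.update b.2 k (b.2 k - f.value b))
  | cmp i j t, b => if b.2 i ≤ b.2 j then (Function.update b.1 t (!b.1 t), b.2) else b
  | flip C t _ _, b => if ∀ c ∈ C, b.1 c = true then (Function.update b.1 t (!b.1 t), b.2) else b

theorem act_inv_act (g : CGate n m) (b : Label n m) : g.inv.act (g.act b) = b := by
  cases g with
  | add f k hf => simp [act, inv, Operation.value_update hf]
  | sub f k hf => simp [act, inv, Operation.value_update hf]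
  | cmp i j t => by_cases h : b.2 i ≤ b.2 j <;> simp [act, inv, h]
  | flip C t hC ht =>
    by_cases h : ∀ c ∈ C, b.1 c = true
    · have h' : ∀ c ∈ C, Function.update b.1 t (!b.1 t) c = true := fun c hc => by
        rw [Function.update_of_ne (ne_of_mem_of_not_mem hc ht)]; exact h c hc
      simp only [act, inv, if_pos h]
      rw [if_pos h']
      simp
    · simp only [act, inv, if_neg h]

theorem inv_inv (g : CGate n m) : g.inv.inv = g := by cases g <;> rfl

/-- The permutation of basis labels. -/
noncomputable def perm (g : CGate n m) : Equiv.Perm (Label n m) where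
  toFun := g.act
  invFun := g.inv.act
  left_inv := g.act_inv_act
  right_inv b := by simpa [inv_inv] using g.inv.act_inv_act b

theorem perm_inv (g : CGate n m) : g.inv.perm = g.perm.symm := by
  ext1 b; rfl

/-- Amplitudes are functions of labels, so a permutation of labels moves them by composition with
its inverse. -/
theorem apply_toGate (Ou Ov : OracleSpace d ≃ₗᵢ[ℂ] OracleSpace d) (g : CGate n m)
    (ψ : State n m) : (g.toGate : Gate d n m).apply Ou Ov ψ = fun b => ψ (g.perm.symm b) := by
  funext b
  cases g with
  | add f k hf => rfl
  | sub f k hf => rfl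
  | cmp i j t =>
    by_cases h : b.2 i ≤ b.2 j <;> simp [toGate, Gate.apply, perm, inv, act, h]
  | flip C t hC ht =>
    by_cases h : ∀ c ∈ C, b.1 c = true
    · simp only [toGate, Gate.apply, perm, inv, act, Equiv.coe_fn_symm_mk, if_pos h]
      cases hb : b.1 t <;> simp [pauliX]
    · simp only [toGate, Gate.apply, perm, inv, act, Equiv.coe_fn_symm_mk, if_neg h]

/-- The permutation of basis labels performed by a list of instructions. -/
noncomputable def permL : List (CGate n m) → Equiv.Perm (Label n m)
  | [] => Equiv.refl _
  | g :: l => g.perm.trans (permL l)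

theorem permL_append (l l' : List (CGate n m)) (b : Label n m) :
    permL (l ++ l') b = permL l' (permL l b) := by
  induction l generalizing b with
  | nil => rfl
  | cons g l ih => exact ih _

/-- The inverse of a list of instructions. -/
def invL (l : List (CGate n m)) : List (CGate n m) := (l.map inv).reverse

theorem permL_invL (l : List (CGate n m)) : permL (invL l) = (permL l).symm := by
  induction l with
  | nil => rfl
  | cons g l ih =>
    ext1 b
    have : invL (g :: l) = invL l ++ [g.inv] := by simp [invL]
    rw [this, permL_append, ih]
    simp [permL, perm_inv]

/-- The instructions of a list of basis permutations. -/
noncomputable def gates (d : ℕ) (l : List (CGate n m)) : List (Gate d n m) := l.map toGate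

theorem run_gates (Ou Ov : OracleSpace d ≃ₗᵢ[ℂ] OracleSpace d) (l : List (CGate n m))
    (ψ : State n m) : run Ou Ov (gates d l) ψ = fun b => ψ ((permL l).symm b) := by
  induction l generalizing ψ with
  | nil => rfl
  | cons g l ih =>
    rw [gates, List.map_cons, run_cons, ← gates, ih, apply_toGate]
    rfl

end CGate

end Semantics

end QuantumIP

namespace QuantumIP

/-! ### Compilation of arithmetic expressions into reversible circuits. -/

section Expressions

/-- An assignment of the qubits and real registers of a circuit: `core` qubits, an index register,
the two registers that receive the answers of the oracles, and `N + 1` auxiliary qubits and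
registers. -/
structure Layout (Q : Type) (d N n m : ℕ) where
  core : Q ↪ Fin n
  idx : Fin (indexBits d) ↪ Fin n
  flagEmb : Fin (N + 1) ↪ Fin n
  regEmb : Fin (N + 1) ↪ Fin m
  ru : Fin m
  rv : Fin m
  core_ne_idx : ∀ q i, core q ≠ idx i
  core_ne_flag : ∀ q i, core q ≠ flagEmb i
  idx_ne_flag : ∀ q i, idx q ≠ flagEmb i
  ru_ne_rv : ru ≠ rv
  ru_ne_reg : ∀ i, ru ≠ regEmb i
  rv_ne_reg : ∀ i, rv ≠ regEmb i

/-- The arithmetic operations on two registers. -/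
inductive Arith : Type
  | add | sub | mul | div

namespace Arith

/-- The operation of the arithmetic model. -/
def op {n m : ℕ} (i j : Fin m) : Arith → Operation n m
  | add => .add i j
  | sub => .sub i j
  | mul => .mul i j
  | div => .div i j

/-- The operation on real numbers. -/
noncomputable def fn (x y : ℝ) : Arith → ℝ
  | add => x + y
  | sub => x - y
  | mul => x * y
  | div => x / y

theorem avoids_op {n m : ℕ} {i j k : Fin m} (o : Arith) (hi : i ≠ k) (hj : j ≠ k) :
    (o.op i j : Operation n m).Avoids k := by
  cases o <;> exact ⟨hi, hj⟩

theorem value_op {n m : ℕ} (i j : Fin m) (o : Arith) (b : Label n m) :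
    (o.op i j).value b = o.fn (b.2 i) (b.2 j) := by
  cases o <;> rfl

end Arith

/-- Arithmetic expressions in qubit values and in the product of the two oracle registers.  The
expression `le e f` has the value `1` if `e ≤ f` and `0` otherwise. -/
inductive Expr (Q : Type) : Type
  | const (c : ℝ)
  | bit (q : Q)
  | prod
  | bin (o : Arith) (e f : Expr Q)
  | le (e f : Expr Q)

namespace Expr

variable {Q : Type} {d N n m : ℕ}

open Classical in
/-- The value of an expression. -/
noncomputable def eval (x : Q → Bool) (p : ℝ) : Expr Q → ℝ
  | const c => c
  | bit q => if x q then 1 else 0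
  | prod => p
  | bin o e f => o.fn (e.eval x p) (f.eval x p)
  | le e f => if e.eval x p ≤ f.eval x p then 1 else 0

open Classical in
/-- The truth value of a comparison. -/
noncomputable def test (x : Q → Bool) (p : ℝ) : Expr Q → Bool
  | le e f => decide (e.eval x p ≤ f.eval x p)
  | _ => false

/-- The number of nodes. -/
def size : Expr Q → ℕ
  | const _ => 1
  | bit _ => 1
  | prod => 1
  | bin _ e f => e.size + f.size + 1
  | le e f => e.size + f.size + 1

theorem size_pos (e : Expr Q) : 0 < e.size := by cases e <;> simp [size]

end Expr

namespace Layout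

variable {Q : Type} {d N n m : ℕ}

/-- The `k`-th auxiliary qubit. -/
def flag (ℒ : Layout Q d N n m) (k : ℕ) : Fin n := ℒ.flagEmb (Fin.ofNat (N + 1) k)

/-- The `k`-th auxiliary register. -/
def reg (ℒ : Layout Q d N n m) (k : ℕ) : Fin m := ℒ.regEmb (Fin.ofNat (N + 1) k)

theorem flag_ne (ℒ : Layout Q d N n m) {i j : ℕ} (hi : i ≤ N) (hj : j ≤ N) (h : i ≠ j) :
    ℒ.flag i ≠ ℒ.flag j := by
  intro e
  have := congrArg Fin.val (ℒ.flagEmb.injective e)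
  simp only [Fin.ofNat_eq_cast, Fin.val_natCast] at this
  rw [Nat.mod_eq_of_lt (by omega), Nat.mod_eq_of_lt (by omega)] at this
  exact h this

theorem reg_ne (ℒ : Layout Q d N n m) {i j : ℕ} (hi : i ≤ N) (hj : j ≤ N) (h : i ≠ j) :
    ℒ.reg i ≠ ℒ.reg j := by
  intro e
  have := congrArg Fin.val (ℒ.regEmb.injective e)
  simp only [Fin.ofNat_eq_cast, Fin.val_natCast] at this
  rw [Nat.mod_eq_of_lt (by omega), Nat.mod_eq_of_lt (by omega)] at this
  exact h this

open Classical in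
/-- Add the value of `f` to the register `k`, which `f` must not read. -/
noncomputable def addGate (f : Operation n m) (k : Fin m) : CGate n m :=
  if h : f.Avoids k then .add f k h else .add (.const 0) k trivial

theorem perm_addGate {f : Operation n m} {k : Fin m} (h : f.Avoids k) (b : Label n m) :
    (addGate f k).perm b = (b.1, Function.update b.2 k (b.2 k + f.value b)) := by
  simp only [addGate, dif_pos h]
  rfl

/-- A circuit that computes an expression into the auxiliary register `k`. -/
noncomputable def compile (ℒ : Layout Q d N n m) : Expr Q → ℕ → List (CGate n m)
  | .const c, k => [addGate (.const c) (ℒ.reg k)]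
  | .bit q, k => [addGate (.bit (ℒ.core q)) (ℒ.reg k)]
  | .prod, k => [addGate (.mul ℒ.ru ℒ.rv) (ℒ.reg k)]
  | .bin o e f, k => ℒ.compile e (k + 1) ++ (ℒ.compile f (k + 1 + e.size) ++
      [addGate (o.op (ℒ.reg (k + 1)) (ℒ.reg (k + 1 + e.size))) (ℒ.reg k)])
  | .le e f, k => ℒ.compile e (k + 1) ++ (ℒ.compile f (k + 1 + e.size) ++
      [.cmp (ℒ.reg (k + 1)) (ℒ.reg (k + 1 + e.size)) (ℒ.flag k),
        addGate (.bit (ℒ.flag k)) (ℒ.reg k)])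

theorem length_compile (ℒ : Layout Q d N n m) (e : Expr Q) (k : ℕ) :
    (ℒ.compile e k).length ≤ 2 * e.size := by
  induction e generalizing k with
  | const c => simp [compile, Expr.size]
  | bit q => simp [compile, Expr.size]
  | prod => simp [compile, Expr.size]
  | bin o e f he hf =>
    have := he (k + 1)
    have := hf (k + 1 + e.size)
    simp only [compile, Expr.size, List.length_append, List.length_cons, List.length_nil]
    omega
  | le e f he hf =>
    have := he (k + 1)
    have := hf (k + 1 + e.size)
    simp only [compile, Expr.size, List.length_append, List.length_cons, List.length_nil]
    omega

/-- The auxiliary resources with numbers in `[k, l)` are zero. -/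
def Fresh (ℒ : Layout Q d N n m) (k l : ℕ) (b : Label n m) : Prop :=
  ∀ i, k ≤ i → i < l → b.2 (ℒ.reg i) = 0 ∧ b.1 (ℒ.flag i) = false

/-- The labels `b` and `b'` differ only in auxiliary resources with numbers in `[k, l)`. -/
def SameOff (ℒ : Layout Q d N n m) (k l : ℕ) (b b' : Label n m) : Prop :=
  (∀ ρ, (∀ i, k ≤ i → i < l → ρ ≠ ℒ.reg i) → b'.2 ρ = b.2 ρ) ∧
    ∀ q, (∀ i, k ≤ i → i < l → q ≠ ℒ.flag i) → b'.1 q = b.1 q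

theorem SameOff.mono {ℒ : Layout Q d N n m} {k l k' l' : ℕ} {b b' : Label n m}
    (h : ℒ.SameOff k l b b') (hk : k' ≤ k) (hl : l ≤ l') : ℒ.SameOff k' l' b b' :=
  ⟨fun ρ hρ => h.1 ρ fun i h1 h2 => hρ i (hk.trans h1) (h2.trans_le hl),
    fun q hq => h.2 q fun i h1 h2 => hq i (hk.trans h1) (h2.trans_le hl)⟩

theorem SameOff.trans {ℒ : Layout Q d N n m} {k l : ℕ} {b b' b'' : Label n m}
    (h : ℒ.SameOff k l b b') (h' : ℒ.SameOff k l b' b'') : ℒ.SameOff k l b b'' :=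
  ⟨fun ρ hρ => (h'.1 ρ hρ).trans (h.1 ρ hρ), fun q hq => (h'.2 q hq).trans (h.2 q hq)⟩

theorem SameOff.core {ℒ : Layout Q d N n m} {k l : ℕ} {b b' : Label n m}
    (h : ℒ.SameOff k l b b') (q : Q) : b'.1 (ℒ.core q) = b.1 (ℒ.core q) :=
  h.2 _ fun _ _ _ => ℒ.core_ne_flag q _

theorem SameOff.ru {ℒ : Layout Q d N n m} {k l : ℕ} {b b' : Label n m}
    (h : ℒ.SameOff k l b b') : b'.2 ℒ.ru = b.2 ℒ.ru := h.1 _ fun _ _ _ => ℒ.ru_ne_reg _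

theorem SameOff.rv {ℒ : Layout Q d N n m} {k l : ℕ} {b b' : Label n m}
    (h : ℒ.SameOff k l b b') : b'.2 ℒ.rv = b.2 ℒ.rv := h.1 _ fun _ _ _ => ℒ.rv_ne_reg _

theorem SameOff.reg {ℒ : Layout Q d N n m} {k l : ℕ} {b b' : Label n m}
    (h : ℒ.SameOff k l b b') (hl : l ≤ N + 1) {j : ℕ} (hj : j ≤ N) (hj' : j < k ∨ l ≤ j) :
    b'.2 (ℒ.reg j) = b.2 (ℒ.reg j) :=
  h.1 _ fun _ _ _ => ℒ.reg_ne hj (by omega) (by omega)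

theorem SameOff.flag {ℒ : Layout Q d N n m} {k l : ℕ} {b b' : Label n m}
    (h : ℒ.SameOff k l b b') (hl : l ≤ N + 1) {j : ℕ} (hj : j ≤ N) (hj' : j < k ∨ l ≤ j) :
    b'.1 (ℒ.flag j) = b.1 (ℒ.flag j) :=
  h.2 _ fun _ _ _ => ℒ.flag_ne hj (by omega) (by omega)

theorem SameOff.fresh {ℒ : Layout Q d N n m} {k l : ℕ} {b b' : Label n m}
    (h : ℒ.SameOff k l b b') (hl : l ≤ N + 1) {k' l' : ℕ} (hb : ℒ.Fresh k' l' b)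
    (hl' : l' ≤ N + 1) (hd : l' ≤ k ∨ l ≤ k') : ℒ.Fresh k' l' b' := fun i h1 h2 => by
  rw [h.reg hl (by omega) (by omega), h.flag hl (by omega) (by omega)]
  exact hb i h1 h2

theorem Fresh.mono {ℒ : Layout Q d N n m} {k l k' l' : ℕ} {b : Label n m}
    (h : ℒ.Fresh k l b) (hk : k ≤ k') (hl : l' ≤ l) : ℒ.Fresh k' l' b :=
  fun i h1 h2 => h i (hk.trans h1) (h2.trans_le hl)

theorem sameOff_update_reg (ℒ : Layout Q d N n m) {k l j : ℕ} (b : Label n m) (y : ℝ)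
    (hj : k ≤ j) (hj' : j < l) : ℒ.SameOff k l b (b.1, Function.update b.2 (ℒ.reg j) y) :=
  ⟨fun _ hρ => Function.update_of_ne (hρ j hj hj') _ _, fun _ _ => rfl⟩

theorem sameOff_update_flag (ℒ : Layout Q d N n m) {k l j : ℕ} (b : Label n m) (y : Bool)
    (hj : k ≤ j) (hj' : j < l) : ℒ.SameOff k l b (Function.update b.1 (ℒ.flag j) y, b.2) :=
  ⟨fun _ _ => rfl, fun _ hq => Function.update_of_ne (hq j hj hj') _ _⟩

/-- The node at slot `k` owns the slots from `k` to `k + e.size`: its result goes to slot `k`, and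
its subexpressions occupy the two consecutive blocks after it. Intermediate values are left behind;
`SameOff` confines them to the block, and the inverse list erases them later. The truth value of a
top-level comparison stays in a qubit, where it can control other gates. -/
theorem compile_spec (ℒ : Layout Q d N n m) (e : Expr Q) (k : ℕ) (hk : k + e.size ≤ N + 1)
    (b : Label n m) (hb : ℒ.Fresh k (k + e.size) b) :
    (CGate.permL (ℒ.compile e k) b).2 (ℒ.reg k) =
        e.eval (fun q => b.1 (ℒ.core q)) (b.2 ℒ.ru * b.2 ℒ.rv) ∧
      (CGate.permL (ℒ.compile e k) b).1 (ℒ.flag k) =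
        e.test (fun q => b.1 (ℒ.core q)) (b.2 ℒ.ru * b.2 ℒ.rv) ∧
      ℒ.SameOff k (k + e.size) b (CGate.permL (ℒ.compile e k) b) := by
  induction e generalizing k b with
  | const c =>
    have h0 := hb k le_rfl (by simp [Expr.size])
    have hg := perm_addGate (n := n) (k := ℒ.reg k) (f := .const c) trivial b
    simp only [compile, CGate.permL, Equiv.trans_apply, Equiv.refl_apply, hg, Expr.eval, Expr.test]
    refine ⟨by simp [h0, Operation.value], h0.2,
      ℒ.sameOff_update_reg b _ le_rfl (by simp [Expr.size])⟩
  | bit q =>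
    have h0 := hb k le_rfl (by simp [Expr.size])
    have hg := perm_addGate (k := ℒ.reg k) (f := .bit (ℒ.core q)) trivial b
    simp only [compile, CGate.permL, Equiv.trans_apply, Equiv.refl_apply, hg, Expr.eval, Expr.test]
    refine ⟨by simp [h0, Operation.value], h0.2,
      ℒ.sameOff_update_reg b _ le_rfl (by simp [Expr.size])⟩
  | prod =>
    have h0 := hb k le_rfl (by simp [Expr.size])
    have hg := perm_addGate (n := n) (k := ℒ.reg k) (f := .mul ℒ.ru ℒ.rv)
      ⟨ℒ.ru_ne_reg _, ℒ.rv_ne_reg _⟩ b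
    simp only [compile, CGate.permL, Equiv.trans_apply, Equiv.refl_apply, hg, Expr.eval, Expr.test]
    refine ⟨by simp [h0, Operation.value], h0.2,
      ℒ.sameOff_update_reg b _ le_rfl (by simp [Expr.size])⟩
  | bin o e f he hf =>
    have hs : (Expr.bin o e f).size = e.size + f.size + 1 := rfl
    rw [hs] at hk hb ⊢
    have hfp := f.size_pos
    obtain ⟨e1, -, e3⟩ := he (k + 1) (by omega) b (hb.mono (by omega) (by omega))
    set b1 := CGate.permL (ℒ.compile e (k + 1)) b with hb1
    obtain ⟨f1, -, f3⟩ := hf (k + 1 + e.size) (by omega) b1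
      (e3.fresh (by omega) (hb.mono (by omega) (by omega)) (by omega) (by omega))
    set b2 := CGate.permL (ℒ.compile f (k + 1 + e.size)) b1 with hb2
    have h02 : ℒ.Fresh k (k + 1) b2 := f3.fresh (by omega)
      (e3.fresh (by omega) (hb.mono (by omega) (by omega)) (by omega) (by omega))
      (by omega) (by omega)
    have h0 := h02 k le_rfl (by omega)
    have hg := perm_addGate (n := n) (k := ℒ.reg k)
      (f := o.op (ℒ.reg (k + 1)) (ℒ.reg (k + 1 + e.size)))
      (o.avoids_op (ℒ.reg_ne (by omega) (by omega) (by omega))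
        (ℒ.reg_ne (by omega) (by omega) (by omega))) b2
    simp only [compile, CGate.permL_append, ← hb1, ← hb2, CGate.permL, Equiv.trans_apply,
      Equiv.refl_apply, hg, Expr.eval, Expr.test]
    refine ⟨?_, h0.2, ?_⟩
    · simp only [Function.update_self, h0.1, zero_add, Arith.value_op, f1,
        f3.reg (j := k + 1) (by omega) (by omega) (by have := e.size_pos; omega), e1, e3.core,
        e3.ru, e3.rv]
    · exact ((e3.mono (by omega) (by omega)).trans (f3.mono (by omega) (by omega))).trans
        (ℒ.sameOff_update_reg b2 _ le_rfl (by omega))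
  | le e f he hf =>
    have hs : (Expr.le e f).size = e.size + f.size + 1 := rfl
    rw [hs] at hk hb ⊢
    have hfp := f.size_pos
    obtain ⟨e1, -, e3⟩ := he (k + 1) (by omega) b (hb.mono (by omega) (by omega))
    set b1 := CGate.permL (ℒ.compile e (k + 1)) b with hb1
    obtain ⟨f1, -, f3⟩ := hf (k + 1 + e.size) (by omega) b1
      (e3.fresh (by omega) (hb.mono (by omega) (by omega)) (by omega) (by omega))
    set b2 := CGate.permL (ℒ.compile f (k + 1 + e.size)) b1 with hb2
    have h02 : ℒ.Fresh k (k + 1) b2 := f3.fresh (by omega)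
      (e3.fresh (by omega) (hb.mono (by omega) (by omega)) (by omega) (by omega))
      (by omega) (by omega)
    have h0 := h02 k le_rfl (by omega)
    -- The flag was still false, so flipping it conditionally writes the truth value of the
    -- comparison.
    have hc : (CGate.cmp (ℒ.reg (k + 1)) (ℒ.reg (k + 1 + e.size)) (ℒ.flag k)).perm b2 =
        (Function.update b2.1 (ℒ.flag k)
          ((Expr.le e f).test (fun q => b.1 (ℒ.core q)) (b.2 ℒ.ru * b.2 ℒ.rv)), b2.2) := by
      have e1' : b2.2 (ℒ.reg (k + 1)) = e.eval (fun q => b.1 (ℒ.core q)) (b.2 ℒ.ru * b.2 ℒ.rv) := by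
        rw [f3.reg (j := k + 1) (by omega) (by omega) (by have := e.size_pos; omega), e1]
      have f1' : b2.2 (ℒ.reg (k + 1 + e.size)) =
          f.eval (fun q => b.1 (ℒ.core q)) (b.2 ℒ.ru * b.2 ℒ.rv) := by
        rw [f1]; simp only [e3.core, e3.ru, e3.rv]
      simp only [CGate.perm, Equiv.coe_fn_mk, CGate.act, e1', f1', Expr.test, h0.2]
      split_ifs with h
      · simp [h]
      · simp only [h, decide_false]
        rw [← h0.2, Function.update_eq_self]
    set b3 := (CGate.cmp (ℒ.reg (k + 1)) (ℒ.reg (k + 1 + e.size)) (ℒ.flag k)).perm b2 with hb3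
    have hg := perm_addGate (n := n) (k := ℒ.reg k) (f := .bit (ℒ.flag k)) trivial b3
    simp only [compile, CGate.permL_append, ← hb1, ← hb2, CGate.permL, Equiv.trans_apply,
      Equiv.refl_apply, ← hb3, hg]
    refine ⟨?_, ?_, ?_⟩
    · rw [hc]
      simp only [Function.update_self, h0.1, zero_add, Operation.value, Expr.test, Expr.eval]
      split_ifs <;> simp_all
    · rw [hc]
      simp
    · refine (((e3.mono (by omega) (by omega)).trans (f3.mono (by omega) (by omega))).trans
        ?_).trans (ℒ.sameOff_update_reg b3 _ le_rfl (by omega))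
      rw [hc]
      exact ℒ.sameOff_update_flag b2 _ le_rfl (by omega)

end Layout

end Expressions

end QuantumIP

namespace QuantumIP

/-! ### Oracles on the inputs for which they are specified. -/

section Queries

variable {d n m : ℕ}

theorem encode_injective : Function.Injective (encode : Fin d → Fin (indexBits d) → Bool) := by
  intro i j h
  apply Fin.ext
  apply Nat.eq_of_testBit_eq
  intro k
  have hd : d ≤ 2 ^ indexBits d := Nat.le_pow_clog (by norm_num) d
  by_cases hk : k < indexBits d
  · exact congrFun h ⟨k, hk⟩
  · have h2 : 2 ^ indexBits d ≤ 2 ^ k := Nat.pow_le_pow_right (by norm_num) (not_lt.mp hk)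
    rw [Nat.testBit_lt_two_pow (i.2.trans_le (hd.trans h2)),
      Nat.testBit_lt_two_pow (j.2.trans_le (hd.trans h2))]

open Classical in
/-- The extension of a vector to all contents of the index register by zero. -/
noncomputable def pad (u : Fin d → ℝ) (p : Fin (indexBits d) → Bool) : ℝ :=
  if h : ∃ j, encode j = p then u h.choose else 0

theorem pad_encode (u : Fin d → ℝ) (j : Fin d) : pad u (encode j) = u j := by
  have h : ∃ i, encode i = encode j := ⟨j, rfl⟩
  rw [pad, dif_pos h, encode_injective h.choose_spec]

/-- The support condition makes every slice of the state a finite combination of the basis vectors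
on which `O` is known; linearity does the rest. The answer before is `x` and after is `y`: the
oracle has `x = 0`, `y = u`, and its inverse has these exchanged. -/
theorem applyOracle_eq {O : OracleSpace d ≃ₗᵢ[ℂ] OracleSpace d} {x y : Fin d → ℝ}
    (hO : ∀ j, O (ket (encode j) (x j)) = ket (encode j) (y j))
    (w : Fin (indexBits d) ↪ Fin n) (k : Fin m) (ψ : State n m)
    (hψ : ∀ b, ψ b ≠ 0 → ∃ j, (encode j = fun i => b.1 (w i)) ∧ b.2 k = x j) :
    applyOracle O w k ψ = fun b => ψ (b.1, Function.update b.2 k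
      (b.2 k - (pad y (fun i => b.1 (w i)) - pad x (fun i => b.1 (w i))))) := by
  classical
  funext b
  set c : Fin d → ℂ := fun j =>
    ψ (Function.extend w (encode j) b.1, Function.update b.2 k (x j)) with hc
  set φ : OracleSpace d := ∑ j, c j • ket (encode j) (x j) with hφ
  have hket : ∀ (p : OracleLabel d) (z : Fin d → ℝ),
      ((∑ j, c j • ket (encode j) (z j) : OracleSpace d) : OracleLabel d → ℂ) p =
        ∑ j, if p = (encode j, z j) then c j else 0 := by
    intro p z
    simp only [lp.coeFn_sum, Finset.sum_apply, lp.coeFn_smul, Pi.smul_apply, ket, lp.single_apply,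
      smul_eq_mul]
    refine Finset.sum_congr rfl fun j _ => ?_
    split_ifs with h
    · subst h; simp
    · rw [Pi.single_eq_of_ne h, mul_zero]
  have hext : ∀ p : Fin (indexBits d) → Bool, (fun i => Function.extend w p b.1 (w i)) = p :=
    fun p => funext fun i => w.injective.extend_apply _ _ _
  -- A nonzero amplitude in the slice forces a valid index and the content `x j`; being a finite
  -- combination, the slice is also square-summable.
  have hslice : (fun p : OracleLabel d =>
      ψ (Function.extend w p.1 b.1, Function.update b.2 k p.2)) = φ := by
    funext p
    rw [hφ, hket]
    by_cases hp : ∃ j, p = (encode j, x j)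
    · obtain ⟨j, rfl⟩ := hp
      rw [Finset.sum_eq_single j]
      · simp [hc]
      · intro i _ hij
        rw [if_neg]
        intro h
        exact hij (encode_injective (Prod.ext_iff.mp h).1).symm
      · simp
    · rw [Finset.sum_eq_zero fun j _ => if_neg fun h => hp ⟨j, h⟩]
      by_contra hne
      obtain ⟨j, h1, h2⟩ := hψ _ hne
      simp only [hext, Function.update_self] at h1 h2
      exact hp ⟨j, Prod.ext h1.symm h2⟩
  have hmem : Memℓp (fun p : OracleLabel d =>
      ψ (Function.extend w p.1 b.1, Function.update b.2 k p.2)) 2 := by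
    rw [hslice]; exact φ.2
  have happ : applyOracle O w k ψ b = O φ (fun a => b.1 (w a), b.2 k) := by
    simp only [applyOracle]
    rw [dif_pos hmem]
    have : (⟨_, hmem⟩ : OracleSpace d) = φ := Subtype.ext hslice
    rw [this]
  rw [happ, hφ, map_sum]
  simp only [map_smul, hO]
  rw [hket]
  by_cases hw : ∃ j, encode j = fun i => b.1 (w i)
  · obtain ⟨j, hj⟩ := hw
    rw [← hj, pad_encode, pad_encode, Finset.sum_eq_single j]
    · split_ifs with h
      · have h2 : b.2 k = y j := (Prod.ext_iff.mp h).2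
        simp only [hc, h2, sub_sub_cancel]
        congr 2
        funext q
        by_cases hq : ∃ i, w i = q
        · obtain ⟨i, rfl⟩ := hq
          rw [w.injective.extend_apply, hj]
        · exact Function.extend_apply' _ _ _ hq
      · by_contra hne
        obtain ⟨i, h1, h2⟩ := hψ _ (Ne.symm hne)
        have hij : i = j := encode_injective (h1.trans hj.symm)
        simp only [Function.update_self, hij] at h2
        exact h (Prod.ext rfl (by linarith : b.2 k = y j))
    · intro i _ hij
      rw [if_neg]
      intro h
      exact hij (encode_injective (Prod.ext_iff.mp h).1).symm
    · simp
  -- At a label with an invalid index both sides vanish, again by the support condition.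
  · rw [Finset.sum_eq_zero fun j _ => if_neg fun h => hw ⟨j, (Prod.ext_iff.mp h).1.symm⟩]
    by_contra hne
    obtain ⟨j, h1, -⟩ := hψ _ (Ne.symm hne)
    exact hw ⟨j, h1⟩

theorem pad_zero (p : Fin (indexBits d) → Bool) : pad (fun _ : Fin d => 0) p = 0 := by
  simp [pad]

/-- The permutation of basis labels which adds a function of the qubits to a register. -/
noncomputable def addPerm (k : Fin m) (f : (Fin n → Bool) → ℝ) : Equiv.Perm (Label n m) where
  toFun b := (b.1, Function.update b.2 k (b.2 k + f b.1))
  invFun b := (b.1, Function.update b.2 k (b.2 k - f b.1))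
  left_inv b := by simp
  right_inv b := by simp

theorem query_eq {O : OracleSpace d ≃ₗᵢ[ℂ] OracleSpace d} {u : Fin d → ℝ} (hO : IsInputOracle O u)
    (w : Fin (indexBits d) ↪ Fin n) (k : Fin m) (ψ : State n m)
    (hψ : ∀ b, ψ b ≠ 0 → (∃ j, encode j = fun i => b.1 (w i)) ∧ b.2 k = 0) :
    applyOracle O w k ψ =
      fun b => ψ ((addPerm k fun x => pad u fun i => x (w i)).symm b) := by
  rw [applyOracle_eq (x := fun _ => 0) (y := u) hO w k ψ fun b hb => by
    obtain ⟨⟨j, h1⟩, h2⟩ := hψ b hb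
    exact ⟨j, h1, h2⟩]
  funext b
  simp [addPerm, pad_zero]

theorem query_symm_eq {O : OracleSpace d ≃ₗᵢ[ℂ] OracleSpace d} {u : Fin d → ℝ}
    (hO : IsInputOracle O u) (w : Fin (indexBits d) ↪ Fin n) (k : Fin m) (ψ : State n m)
    (hψ : ∀ b, ψ b ≠ 0 → (∃ j, encode j = fun i => b.1 (w i)) ∧
      b.2 k = pad u fun i => b.1 (w i)) :
    applyOracle O.symm w k ψ = fun b => ψ ((addPerm k fun x => pad u fun i => x (w i)) b) := by
  rw [applyOracle_eq (x := u) (y := fun _ => 0) (fun j => by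
      rw [LinearIsometryEquiv.symm_apply_eq]; exact (hO j).symm) w k ψ fun b hb => by
    obtain ⟨⟨j, h1⟩, h2⟩ := hψ b hb
    exact ⟨j, h1, by rw [h2, ← h1, pad_encode]⟩]
  funext b
  simp [addPerm, pad_zero]

theorem apply_query_first (Ou Ov : OracleSpace d ≃ₗᵢ[ℂ] OracleSpace d)
    (w : Fin (indexBits d) ↪ Fin n) (k : Fin m) (ψ : State n m) :
    (Gate.query false false w k : Gate d n m).apply Ou Ov ψ = applyOracle Ou w k ψ := rfl

theorem apply_query_second (Ou Ov : OracleSpace d ≃ₗᵢ[ℂ] OracleSpace d)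
    (w : Fin (indexBits d) ↪ Fin n) (k : Fin m) (ψ : State n m) :
    (Gate.query true false w k : Gate d n m).apply Ou Ov ψ = applyOracle Ov w k ψ := rfl

theorem apply_query_first_inv (Ou Ov : OracleSpace d ≃ₗᵢ[ℂ] OracleSpace d)
    (w : Fin (indexBits d) ↪ Fin n) (k : Fin m) (ψ : State n m) :
    (Gate.query false true w k : Gate d n m).apply Ou Ov ψ = applyOracle Ou.symm w k ψ := rfl

theorem apply_query_second_inv (Ou Ov : OracleSpace d ≃ₗᵢ[ℂ] OracleSpace d)
    (w : Fin (indexBits d) ↪ Fin n) (k : Fin m) (ψ : State n m) :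
    (Gate.query true true w k : Gate d n m).apply Ou Ov ψ = applyOracle Ov.symm w k ψ := rfl

theorem apply_phaseGate (Ou Ov : OracleSpace d ≃ₗᵢ[ℂ] OracleSpace d) (f : Bool → ℂ)
    (hf : ∀ s, ‖f s‖ = 1) (C : Finset (Fin n)) (t : Fin n) (hC : C.card ≤ 2) (ht : t ∉ C)
    (ψ : State n m) :
    (Gate.qubit (phaseGate f hf) C t hC ht : Gate d n m).apply Ou Ov ψ =
      fun b => (if ∀ c ∈ C, b.1 c = true then f (b.1 t) else 1) * ψ b := by
  funext b
  simp only [Gate.apply, phaseGate]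
  split_ifs with h
  · cases hb : b.1 t <;> simp [Matrix.diagonal_apply, ← hb]
  · simp

end Queries

/-! ### The phase flip at marked points, implemented with queries and uncomputation. -/

namespace Layout

variable {Q : Type} {d N n m : ℕ}

/-- All real registers and all qubits other than the core qubits are zero. -/
def Clean (ℒ : Layout Q d N n m) (b : Label n m) : Prop :=
  b.2 = 0 ∧ ∀ q, (∀ a, q ≠ ℒ.core a) → b.1 q = false

theorem Clean.fresh {ℒ : Layout Q d N n m} {b : Label n m} (h : ℒ.Clean b) (k l : ℕ) :
    ℒ.Fresh k l b :=
  fun _ _ _ => ⟨by rw [h.1]; rfl, h.2 _ fun a => (ℒ.core_ne_flag a _).symm⟩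

/-- The gates which copy the qubits `j` to the index register, controlled on the first flag. -/
def copyGates (ℒ : Layout Q d N n m) (j : Fin (indexBits d) → Q)
    (l : List (Fin (indexBits d))) : List (CGate n m) :=
  l.map fun i => .flip {ℒ.flag 0, ℒ.core (j i)} (ℒ.idx i) Finset.card_le_two (by
    simp only [Finset.mem_insert, Finset.mem_singleton, not_or]
    exact ⟨ℒ.idx_ne_flag i _, (ℒ.core_ne_idx _ i).symm⟩)

theorem permL_copyGates (ℒ : Layout Q d N n m) (j : Fin (indexBits d) → Q)
    (l : List (Fin (indexBits d))) (hl : l.Nodup) (b : Label n m) :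
    (CGate.permL (ℒ.copyGates j l) b).2 = b.2 ∧
      (∀ q, (∀ i, q ≠ ℒ.idx i) → (CGate.permL (ℒ.copyGates j l) b).1 q = b.1 q) ∧
      ∀ i, (CGate.permL (ℒ.copyGates j l) b).1 (ℒ.idx i) =
        if i ∈ l then (b.1 (ℒ.idx i) ^^ (b.1 (ℒ.flag 0) && b.1 (ℒ.core (j i))))
        else b.1 (ℒ.idx i) := by
  induction l generalizing b with
  | nil => simp [copyGates, CGate.permL]
  | cons a l ih =>
    set g : CGate n m := .flip {ℒ.flag 0, ℒ.core (j a)} (ℒ.idx a) Finset.card_le_two (by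
      simp only [Finset.mem_insert, Finset.mem_singleton, not_or]
      exact ⟨ℒ.idx_ne_flag a _, (ℒ.core_ne_idx _ a).symm⟩) with hg
    have hp : CGate.permL (ℒ.copyGates j (a :: l)) b =
        CGate.permL (ℒ.copyGates j l) (g.perm b) := rfl
    have hgb : g.perm b = (Function.update b.1 (ℒ.idx a)
        (b.1 (ℒ.idx a) ^^ (b.1 (ℒ.flag 0) && b.1 (ℒ.core (j a)))), b.2) := by
      simp only [hg, CGate.perm, Equiv.coe_fn_mk, CGate.act, Finset.mem_insert,
        Finset.mem_singleton, forall_eq_or_imp, forall_eq]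
      cases h1 : b.1 (ℒ.flag 0) <;> cases h2 : b.1 (ℒ.core (j a)) <;> simp
    obtain ⟨i1, i2, i3⟩ := ih (List.nodup_cons.mp hl).2 (g.perm b)
    rw [hp]
    refine ⟨i1.trans (by rw [hgb]), fun q hq => (i2 q hq).trans ?_, fun i => (i3 i).trans ?_⟩
    · rw [hgb]; exact Function.update_of_ne (hq a) _ _
    · have hf : ℒ.flag 0 ≠ ℒ.idx a := (ℒ.idx_ne_flag _ _).symm
      have hc : ∀ q, ℒ.core q ≠ ℒ.idx a := fun q => ℒ.core_ne_idx _ _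
      rw [hgb]
      simp only [Function.update_of_ne hf, Function.update_of_ne (hc _)]
      by_cases hia : i = a
      · subst hia
        simp [(List.nodup_cons.mp hl).1]
      · simp [hia]

/-- The sign that a conditional phase attaches. -/
noncomputable def signPhase (s : Bool) : Matrix.unitaryGroup Bool ℂ :=
  phaseGate (fun a => if a = s then -1 else 1) fun a => by split_ifs <;> simp

/-- The preparation of the queries: decide with the expression `e` whether the index is valid and
copy it to the index register if it is. -/
noncomputable def prepare (ℒ : Layout Q d N n m) (e : Expr Q) (j : Fin (indexBits d) → Q) :
    List (CGate n m) :=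
  ℒ.compile e 0 ++ ℒ.copyGates j (List.finRange _)

/-- Flip the phase, controlled on the qubit `c`, if the index in the qubits `j` satisfies `e` and the
comparison `f`, which may use the product of the oracle answers, is true. -/
noncomputable def markCircuit (ℒ : Layout Q d N n m) (e f : Expr Q) (j : Fin (indexBits d) → Q)
    (c : Q) (hef : ℒ.flag e.size ≠ ℒ.flag 0) : List (Gate d n m) :=
  CGate.gates d (ℒ.prepare e j) ++ ([.query false false ℒ.idx ℒ.ru, .query true false ℒ.idx ℒ.rv] ++
    (CGate.gates d (ℒ.compile f e.size) ++ ([.qubit (signPhase true) {ℒ.core c, ℒ.flag 0}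
      (ℒ.flag e.size) Finset.card_le_two (by
        simp only [Finset.mem_insert, Finset.mem_singleton, not_or]
        exact ⟨(ℒ.core_ne_flag _ _).symm, hef⟩)] ++
    (CGate.gates d (CGate.invL (ℒ.compile f e.size)) ++
      ([.query true true ℒ.idx ℒ.rv, .query false true ℒ.idx ℒ.ru] ++
        CGate.gates d (CGate.invL (ℒ.prepare e j)))))))

/-- The copy is controlled on validity, so an invalid index leaves the index register at zero. -/
theorem prepare_spec (ℒ : Layout Q d N n m) (e : Expr Q) (j : Fin (indexBits d) → Q)
    (he : e.size ≤ N + 1) (b : Label n m) (hb : ℒ.Clean b) :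
    (CGate.permL (ℒ.prepare e j) b).2 ℒ.ru = 0 ∧ (CGate.permL (ℒ.prepare e j) b).2 ℒ.rv = 0 ∧
    (∀ q, (CGate.permL (ℒ.prepare e j) b).1 (ℒ.core q) = b.1 (ℒ.core q)) ∧
    (CGate.permL (ℒ.prepare e j) b).1 (ℒ.flag 0) = e.test (fun q => b.1 (ℒ.core q)) 0 ∧
    (∀ i, (CGate.permL (ℒ.prepare e j) b).1 (ℒ.idx i) =
      (e.test (fun q => b.1 (ℒ.core q)) 0 && b.1 (ℒ.core (j i)))) ∧
    ∀ l, l ≤ N + 1 → ℒ.Fresh e.size l (CGate.permL (ℒ.prepare e j) b) := by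
  obtain ⟨-, e2, e3⟩ := ℒ.compile_spec e 0 (by omega) b (hb.fresh _ _)
  simp only [zero_add] at e3
  have hp : CGate.permL (ℒ.prepare e j) b = CGate.permL (ℒ.copyGates j (List.finRange _))
    (CGate.permL (ℒ.compile e 0) b) := CGate.permL_append _ _ _
  set b1 := CGate.permL (ℒ.compile e 0) b
  obtain ⟨c1, c2, c3⟩ := ℒ.permL_copyGates j (List.finRange _) (List.nodup_finRange _) b1
  rw [← hp] at c1 c2 c3
  have hr : ∀ ρ, b.2 ρ = 0 := fun ρ => by rw [hb.1]; rfl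
  have e2' : b1.1 (ℒ.flag 0) = e.test (fun q => b.1 (ℒ.core q)) 0 := by rw [e2, hr, zero_mul]
  have hflag : ∀ k, (CGate.permL (ℒ.prepare e j) b).1 (ℒ.flag k) = b1.1 (ℒ.flag k) :=
    fun k => c2 _ fun i => (ℒ.idx_ne_flag i _).symm
  refine ⟨?_, ?_, fun q => ?_, ?_, fun i => ?_, fun l hl i h1 h2 => ?_⟩
  · rw [c1, e3.ru, hr]
  · rw [c1, e3.rv, hr]
  · rw [c2 _ fun i => ℒ.core_ne_idx q i, e3.core]
  · rw [hflag, e2']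
  · rw [c3, if_pos (List.mem_finRange i), e2', e3.core,
      e3.2 _ fun _ _ _ => ℒ.idx_ne_flag i _, hb.2 _ fun a => (ℒ.core_ne_idx a i).symm]
    simp
  · rw [c1, hflag]
    exact e3.fresh he (hb.fresh _ _) hl (Or.inr le_rfl) i h1 h2

theorem signPhase_apply (Ou Ov : OracleSpace d ≃ₗᵢ[ℂ] OracleSpace d) (s : Bool)
    (C : Finset (Fin n)) (t : Fin n) (hC : C.card ≤ 2) (ht : t ∉ C) (ψ : State n m) :
    (Gate.qubit (signPhase s) C t hC ht : Gate d n m).apply Ou Ov ψ =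
      fun b => (if (∀ c ∈ C, b.1 c = true) ∧ b.1 t = s then -1 else 1) * ψ b := by
  rw [signPhase, apply_phaseGate]
  funext b
  split_ifs <;> simp_all

/-- Everything before the conditional phase is a permutation of labels, and everything after it is
the inverse permutation. What remains is a diagonal factor, evaluated at the label in which the
index, the answers and the comparisons have been computed. -/
theorem run_markCircuit (ℒ : Layout Q d N n m) (e f : Expr Q) (j : Fin (indexBits d) → Q)
    (c : Q) (hef : ℒ.flag e.size ≠ ℒ.flag 0) (hd : 0 < d) (hs : e.size + f.size ≤ N + 1)
    (he : ∀ x, e.test x 0 = true → ∃ i : Fin d, encode i = fun a => x (j a))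
    {Ou Ov : OracleSpace d ≃ₗᵢ[ℂ] OracleSpace d} {u v : Fin d → ℝ} (hu : IsInputOracle Ou u)
    (hv : IsInputOracle Ov v) (ψ : State n m) (hψ : ∀ b, ψ b ≠ 0 → ℒ.Clean b) :
    run Ou Ov (ℒ.markCircuit e f j c hef) ψ = fun b =>
      (if b.1 (ℒ.core c) = true ∧ e.test (fun q => b.1 (ℒ.core q)) 0 = true ∧
          f.test (fun q => b.1 (ℒ.core q)) (pad u (fun a => b.1 (ℒ.core (j a))) *
            pad v fun a => b.1 (ℒ.core (j a))) = true then -1 else 1) * ψ b := by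
  set π₁ := CGate.permL (ℒ.prepare e j) with hπ₁
  set π₂ := CGate.permL (ℒ.compile f e.size) with hπ₂
  set τu : Equiv.Perm (Label n m) := addPerm ℒ.ru fun x => pad u fun i => x (ℒ.idx i) with hτu
  set τv : Equiv.Perm (Label n m) := addPerm ℒ.rv fun x => pad v fun i => x (ℒ.idx i) with hτv
  have hprep := fun b hb => ℒ.prepare_spec e j (by omega) b hb
  -- In the invalid case the index register is zero, which encodes an index because `0 < d`. Every
  -- query therefore has a valid index.
  have hidx : ∀ b, ℒ.Clean b → ∃ i : Fin d, encode i = fun a => (π₁ b).1 (ℒ.idx a) := by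
    intro b hb
    obtain ⟨-, -, -, -, h5, -⟩ := hprep b hb
    cases ht : e.test (fun q => b.1 (ℒ.core q)) 0 with
    | false =>
      refine ⟨⟨0, hd⟩, funext fun a => ?_⟩
      rw [h5, ht]
      simp [encode]
    | true =>
      obtain ⟨i, hi⟩ := he _ ht
      refine ⟨i, hi.trans (funext fun a => ?_)⟩
      rw [h5, ht, Bool.true_and]
  have hu1 : ∀ b, (τu b).1 = b.1 := fun b => rfl
  have hv1 : ∀ b, (τv b).1 = b.1 := fun b => rfl
  have hτuv : ∀ b, (τu b).2 ℒ.rv = b.2 ℒ.rv := fun b => Function.update_of_ne ℒ.ru_ne_rv.symm _ _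
  have hτvu : ∀ b, (τv b).2 ℒ.ru = b.2 ℒ.ru := fun b => Function.update_of_ne ℒ.ru_ne_rv _ _
  have hτuu : ∀ b, (τu b).2 ℒ.ru = b.2 ℒ.ru + pad u fun i => b.1 (ℒ.idx i) :=
    fun b => Function.update_self _ _ _
  have hτvv : ∀ b, (τv b).2 ℒ.rv = b.2 ℒ.rv + pad v fun i => b.1 (ℒ.idx i) :=
    fun b => Function.update_self _ _ _
  -- The sign attached by the phase gate; it travels through the inverse permutations, which turn it
  -- into a function of the initial label.
  set h : Label n m → ℂ := fun b => if (∀ a ∈ ({ℒ.core c, ℒ.flag 0} : Finset (Fin n)),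
    b.1 a = true) ∧ b.1 (ℒ.flag e.size) = true then -1 else 1 with hh
  have q1 : applyOracle Ou ℒ.idx ℒ.ru (fun b => ψ (π₁.symm b)) =
      fun b => ψ (π₁.symm (τu.symm b)) := by
    rw [query_eq hu]
    intro b hb
    have hcl := hψ _ hb
    obtain ⟨i, hi⟩ := hidx _ hcl
    have := (hprep _ hcl).1
    rw [← hπ₁] at this
    rw [Equiv.apply_symm_apply] at hi this
    exact ⟨⟨i, hi⟩, this⟩
  have q2 : applyOracle Ov ℒ.idx ℒ.rv (fun b => ψ (π₁.symm (τu.symm b))) =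
      fun b => ψ (π₁.symm (τu.symm (τv.symm b))) := by
    rw [query_eq hv]
    intro b hb
    have hcl := hψ _ hb
    obtain ⟨b0, rfl⟩ : ∃ b0, τu (π₁ b0) = b := ⟨π₁.symm (τu.symm b), by simp⟩
    simp only [Equiv.symm_apply_apply] at hcl
    exact ⟨hidx _ hcl, (hτuv _).trans (hprep _ hcl).2.1⟩
  have q3 : applyOracle Ov.symm ℒ.idx ℒ.rv
      (fun b => h (π₂ b) * ψ (π₁.symm (τu.symm (τv.symm b)))) =
      fun b => h (π₂ (τv b)) * ψ (π₁.symm (τu.symm b)) := by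
    rw [query_symm_eq hv]
    · funext b
      rw [← hτv, Equiv.symm_apply_apply]
    intro b hb
    have hcl := hψ _ (right_ne_zero_of_mul hb)
    obtain ⟨b0, rfl⟩ : ∃ b0, τv (τu (π₁ b0)) = b := ⟨π₁.symm (τu.symm (τv.symm b)), by simp⟩
    simp only [Equiv.symm_apply_apply] at hcl
    refine ⟨hidx _ hcl, ?_⟩
    rw [hτvv, hτuv, (hprep _ hcl).2.1, zero_add]
    rfl
  have q4 : applyOracle Ou.symm ℒ.idx ℒ.ru
      (fun b => h (π₂ (τv b)) * ψ (π₁.symm (τu.symm b))) =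
      fun b => h (π₂ (τv (τu b))) * ψ (π₁.symm b) := by
    rw [query_symm_eq hu]
    · funext b
      rw [← hτu, Equiv.symm_apply_apply]
    intro b hb
    have hcl := hψ _ (right_ne_zero_of_mul hb)
    obtain ⟨b0, rfl⟩ : ∃ b0, τu (π₁ b0) = b := ⟨π₁.symm (τu.symm b), by simp⟩
    simp only [Equiv.symm_apply_apply] at hcl
    refine ⟨hidx _ hcl, ?_⟩
    rw [hτuu, (hprep _ hcl).1, zero_add]
    rfl
  have main : run Ou Ov (ℒ.markCircuit e f j c hef) ψ =
      fun b => h (π₂ (τv (τu (π₁ b)))) * ψ b := by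
    simp only [markCircuit, run_append, CGate.run_gates, run_cons, run_nil, signPhase_apply,
      apply_query_first, apply_query_second, apply_query_first_inv, apply_query_second_inv]
    rw [← hπ₁, q1, q2]
    simp only [CGate.permL_invL, Equiv.symm_symm, ← hπ₂, Equiv.symm_apply_apply]
    have := q3
    simp only [hh] at this
    rw [this]
    have := q4
    simp only [hh] at this
    rw [this]
    simp only [hh, ← hπ₁, Equiv.symm_apply_apply]
  rw [main]
  funext b
  by_cases hb : ψ b = 0
  · rw [hb, mul_zero, mul_zero]
  congr 1
  have hcl := hψ b hb
  obtain ⟨p1, p2, p3, p4, p5, p6⟩ := hprep b hcl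
  rw [← hπ₁] at p1 p2 p3 p4 p5 p6
  set b1 := τv (τu (π₁ b)) with hb1
  have hb11 : b1.1 = (π₁ b).1 := rfl
  -- The queries change only the two answer registers, so the slots above those of `e` are still
  -- free for `f`.
  have hfr : ℒ.Fresh e.size (e.size + f.size) b1 := by
    intro i h1 h2
    have := p6 (e.size + f.size) hs i h1 h2
    refine ⟨?_, this.2⟩
    rw [← this.1]
    have e1 : ∀ b, (τv b).2 (ℒ.reg i) = b.2 (ℒ.reg i) :=
      fun b => Function.update_of_ne (ℒ.rv_ne_reg _).symm _ _
    have e2 : ∀ b, (τu b).2 (ℒ.reg i) = b.2 (ℒ.reg i) :=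
      fun b => Function.update_of_ne (ℒ.ru_ne_reg _).symm _ _
    rw [hb1, e1, e2]
  obtain ⟨-, f2, f3⟩ := ℒ.compile_spec f e.size hs b1 hfr
  rw [← hπ₂] at f2 f3
  have hsz := e.size_pos
  have hfs := f.size_pos
  have hru : b1.2 ℒ.ru = pad u fun i => (π₁ b).1 (ℒ.idx i) := by
    rw [hb1, hτvu, hτuu, p1, zero_add]
  have hrv : b1.2 ℒ.rv = pad v fun i => (π₁ b).1 (ℒ.idx i) := by
    rw [hb1, hτvv, hτuv, p2, zero_add]; rfl
  simp only [hh, Finset.mem_insert, Finset.mem_singleton, forall_eq_or_imp, forall_eq]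
  rw [f3.core, f3.flag (j := 0) hs (by omega) (Or.inl hsz), f2, hru, hrv]
  simp only [hb11, p3, p4, p5]
  refine if_congr ?_ rfl rfl
  cases ht : e.test (fun q => b.1 (ℒ.core q)) 0 <;> simp

/-- Flip the phase, controlled on the qubit `c`, if the comparison `e` is false. -/
noncomputable def rejectCircuit (ℒ : Layout Q d N n m) (e : Expr Q) (c : Q) : List (Gate d n m) :=
  CGate.gates d (ℒ.compile e 0) ++ ([.qubit (signPhase false) {ℒ.core c} (ℒ.flag 0) (by simp) (by
    simp only [Finset.mem_singleton]
    exact (ℒ.core_ne_flag _ _).symm)] ++ CGate.gates d (CGate.invL (ℒ.compile e 0)))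

theorem run_rejectCircuit (ℒ : Layout Q d N n m) (e : Expr Q) (c : Q) (hs : e.size ≤ N + 1)
    (Ou Ov : OracleSpace d ≃ₗᵢ[ℂ] OracleSpace d) (ψ : State n m)
    (hψ : ∀ b, ψ b ≠ 0 → ℒ.Clean b) :
    run Ou Ov (ℒ.rejectCircuit e c) ψ = fun b =>
      (if b.1 (ℒ.core c) = true ∧ e.test (fun q => b.1 (ℒ.core q)) 0 = false then -1 else 1) *
        ψ b := by
  simp only [rejectCircuit, run_append, CGate.run_gates, run_cons, run_nil, signPhase_apply,
    CGate.permL_invL, Equiv.symm_symm, Equiv.symm_apply_apply]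
  funext b
  by_cases hb : ψ b = 0
  · rw [hb, mul_zero, mul_zero]
  congr 1
  have hcl := hψ b hb
  obtain ⟨-, e2, e3⟩ := ℒ.compile_spec e 0 (by omega) b (hcl.fresh _ _)
  simp only [Finset.mem_singleton, forall_eq, e3.core, e2]
  rw [hcl.1]
  simp

end Layout

end QuantumIP

namespace QuantumIP

/-! ### Amplitude functions on the core qubits, means, and the Grover iteration. -/

section Amplitudes

variable {Q : Type} [DecidableEq Q]

/-- The function `h` does not depend on the value of the qubit `q`. -/
def Indep {α : Type} (q : Q) (h : (Q → Bool) → α) : Prop :=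
  ∀ x s, h (Function.update x q s) = h x

theorem Indep.comp {α β : Type} {q : Q} {h : (Q → Bool) → α} (hh : Indep q h) (f : α → β) :
    Indep q (fun x => f (h x)) := fun x s => congrArg f (hh x s)

theorem Indep.comp₂ {α β γ : Type} {q : Q} {h : (Q → Bool) → α} {h' : (Q → Bool) → β}
    (hh : Indep q h) (hh' : Indep q h') (f : α → β → γ) : Indep q (fun x => f (h x) (h' x)) :=
  fun x s => by
  simp only [hh x s, hh' x s]

theorem Indep.mul {q : Q} {h h' : (Q → Bool) → ℂ} (hh : Indep q h) (hh' : Indep q h') :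
    Indep q (h * h') := hh.comp₂ hh' (· * ·)

theorem indep_eval {q q' : Q} (h : q ≠ q') : Indep q (fun x : Q → Bool => x q') :=
  fun _ _ => Function.update_of_ne h.symm _ _

theorem indep_const {α : Type} (q : Q) (c : α) : Indep q (fun _ : Q → Bool => c) :=
  fun _ _ => rfl

theorem eq_of_indep_all [Fintype Q] {α : Type} {h : (Q → Bool) → α} (hh : ∀ q, Indep q h)
    (x y : Q → Bool) : h x = h y := by
  have key : ∀ s : Finset Q, h (fun q => if q ∈ s then y q else x q) = h x := by
    intro s
    induction s using Finset.induction_on with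
    | empty => simp
    | insert a s ha ih =>
      rw [← ih, ← hh a (fun q => if q ∈ s then y q else x q) (y a)]
      congr 1
      funext q
      by_cases hq : q = a
      · subst hq; simp
      · simp [hq]
  simpa using (key Finset.univ).symm

/-- The action of a one-qubit unitary on amplitude functions. -/
noncomputable def qubitOp (U : Matrix.unitaryGroup Bool ℂ) (t : Q) :
    ((Q → Bool) → ℂ) →ₗ[ℂ] ((Q → Bool) → ℂ) where
  toFun A x := ∑ s : Bool, (U : Matrix Bool Bool ℂ) (x t) s * A (Function.update x t s)
  map_add' A A' := by funext x; simp [mul_add]; ring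
  map_smul' c A := by funext x; simp [mul_add]; ring

/-- Multiplication by a function. -/
noncomputable def mulOp (f : (Q → Bool) → ℂ) : ((Q → Bool) → ℂ) →ₗ[ℂ] ((Q → Bool) → ℂ) where
  toFun A := f * A
  map_add' A A' := mul_add _ _ _
  map_smul' c A := by simp

omit [DecidableEq Q] in
theorem mulOp_apply (f A : (Q → Bool) → ℂ) : mulOp f A = f * A := rfl

/-- The Hadamard transform of a qubit. -/
noncomputable def hadamard (q : Q) : ((Q → Bool) → ℂ) →ₗ[ℂ] ((Q → Bool) → ℂ) :=
  qubitOp hadamardGate q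

theorem hadamard_apply (q : Q) (A : (Q → Bool) → ℂ) (x : Q → Bool) :
    hadamard q A x = (1 / (Real.sqrt 2 : ℂ)) * (A (Function.update x q false) +
      (if x q then -1 else 1) * A (Function.update x q true)) := by
  simp only [hadamard, qubitOp, LinearMap.coe_mk, AddHom.coe_mk, hadamardGate, Matrix.of_apply,
    Fintype.sum_bool]
  cases x q <;> simp <;> ring

theorem inv_sqrt_two_mul_self : (1 / (Real.sqrt 2 : ℂ)) * (1 / (Real.sqrt 2 : ℂ)) = 1 / 2 := by
  rw [div_mul_div_comm, ← Complex.ofReal_mul, Real.mul_self_sqrt (by norm_num)]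
  norm_num

theorem hadamard_hadamard (q : Q) (A : (Q → Bool) → ℂ) : hadamard q (hadamard q A) = A := by
  funext x
  have h := inv_sqrt_two_mul_self
  simp only [hadamard_apply, Function.update_self, Function.update_idem]
  have hx : Function.update x q (x q) = x := Function.update_eq_self _ _
  cases hq : x q
  · rw [hq] at hx
    simp only [hx, Bool.false_eq_true, if_false, if_true]
    linear_combination (2 * A x) * h
  · rw [hq] at hx
    simp only [hx, Bool.false_eq_true, if_false, if_true]
    linear_combination (2 * A x) * h

theorem hadamard_mul (q : Q) {h : (Q → Bool) → ℂ} (hh : Indep q h) (A : (Q → Bool) → ℂ) :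
    hadamard q (h * A) = h * hadamard q A := by
  funext x
  simp only [hadamard_apply, Pi.mul_apply, hh x]
  ring

/-- Hadamard transforms of a list of qubits. -/
noncomputable def layer : List Q → ((Q → Bool) → ℂ) →ₗ[ℂ] ((Q → Bool) → ℂ)
  | [] => LinearMap.id
  | q :: l => layer l ∘ₗ hadamard q

theorem layer_append (l l' : List Q) (A : (Q → Bool) → ℂ) :
    layer (l ++ l') A = layer l' (layer l A) := by
  induction l generalizing A with
  | nil => rfl
  | cons q l ih => exact ih _

theorem layer_reverse (l : List Q) (A : (Q → Bool) → ℂ) : layer l.reverse (layer l A) = A := by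
  induction l generalizing A with
  | nil => rfl
  | cons q l ih =>
    rw [List.reverse_cons, layer_append]
    change hadamard q (layer l.reverse (layer l (hadamard q A))) = A
    rw [ih, hadamard_hadamard]

/-- Independence of qubits plays the role of a tensor factorization: a factor that does not involve
the transformed qubits can be pulled out. -/
theorem layer_mul (l : List Q) {h : (Q → Bool) → ℂ} (hh : ∀ q ∈ l, Indep q h)
    (A : (Q → Bool) → ℂ) : layer l (h * A) = h * layer l A := by
  induction l generalizing A with
  | nil => rfl
  | cons q l ih =>
    change layer l (hadamard q (h * A)) = h * layer l (hadamard q A)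
    rw [hadamard_mul q (hh q (by simp)), ih fun q hq => hh q (by simp [hq])]

/-- The indicator function of the assignments that vanish on `l`. -/
noncomputable def zeroOn (l : List Q) (x : Q → Bool) : ℂ := if ∀ q ∈ l, x q = false then 1 else 0

omit [DecidableEq Q] in
theorem zeroOn_cons (q : Q) (l : List Q) : zeroOn (q :: l) = zeroOn [q] * zeroOn l := by
  funext x
  by_cases h : x q = false <;> simp [zeroOn, h]

theorem indep_zeroOn {q : Q} {l : List Q} (hq : q ∉ l) : Indep q (zeroOn l) := by
  intro x s
  refine if_congr (forall₂_congr fun a ha => ?_) rfl rfl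
  rw [Function.update_of_ne (ne_of_mem_of_not_mem ha hq)]

theorem layer_one {l : List Q} (hl : l.Nodup) :
    layer l 1 = ((Real.sqrt 2 : ℂ) ^ l.length) • zeroOn l := by
  have h2 : (Real.sqrt 2 : ℂ) ≠ 0 := by
    rw [Ne, Complex.ofReal_eq_zero]; positivity
  have hh : (2 : ℂ) = Real.sqrt 2 * Real.sqrt 2 := by
    rw [← Complex.ofReal_mul, Real.mul_self_sqrt (by norm_num)]; norm_num
  induction l with
  | nil => funext x; simp [layer, zeroOn]
  | cons q l ih =>
    have h1 : hadamard q (1 : (Q → Bool) → ℂ) = (Real.sqrt 2 : ℂ) • zeroOn [q] := by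
      funext x
      rw [hadamard_apply]
      cases hx : x q
      · simp only [Pi.one_apply, Pi.smul_apply, zeroOn, List.mem_singleton, forall_eq, hx,
          smul_eq_mul]
        simp only [Bool.false_eq_true, if_false, if_true]
        field_simp
        linear_combination hh
      · simp [zeroOn, hx]
    change layer l (hadamard q 1) = _
    rw [h1, map_smul, ← mul_one (zeroOn [q]), layer_mul, ih (List.nodup_cons.mp hl).2,
      zeroOn_cons q l, List.length_cons, pow_succ', mul_smul, mul_smul_comm]
    intro a ha
    exact indep_zeroOn (by
      simpa using ne_of_mem_of_not_mem ha (List.nodup_cons.mp hl).1)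

/-- Sum over the two values of a qubit, normalized by `√2`. -/
noncomputable def fold (q : Q) (A : (Q → Bool) → ℂ) (x : Q → Bool) : ℂ :=
  (1 / (Real.sqrt 2 : ℂ)) * (A (Function.update x q false) + A (Function.update x q true))

/-- Iterated normalized sum over the values of the qubits in a list. -/
noncomputable def foldL : List Q → ((Q → Bool) → ℂ) → ((Q → Bool) → ℂ)
  | [], A => A
  | q :: l, A => foldL l (fold q A)

theorem fold_mul (q : Q) {h : (Q → Bool) → ℂ} (hh : Indep q h) (A : (Q → Bool) → ℂ) :
    fold q (h * A) = h * fold q A := by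
  funext x
  simp only [fold, Pi.mul_apply, hh x]
  ring

theorem foldL_mul (l : List Q) {h : (Q → Bool) → ℂ} (hh : ∀ q ∈ l, Indep q h)
    (A : (Q → Bool) → ℂ) : foldL l (h * A) = h * foldL l A := by
  induction l generalizing A with
  | nil => rfl
  | cons q l ih =>
    change foldL l (fold q (h * A)) = h * foldL l (fold q A)
    rw [fold_mul q (hh q (by simp)), ih fun q hq => hh q (by simp [hq])]

/-- Where the output qubits are zero, all Hadamard signs are positive, and the transform is a plain
normalized sum. -/
theorem zeroOn_mul_layer {l : List Q} (hl : l.Nodup) (A : (Q → Bool) → ℂ) :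
    zeroOn l * layer l A = zeroOn l * foldL l A := by
  induction l generalizing A with
  | nil => rfl
  | cons q l ih =>
    have hi : ∀ a ∈ l, Indep a (zeroOn [q]) := fun a ha => indep_zeroOn (by
      simpa using ne_of_mem_of_not_mem ha (List.nodup_cons.mp hl).1)
    have h1 : zeroOn [q] * hadamard q A = zeroOn [q] * fold q A := by
      funext x
      simp only [Pi.mul_apply, zeroOn, List.mem_singleton, forall_eq, hadamard_apply, fold]
      cases x q <;> simp
    change zeroOn (q :: l) * layer l (hadamard q A) = zeroOn (q :: l) * foldL l (fold q A)
    rw [zeroOn_cons, mul_right_comm, ← layer_mul l hi, h1, layer_mul l hi, mul_right_comm,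
      mul_assoc, ih (List.nodup_cons.mp hl).2, mul_assoc]

theorem indep_fold_self (q : Q) (A : (Q → Bool) → ℂ) : Indep q (fold q A) := fun x s => by
  simp [fold]

theorem Indep.fold {q : Q} {A : (Q → Bool) → ℂ} (hA : Indep q A) (a : Q) :
    Indep q (fold a A) := by
  by_cases h : q = a
  · subst h; exact indep_fold_self q A
  · intro x s
    simp only [QuantumIP.fold]
    rw [Function.update_comm h, Function.update_comm h, hA, hA]

theorem indep_foldL {q : Q} {l : List Q} {A : (Q → Bool) → ℂ} (h : q ∈ l ∨ Indep q A) :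
    Indep q (foldL l A) := by
  induction l generalizing A with
  | nil => simpa [foldL] using h
  | cons a l ih =>
    apply ih
    rcases h with h | h
    · rcases List.mem_cons.mp h with rfl | h
      · exact Or.inr (indep_fold_self _ _)
      · exact Or.inl h
    · exact Or.inr (h.fold a)

variable [Fintype Q]

/-- The average of a function over all assignments. -/
noncomputable def mean (A : (Q → Bool) → ℂ) : ℂ := (∑ x, A x) / 2 ^ Fintype.card Q

theorem sum_update (q : Q) (A : (Q → Bool) → ℂ) :
    ∑ x, (A (Function.update x q false) + A (Function.update x q true)) = 2 * ∑ x, A x := by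
  have h1 : ∀ x, A (Function.update x q false) + A (Function.update x q true) =
      A x + A (Function.update x q (!x q)) := by
    intro x
    have hx : Function.update x q (x q) = x := Function.update_eq_self _ _
    cases hq : x q <;> rw [hq] at hx <;> simp [hx, add_comm]
  have h2 : ∑ x, A (Function.update x q (!x q)) = ∑ x, A x :=
    Fintype.sum_equiv (Function.Involutive.toPerm (fun x : Q → Bool => Function.update x q (!x q))
      fun x => by simp) _ _ fun x => rfl
  simp only [h1, Finset.sum_add_distrib, h2]
  ring

theorem mean_fold (q : Q) (A : (Q → Bool) → ℂ) : mean (fold q A) = Real.sqrt 2 * mean A := by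
  have h2 : (Real.sqrt 2 : ℂ) ≠ 0 := by
    rw [Ne, Complex.ofReal_eq_zero]; positivity
  have hh : (2 : ℂ) = Real.sqrt 2 * Real.sqrt 2 := by
    rw [← Complex.ofReal_mul, Real.mul_self_sqrt (by norm_num)]; norm_num
  simp only [mean, fold, ← Finset.mul_sum, sum_update]
  field_simp
  linear_combination (∑ x, A x) * hh

theorem mean_foldL (l : List Q) (A : (Q → Bool) → ℂ) :
    mean (foldL l A) = (Real.sqrt 2 : ℂ) ^ l.length * mean A := by
  induction l generalizing A with
  | nil => simp [foldL]
  | cons q l ih =>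
    change mean (foldL l (fold q A)) = _
    rw [ih, mean_fold, List.length_cons, pow_succ, mul_assoc]

theorem mean_const (c : ℂ) : mean (fun _ : Q → Bool => c) = c := by
  simp only [mean, Finset.sum_const, Finset.card_univ, Fintype.card_fun, Fintype.card_bool,
    nsmul_eq_mul]
  push_cast
  field_simp

/-- After summing over `l` no variable is left, so the result is constant and equals its own mean.
-/
theorem foldL_eq_const {l : List Q} {A : (Q → Bool) → ℂ} (hA : ∀ q, q ∉ l → Indep q A)
    (x : Q → Bool) : foldL l A x = (Real.sqrt 2 : ℂ) ^ l.length * mean A := by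
  have h : foldL l A = fun _ => foldL l A x := by
    funext y
    refine eq_of_indep_all (fun q => indep_foldL ?_) _ _
    by_cases hq : q ∈ l
    · exact Or.inl hq
    · exact Or.inr (hA q hq)
  rw [← mean_foldL, h, mean_const]

/-- The two factors depend on disjoint sets of qubits. Folding over `l` replaces `A` by a constant
and passes through `h`. -/
theorem mean_mul {l : List Q} {h A : (Q → Bool) → ℂ} (hh : ∀ q ∈ l, Indep q h)
    (hA : ∀ q, q ∉ l → Indep q A) : mean (h * A) = mean h * mean A := by
  have h2 : (Real.sqrt 2 : ℂ) ^ l.length ≠ 0 := pow_ne_zero _ (by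
    rw [Ne, Complex.ofReal_eq_zero]; positivity)
  apply mul_left_cancel₀ h2
  rw [← mean_foldL, foldL_mul l hh]
  have : h * foldL l A = ((Real.sqrt 2 : ℂ) ^ l.length * mean A) • h := by
    funext x
    simp only [Pi.mul_apply, foldL_eq_const hA, Pi.smul_apply, smul_eq_mul]
    ring
  rw [this]
  simp only [mean, Pi.smul_apply, smul_eq_mul, ← Finset.mul_sum]
  ring

/-- Reflection about the uniform superposition of the qubits in `l`. -/
theorem reflect_apply {l : List Q} (hl : l.Nodup) {A : (Q → Bool) → ℂ}
    (hA : ∀ q, q ∉ l → Indep q A) :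
    layer l.reverse ((2 * zeroOn l - 1) * layer l A) = fun x => 2 * mean A - A x := by
  -- The part of the transform of `A` supported at zero is a multiple of `zeroOn l`, hence of the
  -- transform of the constant `1`; the inverse layer returns it as the constant `2 * mean A`.
  have h1 : (2 * zeroOn l - 1) * layer l A = (2 * mean A) • layer l 1 - layer l A := by
    have := zeroOn_mul_layer hl A
    rw [sub_mul, mul_assoc, this, layer_one hl, one_mul]
    congr 1
    funext x
    simp only [Pi.mul_apply, foldL_eq_const hA, Pi.smul_apply, smul_eq_mul, Pi.ofNat_apply]
    ring
  rw [h1, map_sub, map_smul, layer_reverse, layer_reverse]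
  funext x
  simp

/-- The controlled Grover iteration for the marking function `f` on the qubits in `l`. -/
noncomputable def groverOp (l : List Q) (c : Q) (f : (Q → Bool) → Bool) :
    ((Q → Bool) → ℂ) →ₗ[ℂ] ((Q → Bool) → ℂ) :=
  layer l.reverse ∘ₗ mulOp (fun x => if x c = true ∧ ¬ ∀ q ∈ l, x q = false then -1 else 1) ∘ₗ
    layer l ∘ₗ mulOp (fun x => if x c = true ∧ f x = true then -1 else 1)

/-- The state splits by the control qubit. If it is zero, the two Hadamard layers cancel; if it is
one, they enclose a reflection about zero, and with the sign flip at marked points this gives the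
operator in `hlam`. Only the sign flips need controls. The factor `B` carries all other qubits. -/
theorem groverOp_apply {l : List Q} (hl : l.Nodup) {c : Q} (hc : c ∉ l) {f : (Q → Bool) → Bool}
    (hf : ∀ q, q ∉ l → Indep q f) {B Φ : (Q → Bool) → ℂ} (hB : ∀ q ∈ l, Indep q B)
    (hΦ : ∀ q, q ∉ l → Indep q Φ) {lam : ℂ}
    (hlam : ∀ x, 2 * mean (fun y => (if f y then -1 else 1) * Φ y) - (if f x then -1 else 1) * Φ x =
      lam * Φ x) :
    groverOp l c f (B * Φ) = (fun x => if x c then lam else 1) * (B * Φ) := by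
  set on : (Q → Bool) → ℂ := fun x => if x c then 1 else 0 with hon
  set off : (Q → Bool) → ℂ := fun x => if x c then 0 else 1 with hoff
  have ion : ∀ q ∈ l, Indep q on := fun q hq =>
    (indep_eval (ne_of_mem_of_not_mem hq hc)).comp fun b : Bool => if b then (1 : ℂ) else 0
  have ioff : ∀ q ∈ l, Indep q off := fun q hq =>
    (indep_eval (ne_of_mem_of_not_mem hq hc)).comp fun b : Bool => if b then (0 : ℂ) else 1
  set S : (Q → Bool) → ℂ := fun y => (if f y then -1 else 1) * Φ y with hS
  have iS : ∀ q, q ∉ l → Indep q S := fun q hq =>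
    (hf q hq).comp₂ (hΦ q hq) fun b z => (if b then -1 else 1) * z
  have h1 : (fun x => if x c = true ∧ f x = true then (-1 : ℂ) else 1) * (B * Φ) =
      (on * B) * S + (off * B) * Φ := by
    funext x
    simp only [Pi.mul_apply, Pi.add_apply, hon, hoff, hS]
    cases x c <;> cases f x <;> simp
  have h2 : (fun x => if x c = true ∧ ¬ ∀ q ∈ l, x q = false then (-1 : ℂ) else 1) *
      ((on * B) * layer l S + (off * B) * layer l Φ) =
      (on * B) * ((2 * zeroOn l - 1) * layer l S) + (off * B) * layer l Φ := by
    funext x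
    simp only [Pi.mul_apply, Pi.add_apply, Pi.sub_apply, Pi.ofNat_apply, hon, hoff,
      zeroOn]
    by_cases h : ∀ q ∈ l, x q = false
    · rw [if_pos h, if_neg (fun h' => h'.2 h)]
      cases x c <;> norm_num
    · rw [if_neg h]
      cases x c <;> simp [h]
  have ionB : ∀ q ∈ l, Indep q (on * B) := fun q hq => (ion q hq).mul (hB q hq)
  have ioffB : ∀ q ∈ l, Indep q (off * B) := fun q hq => (ioff q hq).mul (hB q hq)
  have ionB' : ∀ q ∈ l.reverse, Indep q (on * B) := fun q hq => ionB q (List.mem_reverse.mp hq)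
  have ioffB' : ∀ q ∈ l.reverse, Indep q (off * B) := fun q hq => ioffB q (List.mem_reverse.mp hq)
  simp only [groverOp, LinearMap.comp_apply, mulOp_apply]
  rw [h1, map_add, layer_mul l ionB, layer_mul l ioffB, h2, map_add, layer_mul _ ionB',
    layer_mul _ ioffB', layer_reverse, reflect_apply hl iS]
  funext x
  simp only [Pi.mul_apply, Pi.add_apply, hon, hoff]
  rw [show S x = (if f x then -1 else 1) * Φ x from rfl, hlam x]
  cases x c <;> simp
  ring

theorem groverOp_pow_apply {l : List Q} (hl : l.Nodup) {c : Q} (hc : c ∉ l)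
    {f : (Q → Bool) → Bool} (hf : ∀ q, q ∉ l → Indep q f) {B Φ : (Q → Bool) → ℂ}
    (hB : ∀ q ∈ l, Indep q B) (hΦ : ∀ q, q ∉ l → Indep q Φ) {lam : ℂ}
    (hlam : ∀ x, 2 * mean (fun y => (if f y then -1 else 1) * Φ y) - (if f x then -1 else 1) * Φ x =
      lam * Φ x) (k : ℕ) :
    (groverOp l c f ^ k) (B * Φ) = (fun x => if x c then lam ^ k else 1) * (B * Φ) := by
  induction k with
  | zero => funext x; simp
  | succ k ih =>
    rw [pow_succ', Module.End.mul_apply, ih, ← mul_assoc, groverOp_apply hl hc hf _ hΦ hlam]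
    · funext x
      simp only [Pi.mul_apply]
      cases x c <;> simp; ring
    · intro q hq
      refine Indep.mul ?_ (hB q hq)
      exact (indep_eval (ne_of_mem_of_not_mem hq hc)).comp
        fun b : Bool => if b then lam ^ k else (1 : ℂ)

end Amplitudes

end QuantumIP

namespace QuantumIP

/-! ### Eigenvectors of the Grover iteration. -/

section Spectrum

variable {Q : Type} [DecidableEq Q] [Fintype Q]

/-- The fraction of assignments which satisfy `f`. -/
noncomputable def density (f : (Q → Bool) → Bool) : ℝ :=
  (∑ x, if f x then 1 else 0) / 2 ^ Fintype.card Q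

theorem mean_ite (f : (Q → Bool) → Bool) (a b : ℂ) :
    mean (fun x => if f x then a else b) = density f * a + (1 - density f) * b := by
  have h : (fun x => if f x then a else b) = fun x => (if f x then 1 else 0) * (a - b) + b := by
    funext x; cases f x <;> simp
  have h1 := mean_const (Q := Q) b
  rw [mean] at h1
  have h2 : ((∑ x, if f x then (1 : ℝ) else 0 : ℝ) : ℂ) = ∑ x, if f x then 1 else 0 := by
    rw [Complex.ofReal_sum]
    exact Finset.sum_congr rfl fun x _ => by split_ifs <;> simp
  rw [h, mean, Finset.sum_add_distrib, add_div, h1, ← Finset.sum_mul, density, Complex.ofReal_div, h2]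
  push_cast
  ring

theorem density_nonneg (f : (Q → Bool) → Bool) : 0 ≤ density f :=
  div_nonneg (Finset.sum_nonneg fun x _ => by split_ifs <;> norm_num) (by positivity)

theorem density_le_one (f : (Q → Bool) → Bool) : density f ≤ 1 := by
  refine div_le_one_of_le₀ ?_ (by positivity)
  calc (∑ x, if f x then (1 : ℝ) else 0) ≤ ∑ _x : Q → Bool, (1 : ℝ) :=
        Finset.sum_le_sum fun x _ => by split_ifs <;> norm_num
    _ = 2 ^ Fintype.card Q := by simp

theorem eq_false_of_density_eq_zero {f : (Q → Bool) → Bool} (h : density f = 0) (x : Q → Bool) :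
    f x = false := by
  have h1 : (∑ x, if f x then (1 : ℝ) else 0) = 0 := by
    rcases div_eq_zero_iff.mp h with h | h
    · exact h
    · exact absurd h (by positivity)
  have := (Finset.sum_eq_zero_iff_of_nonneg
    (fun x _ => by split_ifs <;> norm_num)).mp h1 x (Finset.mem_univ x)
  by_contra hx
  simp [hx] at this

theorem density_not (f : (Q → Bool) → Bool) : density (fun x => !f x) = 1 - density f := by
  have h : (∑ x, if (!f x) then (1 : ℝ) else 0) = ∑ x, (1 - if f x then (1 : ℝ) else 0) :=
    Finset.sum_congr rfl fun x _ => by cases f x <;> simp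
  have h2 : (2 : ℝ) ^ Fintype.card Q ≠ 0 := by positivity
  rw [density, h, Finset.sum_sub_distrib, density, sub_div]
  congr 1
  simp [h2]

/-- The angle of a Grover iteration. -/
noncomputable def groverAngle (f : (Q → Bool) → Bool) : ℝ := Real.arcsin (Real.sqrt (density f))

theorem sin_groverAngle (f : (Q → Bool) → Bool) :
    Real.sin (groverAngle f) = Real.sqrt (density f) :=
  Real.sin_arcsin (by linarith [Real.sqrt_nonneg (density f)])
    (Real.sqrt_le_one.mpr (density_le_one f))

/-- The two eigenphases of a Grover iteration. -/
noncomputable def groverPhase (f : (Q → Bool) → Bool) (σ : Bool) : ℝ :=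
  if σ then 2 * groverAngle f else -(2 * groverAngle f)

/-- On functions constant on the marked and on the unmarked points, the iteration is a rotation of a
plane by twice the angle `θ` with `sin θ ^ 2 = density f`. The two functions are the components of
the constant `1`, the uniform state, in the eigenbasis `exp (±2iθ)`. -/
theorem exists_grover_eigenvectors {l : List Q} {f : (Q → Bool) → Bool}
    (hf : ∀ q, q ∉ l → Indep q f) :
    ∃ Φ : Bool → (Q → Bool) → ℂ, (∀ σ q, q ∉ l → Indep q (Φ σ)) ∧
      (∀ x, Φ true x + Φ false x = 1) ∧ (mean fun x => Φ true x * star (Φ false x)) = 0 ∧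
      ∀ σ x, 2 * mean (fun y => (if f y then -1 else 1) * Φ σ y) - (if f x then -1 else 1) * Φ σ x =
        Complex.exp (groverPhase f σ * Complex.I) * Φ σ x := by
  -- For densities `0` and `1` the plane degenerates to a line: `1` is itself an eigenvector, and
  -- the other component is zero.
  have trivial_case : (∀ x, f x = false) ∨ (∀ x, f x = true) →
      Complex.exp (groverPhase f true * Complex.I) = (if f (fun _ => false) then -1 else 1) →
      ∃ Φ : Bool → (Q → Bool) → ℂ, (∀ σ q, q ∉ l → Indep q (Φ σ)) ∧
      (∀ x, Φ true x + Φ false x = 1) ∧ (mean fun x => Φ true x * star (Φ false x)) = 0 ∧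
      ∀ σ x, 2 * mean (fun y => (if f y then -1 else 1) * Φ σ y) - (if f x then -1 else 1) * Φ σ x =
        Complex.exp (groverPhase f σ * Complex.I) * Φ σ x := by
    intro h1 h2
    refine ⟨fun σ _ => if σ then 1 else 0, fun σ q _ => indep_const q _, by simp, ?_, ?_⟩
    · simp [mean]
    · intro σ x
      cases σ
      · simp [mean]
      · rw [h2]
        rcases h1 with h1 | h1
        · simp only [h1, Bool.false_eq_true, if_false, if_true, mean_const]
          norm_num
        · simp only [h1, if_true, mean_const]
          norm_num
  by_cases h0 : density f = 0
  · have hf0 := eq_false_of_density_eq_zero h0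
    refine trivial_case (Or.inl hf0) ?_
    simp [groverPhase, groverAngle, h0, hf0]
  by_cases h1 : density f = 1
  · have hf1 : ∀ x, f x = true := by
      intro x
      have := eq_false_of_density_eq_zero (f := fun x => !f x) (by rw [density_not, h1, sub_self]) x
      simpa using this
    refine trivial_case (Or.inr hf1) ?_
    have : (2 * ((Real.pi / 2 : ℝ) : ℂ) * Complex.I) = Real.pi * Complex.I := by push_cast; ring
    simp only [groverPhase, groverAngle, h1, hf1, if_true, Real.sqrt_one, Real.arcsin_one]
    push_cast at this ⊢
    rw [this, Complex.exp_pi_mul_I]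
  have hp0 : 0 < density f := lt_of_le_of_ne (density_nonneg f) (Ne.symm h0)
  have hp1 : density f < 1 := lt_of_le_of_ne (density_le_one f) h1
  set θ := groverAngle f with hθ
  have hs2 : Real.sin θ ^ 2 = density f := by
    rw [hθ, sin_groverAngle, Real.sq_sqrt hp0.le]
  have hc2 : Real.cos θ ^ 2 = 1 - density f := by
    rw [← hs2, ← Real.sin_sq_add_cos_sq θ]; ring
  have hs0 : Real.sin θ ≠ 0 := fun h => by rw [h] at hs2; norm_num at hs2; exact h0 hs2.symm
  have hc0 : Real.cos θ ≠ 0 := fun h => by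
    rw [h] at hc2; norm_num at hc2; linarith
  set s : ℂ := (Real.sin θ : ℂ) with hs
  set c : ℂ := (Real.cos θ : ℂ) with hc
  have hs0' : s ≠ 0 := by rw [hs, Ne, Complex.ofReal_eq_zero]; exact hs0
  have hc0' : c ≠ 0 := by rw [hc, Ne, Complex.ofReal_eq_zero]; exact hc0
  have hps : (density f : ℂ) = s ^ 2 := by rw [hs, ← hs2]; push_cast; ring
  have hcs : c ^ 2 = 1 - s ^ 2 := by
    rw [hs, hc, ← Complex.ofReal_pow, ← Complex.ofReal_pow, hc2, hs2]; push_cast; ring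
  have hI := Complex.I_sq
  set η : Bool → ℂ := fun σ => if σ then 1 else -1 with hη
  have hη2 : ∀ σ, η σ ^ 2 = 1 := by intro σ; cases σ <;> simp [hη]
  -- Here `e σ` is `exp (±iθ)`, and the eigenvalue is its square.
  set e : Bool → ℂ := fun σ => c + Complex.I * η σ * s with he
  have hlam : ∀ σ, Complex.exp (groverPhase f σ * Complex.I) = e σ ^ 2 := by
    intro σ
    have h : (groverPhase f σ : ℂ) * Complex.I =
        ((if σ then θ else -θ : ℝ) * Complex.I) + ((if σ then θ else -θ : ℝ) * Complex.I) := by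
      cases σ <;> simp [groverPhase, ← hθ] <;> ring
    have h2 : Complex.exp ((if σ then θ else -θ : ℝ) * Complex.I) = e σ := by
      rw [Complex.exp_mul_I, ← Complex.ofReal_cos, ← Complex.ofReal_sin]
      cases σ
      · simp only [Bool.false_eq_true, if_false, Real.cos_neg, Real.sin_neg, he, hη, hs, hc]
        push_cast; ring
      · simp only [if_true, he, hη, hs, hc]
        ring
    rw [h, Complex.exp_add, h2, sq]
  -- The eigenvector with values `∓i / sin θ` on marked and `1 / cos θ` on unmarked points, scaled
  -- by `e σ / 2` so that the two add up to `1`.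
  refine ⟨fun σ x => if f x then -(Complex.I * η σ * e σ) / (2 * s) else e σ / (2 * c),
    fun σ q hq => (hf q hq).comp fun b : Bool =>
      if b then -(Complex.I * η σ * e σ) / (2 * s) else e σ / (2 * c), ?_, ?_, ?_⟩
  · intro x
    beta_reduce
    cases f x
    · simp only [Bool.false_eq_true, if_false, he, hη, if_true]
      field_simp
      ring
    · simp only [Bool.false_eq_true, if_false, he, hη, if_true]
      field_simp
      linear_combination (-2 * s) * hI
  · have hstar : star (e false) = e true := by
      simp [he, hη, hs, hc, -Complex.ofReal_sin, -Complex.ofReal_cos]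
    have hstar2 : star (-(Complex.I * η false * e false) / (2 * s)) =
        -(Complex.I * e true) / (2 * s) := by
      rw [← hstar]
      simp [hη, hs, -Complex.ofReal_sin, -Complex.ofReal_cos]
    have hstar3 : star (e false / (2 * c)) = e true / (2 * c) := by
      rw [← hstar]
      simp [hc, -Complex.ofReal_sin, -Complex.ofReal_cos]
    have : (fun x => (if f x then -(Complex.I * η true * e true) / (2 * s) else e true / (2 * c)) *
        star (if f x then -(Complex.I * η false * e false) / (2 * s) else e false / (2 * c))) =
        fun x => if f x then -(Complex.I * η true * e true) / (2 * s) *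
          (-(Complex.I * e true) / (2 * s)) else e true / (2 * c) * (e true / (2 * c)) := by
      funext x
      cases f x
      · simp only [Bool.false_eq_true, if_false, hstar3]
      · simp only [if_true, hstar2]
    -- Marked points contribute `-(e true) ^ 2 / 4` to the mean, unmarked points the opposite.
    rw [this, mean_ite, hps]
    simp only [hη, if_true]
    have h1 : 1 - s ^ 2 = c ^ 2 := hcs.symm
    rw [h1]
    field_simp
    rw [hI]; ring
  · intro σ x
    have hm : mean (fun y => (if f y then -1 else 1) *
        (if f y then -(Complex.I * η σ * e σ) / (2 * s) else e σ / (2 * c))) = e σ ^ 2 / 2 := by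
      have : (fun y => (if f y then (-1 : ℂ) else 1) *
        (if f y then -(Complex.I * η σ * e σ) / (2 * s) else e σ / (2 * c))) =
        fun y => if f y then (Complex.I * η σ * e σ) / (2 * s) else e σ / (2 * c) := by
        funext y
        cases f y
        · simp
        · simp only [if_true]; ring
      rw [this, mean_ite, hps, ← hcs]
      field_simp
      simp only [he]
      ring
    rw [hm, hlam]
    have hηs := hη2 σ
    beta_reduce
    cases f x
    · simp only [Bool.false_eq_true, if_false]
      field_simp
      have : e σ * (2 * c) = e σ ^ 2 + 1 := by
        simp only [he]
        linear_combination hcs + (-(η σ ^ 2 * s ^ 2)) * hI + s ^ 2 * hηs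
      linear_combination e σ * this
    · simp only [if_true]
      field_simp
      have : e σ * (2 * Complex.I * η σ * s) = e σ ^ 2 - 1 := by
        simp only [he]
        linear_combination -hcs + (η σ ^ 2 * s ^ 2) * hI - s ^ 2 * hηs
      have h3 : (Complex.I * η σ) ^ 2 = -1 := by rw [mul_pow, hI, hηs]; ring
      linear_combination (-(Complex.I * η σ * e σ)) * this + 2 * s * e σ ^ 2 * h3

end Spectrum

/-! ### Hadamard tests of powers of the Grover iteration. -/

section Tests

variable {Q : Type} [DecidableEq Q]

/-- The sum of the angles in a list over the qubits whose value is one. -/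
noncomputable def angleSum (w : List (Q × ℝ)) (x : Q → Bool) : ℝ :=
  (w.map fun p => if x p.1 then p.2 else 0).sum

/-- Controlled phase rotation by the negative of the sum of angles. -/
noncomputable def phaseOp (c : Q) (w : List (Q × ℝ)) :
    ((Q → Bool) → ℂ) →ₗ[ℂ] ((Q → Bool) → ℂ) :=
  mulOp fun x => if x c then Complex.exp (-(angleSum w x) * Complex.I) else 1

variable [Fintype Q]

/-- A one-qubit phase test of the `k`-th power of a Grover iteration. -/
noncomputable def testOp (l : List Q) (c : Q) (f : (Q → Bool) → Bool) (w : List (Q × ℝ)) (k : ℕ) :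
    ((Q → Bool) → ℂ) →ₗ[ℂ] ((Q → Bool) → ℂ) :=
  hadamard c ∘ₗ (groverOp l c f ^ k) ∘ₗ phaseOp c w ∘ₗ hadamard c

omit [Fintype Q] in
theorem indep_angleSum {q : Q} {w : List (Q × ℝ)} (h : ∀ p ∈ w, p.1 ≠ q) :
    Indep q (angleSum w) := by
  intro x s
  rw [angleSum, angleSum]
  congr 1
  refine List.map_congr_left fun p hp => ?_
  rw [Function.update_of_ne (h p hp)]

/-- Phase kickback: on an eigenvector the controlled power multiplies the branch `1` of the control
by `exp (i k φ)`, and the correction subtracts the angle given by known digits. The second Hadamard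
gate turns this relative phase into amplitudes, while the search register stays in the eigenvector.
-/
theorem testOp_apply {l : List Q} (hl : l.Nodup) {c : Q} (hc : c ∉ l) {f : (Q → Bool) → Bool}
    (hf : ∀ q, q ∉ l → Indep q f) {w : List (Q × ℝ)} (hw : ∀ p ∈ w, p.1 ≠ c ∧ p.1 ∉ l)
    {B Φ : (Q → Bool) → ℂ} (hB : ∀ q ∈ l, Indep q B) (hBc : Indep c B)
    (hΦ : ∀ q, q ∉ l → Indep q Φ) {φ : ℝ}
    (hφ : ∀ x, 2 * mean (fun y => (if f y then -1 else 1) * Φ y) - (if f x then -1 else 1) * Φ x =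
      Complex.exp (φ * Complex.I) * Φ x) (k : ℕ) :
    testOp l c f w k (B * zeroOn [c] * Φ) = (B * fun x => (1 + (if x c then -1 else 1) *
      Complex.exp ((k * φ - angleSum w x : ℝ) * Complex.I)) / 2) * Φ := by
  have h1 : hadamard c (B * zeroOn [c] * Φ) = (fun x => (1 / (Real.sqrt 2 : ℂ)) * B x) * Φ := by
    rw [mul_right_comm, hadamard_mul c (hBc.mul (hΦ c hc))]
    funext x
    simp only [Pi.mul_apply, hadamard_apply, zeroOn, List.mem_singleton, forall_eq,
      Function.update_self]
    simp
    ring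
  have iw : Indep c (angleSum w) := indep_angleSum fun p hp => (hw p hp).1
  have iwl : ∀ q ∈ l, Indep q (angleSum w) := fun q hq => indep_angleSum fun p hp h =>
    (hw p hp).2 (h ▸ hq)
  set F : (Q → Bool) → ℂ := fun x => if x c then Complex.exp (-(angleSum w x) * Complex.I) else 1
    with hF
  have iF : ∀ q ∈ l, Indep q F := fun q hq =>
    (indep_eval (ne_of_mem_of_not_mem hq hc)).comp₂ (iwl q hq)
      fun (b : Bool) (a : ℝ) => if b then Complex.exp (-a * Complex.I) else 1
  have h2 : phaseOp c w ((fun x => (1 / (Real.sqrt 2 : ℂ)) * B x) * Φ) =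
      (F * fun x => (1 / (Real.sqrt 2 : ℂ)) * B x) * Φ := by
    rw [phaseOp, mulOp_apply, mul_assoc]
  simp only [testOp, LinearMap.comp_apply]
  rw [h1, h2, groverOp_pow_apply hl hc hf (fun q hq => (iF q hq).mul
    ((hB q hq).comp fun z => (1 / (Real.sqrt 2 : ℂ)) * z)) hΦ hφ]
  have h3 := inv_sqrt_two_mul_self
  have hexp : ∀ x, Complex.exp ((k * φ - angleSum w x : ℝ) * Complex.I) =
      Complex.exp (φ * Complex.I) ^ k * Complex.exp (-(angleSum w x) * Complex.I) := by
    intro x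
    rw [← Complex.exp_nat_mul, ← Complex.exp_add]
    congr 1
    push_cast
    ring
  funext x
  simp only [hadamard_apply, Pi.mul_apply, hF, Function.update_self, hBc x, iw x, hΦ c hc x, hexp]
  simp only [Bool.false_eq_true, if_false, if_true]
  linear_combination (B x * Φ x * (1 + (if x c then -1 else 1) *
    (Complex.exp (φ * Complex.I) ^ k * Complex.exp (-(angleSum w x) * Complex.I)))) * h3

end Tests

end QuantumIP

namespace QuantumIP

/-! ### Error probabilities of digit-by-digit phase estimation. -/

section PhaseTails

/-- The number with the binary digits `y` below position `l`. -/
noncomputable def bitSum {t : ℕ} (y : Fin t → Bool) (l : ℕ) : ℝ :=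
  ∑ k : Fin t, if (k : ℕ) < l ∧ y k = true then 2 ^ (k : ℕ) else 0

/-- The phase that remains after the digits of `y` below position `l` have been measured. -/
noncomputable def residual {t : ℕ} (a : ℝ) (y : Fin t → Bool) (l : ℕ) : ℝ :=
  (a - Real.pi * bitSum y l) / 2 ^ l

/-- The probability that the phase tests, started with the phase `a`, yield the digits `y`. -/
noncomputable def chain {t : ℕ} (a : ℝ) (y : Fin t → Bool) : ℝ :=
  ∏ l : Fin t, Real.cos (residual a y (l + 1)) ^ 2

theorem bitSum_zero {t : ℕ} (y : Fin t → Bool) : bitSum y 0 = 0 := by simp [bitSum]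

theorem bitSum_cons {t : ℕ} (b : Bool) (z : Fin t → Bool) (l : ℕ) :
    bitSum (Fin.cons b z : Fin (t + 1) → Bool) (l + 1) = (if b then 1 else 0) + 2 * bitSum z l := by
  simp only [bitSum, Fin.sum_univ_succ, Fin.cons_zero, Fin.cons_succ, Finset.mul_sum, Fin.val_zero,
    Fin.val_succ, add_lt_add_iff_right, mul_ite, mul_zero, pow_succ', pow_zero]
  simp

theorem residual_zero {t : ℕ} (a : ℝ) (y : Fin t → Bool) : residual a y 0 = a := by
  simp [residual, bitSum_zero]

/-- Splitting off the lowest digit `b` replaces the phase `a` by `(a - π b) / 2`. This recursion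
drives all inductions below. -/
theorem residual_cons {t : ℕ} (a : ℝ) (b : Bool) (z : Fin t → Bool) (l : ℕ) :
    residual a (Fin.cons b z : Fin (t + 1) → Bool) (l + 1) =
      residual ((a - Real.pi * if b then 1 else 0) / 2) z l := by
  rw [residual, residual, bitSum_cons, pow_succ]
  field_simp
  ring

theorem chain_cons {t : ℕ} (a : ℝ) (b : Bool) (z : Fin t → Bool) :
    chain a (Fin.cons b z : Fin (t + 1) → Bool) =
      Real.cos ((a - Real.pi * if b then 1 else 0) / 2) ^ 2 *
        chain ((a - Real.pi * if b then 1 else 0) / 2) z := by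
  simp only [chain, Fin.prod_univ_succ, Fin.val_zero, Fin.val_succ, residual_cons, residual_zero]

theorem chain_nonneg {t : ℕ} (a : ℝ) (y : Fin t → Bool) : 0 ≤ chain a y :=
  Finset.prod_nonneg fun _ _ => sq_nonneg _

theorem sum_cons {t : ℕ} (F : (Fin (t + 1) → Bool) → ℝ) :
    ∑ y, F y = ∑ z : Fin t → Bool, F (Fin.cons true z) + ∑ z : Fin t → Bool, F (Fin.cons false z) := by
  rw [← (Fin.consEquiv fun _ => Bool).sum_comp, Fintype.sum_prod_type, Fintype.sum_bool]
  rfl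

theorem cos_half_sub_pi (a : ℝ) : Real.cos ((a - Real.pi * 1) / 2) = Real.sin (a / 2) := by
  rw [mul_one, sub_div, Real.cos_sub_pi_div_two]

theorem sin_half_sub_pi (a : ℝ) : Real.sin ((a - Real.pi * 1) / 2) = -Real.cos (a / 2) := by
  rw [mul_one, sub_div, Real.sin_sub_pi_div_two]

theorem sum_chain_mul {t : ℕ} (a : ℝ) (F : (Fin (t + 1) → Bool) → ℝ) :
    ∑ y, chain a y * F y =
      Real.cos ((a - Real.pi * 1) / 2) ^ 2 * ∑ z : Fin t → Bool,
        chain ((a - Real.pi * 1) / 2) z * F (Fin.cons true z) +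
      Real.cos ((a - Real.pi * 0) / 2) ^ 2 * ∑ z : Fin t → Bool,
        chain ((a - Real.pi * 0) / 2) z * F (Fin.cons false z) := by
  rw [sum_cons]
  simp only [chain_cons, if_true, Bool.false_eq_true, if_false, Finset.mul_sum, mul_assoc]

/-- The two values of the first digit have probabilities `cos (a / 2) ^ 2` and `sin (a / 2) ^ 2`. -/
theorem sum_chain {t : ℕ} (a : ℝ) : ∑ y : Fin t → Bool, chain a y = 1 := by
  induction t generalizing a with
  | zero => simp [chain]
  | succ t ih =>
    have := sum_chain_mul (t := t) a fun _ => 1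
    simp only [mul_one, ih] at this
    rw [this]
    have h := cos_half_sub_pi a
    rw [mul_one] at h
    rw [h, mul_zero, sub_zero]
    exact Real.sin_sq_add_cos_sq _

/-- All residual phases have tangent less than one. -/
def Steady {t : ℕ} (a : ℝ) (y : Fin t → Bool) : Prop :=
  ∀ l ≤ t, Real.sin (residual a y l) ^ 2 < 1 / 2

theorem steady_cons {t : ℕ} (a : ℝ) (b : Bool) (z : Fin t → Bool) :
    Steady a (Fin.cons b z : Fin (t + 1) → Bool) ↔ Real.sin a ^ 2 < 1 / 2 ∧
      Steady ((a - Real.pi * if b then 1 else 0) / 2) z := by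
  constructor
  · intro h
    refine ⟨?_, fun l hl => ?_⟩
    · have := h 0 (by omega)
      rwa [residual_zero] at this
    · have := h (l + 1) (by omega)
      rwa [residual_cons] at this
  · rintro ⟨h1, h2⟩ l hl
    cases l with
    | zero => rwa [residual_zero]
    | succ l => rw [residual_cons]; exact h2 l (by omega)

-- If `sin a ^ 2 ≥ 1 / 2`, the bound is at least `1`. Otherwise the first digit leads to `a / 2` or
-- `(a - π) / 2`, and by induction the weighted failure probabilities add up to `4 * sin (a / 2) ^ 2
-- * cos (a / 2) ^ 2 = sin a ^ 2`.
open Classical in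
theorem sum_chain_not_steady {t : ℕ} (a : ℝ) :
    ∑ y : Fin t → Bool, chain a y * (if Steady a y then 0 else 1) ≤ 2 * Real.sin a ^ 2 := by
  have hle : ∀ (t : ℕ) (a : ℝ),
      ∑ y : Fin t → Bool, chain a y * (if Steady a y then 0 else 1) ≤ 1 := fun t a =>
    (Finset.sum_le_sum fun y _ => by
      have := chain_nonneg a y
      split_ifs <;> linarith).trans (sum_chain (t := t) a).le
  induction t generalizing a with
  | zero =>
    by_cases h : Real.sin a ^ 2 < 1 / 2
    · have : ∀ y : Fin 0 → Bool, Steady a y := fun y l hl => by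
        obtain rfl : l = 0 := by omega
        rwa [residual_zero]
      simp only [this, if_true, mul_zero, Finset.sum_const_zero]
      positivity
    · exact (hle 0 a).trans (by linarith)
  | succ t ih =>
    by_cases h : Real.sin a ^ 2 < 1 / 2
    · rw [sum_chain_mul]
      simp only [steady_cons, h, true_and, if_true, Bool.false_eq_true, if_false]
      have h1 := ih ((a - Real.pi * 1) / 2)
      have h2 := ih ((a - Real.pi * 0) / 2)
      rw [sin_half_sub_pi] at h1
      rw [cos_half_sub_pi]
      simp only [mul_zero, sub_zero] at h2 ⊢
      have hs : Real.sin a = 2 * Real.sin (a / 2) * Real.cos (a / 2) := by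
        rw [← Real.sin_two_mul]; ring_nf
      calc _ ≤ Real.sin (a / 2) ^ 2 * (2 * (-Real.cos (a / 2)) ^ 2) +
          Real.cos (a / 2) ^ 2 * (2 * Real.sin (a / 2) ^ 2) :=
            add_le_add (mul_le_mul_of_nonneg_left h1 (sq_nonneg _))
              (mul_le_mul_of_nonneg_left h2 (sq_nonneg _))
        _ = Real.sin a ^ 2 := by rw [hs]; ring
        _ ≤ 2 * Real.sin a ^ 2 := by nlinarith [sq_nonneg (Real.sin a)]
    · exact (hle (t + 1) a).trans (by linarith)

/-- From `tan x = 2 tan (x / 2) / (1 - tan (x / 2) ^ 2)`, where the denominator lies in `(0, 1]`. -/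
theorem two_mul_abs_tan_half_le {x : ℝ} (h1 : Real.sin (x / 2) ^ 2 < 1 / 2) :
    2 * |Real.tan (x / 2)| ≤ |Real.tan x| ∨ Real.cos x = 0 := by
  by_cases hc : Real.cos x = 0
  · exact Or.inr hc
  left
  have hs : Real.sin x = 2 * Real.sin (x / 2) * Real.cos (x / 2) := by
    rw [← Real.sin_two_mul]; ring_nf
  have hsq := Real.sin_sq_add_cos_sq (x / 2)
  have hcx : Real.cos x = 2 * Real.cos (x / 2) ^ 2 - 1 := by
    rw [← Real.cos_two_mul]; ring_nf
  have hpos : 0 < Real.cos x := by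
    rw [hcx]; linarith
  have hc2 : Real.cos (x / 2) ≠ 0 := fun h => by rw [h] at hcx; norm_num at hcx; linarith
  have hcp : 0 < |Real.cos (x / 2)| := abs_pos.mpr hc2
  rw [Real.tan_eq_sin_div_cos, Real.tan_eq_sin_div_cos, abs_div, abs_div, abs_of_pos hpos,
    ← mul_div_assoc, div_le_div_iff₀ hcp hpos, hs, abs_mul, abs_mul, abs_two]
  have h3 : Real.cos x ≤ |Real.cos (x / 2)| * |Real.cos (x / 2)| := by
    rw [← sq, sq_abs, hcx]
    nlinarith [Real.cos_sq_le_one (x / 2)]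
  have h4 : 0 ≤ 2 * |Real.sin (x / 2)| := by positivity
  calc 2 * |Real.sin (x / 2)| * Real.cos x ≤
      2 * |Real.sin (x / 2)| * (|Real.cos (x / 2)| * |Real.cos (x / 2)|) :=
        mul_le_mul_of_nonneg_left h3 h4
    _ = 2 * |Real.sin (x / 2)| * |Real.cos (x / 2)| * |Real.cos (x / 2)| := by ring

/-- Subtracting `π` does not change the tangent, and each halving of the phase at least halves it.
-/
theorem Steady.pow_mul_abs_tan_le {t : ℕ} {a : ℝ} {y : Fin t → Bool} (h : Steady a y) :
    2 ^ t * |Real.tan (residual a y t)| ≤ |Real.tan a| := by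
  have hcos : ∀ x, Real.sin x ^ 2 < 1 / 2 → Real.cos x ≠ 0 := fun x hx hc => by
    have := Real.sin_sq_add_cos_sq x
    rw [hc] at this
    linarith
  induction t generalizing a with
  | zero => simp [residual_zero]
  | succ t ih =>
    obtain ⟨b, z, rfl⟩ : ∃ b z, (Fin.cons b z : Fin (t + 1) → Bool) = y :=
      ⟨y 0, Fin.tail y, Fin.cons_self_tail y⟩
    rw [steady_cons] at h
    rw [residual_cons]
    have h1 := ih h.2
    set a1 := (a - Real.pi * if b then 1 else 0) / 2 with ha1
    have h2 : Real.sin a1 ^ 2 < 1 / 2 := by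
      have := h.2 0 (by omega)
      rwa [residual_zero] at this
    have ht : |Real.tan (2 * a1)| = |Real.tan a| ∧ (Real.cos (2 * a1) = 0 → Real.cos a = 0) := by
      have : 2 * a1 = a - Real.pi * if b then 1 else 0 := by rw [ha1]; ring
      rw [this]
      cases b
      · simp
      · simp only [if_true, mul_one, Real.tan_sub_pi, Real.cos_sub_pi, neg_eq_zero, imp_self,
          and_self]
    have h3 := two_mul_abs_tan_half_le (x := 2 * a1) (by rwa [mul_div_cancel_left₀ _ two_ne_zero])
    rw [mul_div_cancel_left₀ _ two_ne_zero] at h3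
    rcases h3 with h3 | h3
    · rw [ht.1] at h3
      rw [pow_succ, mul_right_comm]
      linarith
    · exact absurd (ht.2 h3) (hcos a h.1)

-- The tail decays like `1 / 2 ^ e`. Splitting off one digit lowers `t` and `e` together, and the
-- two branches combine through the double-angle formula, which supplies the factor `1 / 2`.
open Classical in
theorem sum_chain_far {t : ℕ} (e : ℕ) (a : ℝ) :
    ∑ y : Fin t → Bool, chain a y *
      (if 2 ^ e < 2 ^ t * |Real.sin (residual a y t)| then 1 else 0) ≤
        2 * Real.sin a ^ 2 / 2 ^ e := by
  induction e generalizing t a with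
  | zero =>
    simp only [pow_zero, div_one]
    refine le_trans (Finset.sum_le_sum fun y _ => ?_) (sum_chain_not_steady (t := t) a)
    refine mul_le_mul_of_nonneg_left ?_ (chain_nonneg a y)
    -- For steady digits `2 ^ t * |tan|` of the last residual is at most `|tan a| ≤ 1`, so only
    -- unsteady digits can be far off.
    by_cases hs : Steady a y
    · rw [if_neg]
      · rw [if_pos hs]
      have h1 := hs.pow_mul_abs_tan_le
      have h2 : Real.sin a ^ 2 < 1 / 2 := by
        have := hs 0 (by omega)
        rwa [residual_zero] at this
      have hsq := Real.sin_sq_add_cos_sq a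
      have hc : 0 < |Real.cos a| := abs_pos.mpr fun h => by
        rw [h] at hsq
        linarith
      have h3 : |Real.tan a| ≤ 1 := by
        rw [Real.tan_eq_sin_div_cos, abs_div, div_le_one hc]
        apply sq_le_sq.mp
        linarith
      have h4 : ∀ x, |Real.sin x| ≤ |Real.tan x| ∨ Real.cos x = 0 := by
        intro x
        by_cases hx : Real.cos x = 0
        · exact Or.inr hx
        left
        rw [Real.tan_eq_sin_div_cos, abs_div, le_div_iff₀ (abs_pos.mpr hx)]
        exact mul_le_of_le_one_right (abs_nonneg _) (Real.abs_cos_le_one x)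
      have h5 := h4 (residual a y t)
      have h6 := hs t le_rfl
      have hsq' := Real.sin_sq_add_cos_sq (residual a y t)
      rcases h5 with h5 | h5
      · have : (2 : ℝ) ^ t * |Real.sin (residual a y t)| ≤ 2 ^ t * |Real.tan (residual a y t)| :=
          mul_le_mul_of_nonneg_left h5 (by positivity)
        linarith
      · rw [h5] at hsq'
        linarith
    · rw [if_neg hs]
      split_ifs <;> norm_num
  | succ e ih =>
    cases t with
    | zero =>
      have : ∀ y : Fin 0 → Bool, ¬ (2 : ℝ) ^ (e + 1) < 2 ^ 0 * |Real.sin (residual a y 0)| := by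
        intro y
        have h1 := Real.abs_sin_le_one (residual a y 0)
        have h2 : (1 : ℝ) ≤ 2 ^ (e + 1) := one_le_pow₀ (by norm_num)
        rw [pow_zero, one_mul]
        linarith
      simp only [this, if_false, mul_zero, Finset.sum_const_zero]
      positivity
    | succ t =>
      rw [sum_chain_mul]
      have hiff : ∀ x : ℝ, ((2 : ℝ) ^ (e + 1) < 2 ^ (t + 1) * x) = ((2 : ℝ) ^ e < 2 ^ t * x) := by
        intro x
        rw [pow_succ, pow_succ, mul_right_comm]
        exact propext (mul_lt_mul_iff_left₀ (by norm_num))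
      simp only [residual_cons, if_true, Bool.false_eq_true, if_false, hiff]
      have h1 := ih (t := t) ((a - Real.pi * 1) / 2)
      have h2 := ih (t := t) ((a - Real.pi * 0) / 2)
      rw [sin_half_sub_pi] at h1
      rw [cos_half_sub_pi]
      simp only [mul_zero, sub_zero] at h2 ⊢
      have hs : Real.sin a = 2 * Real.sin (a / 2) * Real.cos (a / 2) := by
        rw [← Real.sin_two_mul]; ring_nf
      calc _ ≤ Real.sin (a / 2) ^ 2 * (2 * (-Real.cos (a / 2)) ^ 2 / 2 ^ e) +
          Real.cos (a / 2) ^ 2 * (2 * Real.sin (a / 2) ^ 2 / 2 ^ e) :=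
            add_le_add (mul_le_mul_of_nonneg_left h1 (sq_nonneg _))
              (mul_le_mul_of_nonneg_left h2 (sq_nonneg _))
        _ = 2 * Real.sin a ^ 2 / 2 ^ (e + 1) := by rw [hs, pow_succ]; field_simp; ring

end PhaseTails

end QuantumIP

namespace QuantumIP

/-! ### Circuits that implement the operators on the core qubits. -/

namespace Expr

variable {Q : Type}

/-- The sum of the coefficients in a list over the qubits whose value is one. -/
noncomputable def weightedSum : List (Q × ℝ) → Expr Q
  | [] => const 0
  | p :: w => bin .add (bin .mul (const p.2) (bit p.1)) (weightedSum w)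

theorem eval_weightedSum (w : List (Q × ℝ)) (x : Q → Bool) (z : ℝ) :
    (weightedSum w).eval x z = angleSum w x := by
  induction w with
  | nil => rfl
  | cons p w ih =>
    simp only [weightedSum, eval, Arith.fn, ih, angleSum, List.map_cons, List.sum_cons]
    split_ifs <;> simp

theorem size_weightedSum (w : List (Q × ℝ)) : (weightedSum w).size = 4 * w.length + 1 := by
  induction w with
  | nil => rfl
  | cons p w ih =>
    simp only [weightedSum, size, ih, List.length_cons]
    ring

/-- All qubits in the list are zero. -/
noncomputable def isZero (l : List Q) : Expr Q := le (weightedSum (l.map fun q => (q, 1))) (const 0)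

theorem size_isZero (l : List Q) : (isZero l).size = 4 * l.length + 3 := by
  simp [isZero, size, size_weightedSum]

theorem test_isZero (l : List Q) (x : Q → Bool) (z : ℝ) :
    (isZero l).test x z = true ↔ ∀ q ∈ l, x q = false := by
  simp only [isZero, test, eval_weightedSum, eval, decide_eq_true_eq, angleSum, List.map_map,
    Function.comp_def]
  constructor
  · intro h q hq
    by_contra hx
    have h1 : (1 : ℝ) ∈ l.map fun q => if x q then (1 : ℝ) else 0 :=
      List.mem_map.mpr ⟨q, hq, by simp [hx]⟩
    have h2 := List.single_le_sum (l := l.map fun q => if x q then (1 : ℝ) else 0) (by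
      intro y hy
      obtain ⟨a, -, rfl⟩ := List.mem_map.mp hy
      split_ifs <;> norm_num) _ h1
    linarith
  · intro h
    rw [List.map_congr_left (g := fun _ => (0 : ℝ)) fun q hq => by simp [h q hq]]
    simp

end Expr

namespace Layout

variable {Q : Type} [DecidableEq Q] {d N n m : ℕ}

open Classical in
/-- The state with amplitudes `A` on the core qubits and zeros elsewhere. -/
noncomputable def lift (ℒ : Layout Q d N n m) (A : (Q → Bool) → ℂ) : State n m := fun b =>
  if ℒ.Clean b then A fun q => b.1 (ℒ.core q) else 0

/-- The circuit `C` acts on the core qubits as `T`. -/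
def Implements (ℒ : Layout Q d N n m) (Ou Ov : OracleSpace d ≃ₗᵢ[ℂ] OracleSpace d)
    (C : List (Gate d n m)) (T : ((Q → Bool) → ℂ) →ₗ[ℂ] ((Q → Bool) → ℂ)) : Prop :=
  ∀ A, run Ou Ov C (ℒ.lift A) = ℒ.lift (T A)

variable {ℒ : Layout Q d N n m} {Ou Ov : OracleSpace d ≃ₗᵢ[ℂ] OracleSpace d}

omit [DecidableEq Q] in
theorem Implements.nil : ℒ.Implements Ou Ov [] LinearMap.id := fun _ => rfl

omit [DecidableEq Q] in
theorem Implements.append {C C' : List (Gate d n m)}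
    {T T' : ((Q → Bool) → ℂ) →ₗ[ℂ] ((Q → Bool) → ℂ)} (h : ℒ.Implements Ou Ov C T)
    (h' : ℒ.Implements Ou Ov C' T') : ℒ.Implements Ou Ov (C ++ C') (T' ∘ₗ T) := fun A => by
  rw [run_append, h, h']
  rfl

omit [DecidableEq Q] in
theorem Implements.power {C : List (Gate d n m)}
    {T : ((Q → Bool) → ℂ) →ₗ[ℂ] ((Q → Bool) → ℂ)} (h : ℒ.Implements Ou Ov C T) (k : ℕ) :
    ℒ.Implements Ou Ov (List.replicate k C).flatten (T ^ k) := by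
  induction k with
  | zero => exact Implements.nil
  | succ k ih =>
    rw [List.replicate_succ, List.flatten_cons, pow_succ]
    exact h.append ih

omit [DecidableEq Q] in
theorem clean_of_lift_ne_zero {A : (Q → Bool) → ℂ} {b : Label n m} (h : ℒ.lift A b ≠ 0) :
    ℒ.Clean b := by
  by_contra hb
  exact h (if_neg hb)

omit [DecidableEq Q] in
theorem implements_mulOp {C : List (Gate d n m)} {f : (Q → Bool) → ℂ}
    (h : ∀ A, run Ou Ov C (ℒ.lift A) =
      fun b => f (fun q => b.1 (ℒ.core q)) * ℒ.lift A b) :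
    ℒ.Implements Ou Ov C (mulOp f) := fun A => by
  rw [h A]
  funext b
  simp only [lift, mulOp_apply, Pi.mul_apply]
  split_ifs <;> simp

theorem implements_qubit (U : Matrix.unitaryGroup Bool ℂ) (t : Q) :
    ℒ.Implements Ou Ov [.qubit U ∅ (ℒ.core t) (by simp) (by simp)] (qubitOp U t) := by
  intro A
  funext b
  have hcl : ∀ s, ℒ.Clean (Function.update b.1 (ℒ.core t) s, b.2) ↔ ℒ.Clean b := by
    intro s
    refine and_congr Iff.rfl (forall₂_congr fun q hq => ?_)
    exact Eq.congr (Function.update_of_ne (hq t) _ _) rfl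
  have hup : ∀ s, (fun q => Function.update b.1 (ℒ.core t) s (ℒ.core q)) =
      Function.update (fun q => b.1 (ℒ.core q)) t s := by
    intro s
    funext q
    by_cases hq : q = t
    · subst hq; simp
    · rw [Function.update_of_ne hq, Function.update_of_ne fun h => hq (ℒ.core.injective h)]
  simp only [run_cons, run_nil, Gate.apply, Finset.notMem_empty, false_imp_iff, implies_true,
    if_true, lift, qubitOp, LinearMap.coe_mk, AddHom.coe_mk, hup]
  by_cases hb : ℒ.Clean b
  · rw [if_pos hb]
    refine Finset.sum_congr rfl fun s _ => ?_
    rw [if_pos ((hcl s).mpr hb)]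
  · rw [if_neg hb]
    refine Finset.sum_eq_zero fun s _ => ?_
    rw [if_neg fun h => hb ((hcl s).mp h), mul_zero]

/-- A layer of Hadamard gates. -/
noncomputable def layerCircuit (ℒ : Layout Q d N n m) (l : List Q) : List (Gate d n m) :=
  l.map fun q => .qubit hadamardGate ∅ (ℒ.core q) (by simp) (by simp)

theorem implements_layer (l : List Q) :
    ℒ.Implements Ou Ov (ℒ.layerCircuit l) (layer l) := by
  induction l with
  | nil => exact Implements.nil
  | cons q l ih => exact (implements_qubit hadamardGate q).append ih

/-- A controlled phase rotation. -/
noncomputable def phaseCircuit (ℒ : Layout Q d N n m) (c : Q) (w : List (Q × ℝ)) :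
    List (Gate d n m) :=
  w.flatMap fun p => if h : c ≠ p.1 then
    [.qubit (phaseGate (fun s => if s then Complex.exp (-p.2 * Complex.I) else 1) fun s => by
      split_ifs
      · rw [← Complex.ofReal_neg, Complex.norm_exp_ofReal_mul_I]
      · simp) {ℒ.core p.1} (ℒ.core c) (by simp) (by
        simpa using fun e => h (ℒ.core.injective e))] else []

theorem length_phaseCircuit (c : Q) (w : List (Q × ℝ)) :
    (ℒ.phaseCircuit c w).length ≤ w.length := by
  induction w with
  | nil => simp [phaseCircuit]
  | cons p w ih =>
    have : ℒ.phaseCircuit c (p :: w) = ℒ.phaseCircuit c [p] ++ ℒ.phaseCircuit c w := by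
      simp [phaseCircuit]
    rw [this, List.length_append, List.length_cons, add_comm]
    refine add_le_add ih ?_
    simp only [phaseCircuit, List.flatMap_cons, List.flatMap_nil, List.append_nil]
    split_ifs <;> simp

/-- The angle is a sum over digits, so the rotation factors into gates controlled on one digit each.
-/
theorem implements_phase (c : Q) (w : List (Q × ℝ)) (hw : ∀ p ∈ w, p.1 ≠ c) :
    ℒ.Implements Ou Ov (ℒ.phaseCircuit c w) (phaseOp c w) := by
  induction w with
  | nil =>
    have : phaseOp c ([] : List (Q × ℝ)) = LinearMap.id := by
      ext1 A
      simp [phaseOp, mulOp_apply, angleSum]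
      funext x; simp
    rw [this]
    exact Implements.nil
  | cons p w ih =>
    have h1 : ℒ.Implements Ou Ov (ℒ.phaseCircuit c [p]) (phaseOp c [p]) := by
      have hp : c ≠ p.1 := (hw p (by simp)).symm
      simp only [phaseCircuit, List.flatMap_cons, List.flatMap_nil, List.append_nil, dif_pos hp]
      refine implements_mulOp fun A => ?_
      rw [run_cons, run_nil, apply_phaseGate]
      funext b
      congr 1
      simp only [Finset.mem_singleton, forall_eq, angleSum, List.map_cons, List.map_nil,
        List.sum_cons, List.sum_nil, add_zero]
      by_cases hb : b.1 (ℒ.core p.1) = true <;> simp [hb]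
    have h2 : ℒ.phaseCircuit c (p :: w) = ℒ.phaseCircuit c [p] ++ ℒ.phaseCircuit c w := by
      simp [phaseCircuit]
    have h3 : phaseOp c (p :: w) = phaseOp c w ∘ₗ phaseOp c [p] := by
      refine LinearMap.ext fun A => ?_
      simp only [phaseOp, LinearMap.comp_apply, mulOp_apply]
      funext x
      simp only [Pi.mul_apply, angleSum, List.map_cons, List.sum_cons, List.map_nil, List.sum_nil,
        add_zero, Complex.ofReal_add]
      cases x c
      · simp
      · simp only [if_true, ← mul_assoc, ← Complex.exp_add]
        congr 2
        ring
    rw [h2, h3]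
    exact h1.append (ih fun p hp => hw p (by simp [hp]))

/-- The controlled Grover iteration. -/
noncomputable def groverCircuit (ℒ : Layout Q d N n m) (l : List Q) (e f : Expr Q)
    (j : Fin (indexBits d) → Q) (c : Q) (hef : ℒ.flag e.size ≠ ℒ.flag 0) : List (Gate d n m) :=
  ℒ.markCircuit e f j c hef ++ (ℒ.layerCircuit l ++
    (ℒ.rejectCircuit (.isZero l) c ++ ℒ.layerCircuit l.reverse))

/-- The marking function of the Grover iteration. -/
noncomputable def marked (u v : Fin d → ℝ) (e f : Expr Q) (j : Fin (indexBits d) → Q)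
    (x : Q → Bool) : Bool :=
  e.test x 0 && f.test x (pad u (fun a => x (j a)) * pad v fun a => x (j a))

/-- The number of core qubits touched does not matter: auxiliary qubits and registers return to zero
after each sign flip, so the steps compose as operators on amplitude functions. -/
theorem implements_grover [Fintype Q] (l : List Q) (e f : Expr Q) (j : Fin (indexBits d) → Q)
    (c : Q) (hef : ℒ.flag e.size ≠ ℒ.flag 0) (hd : 0 < d) (hs : e.size + f.size ≤ N + 1)
    (hl : 4 * l.length + 3 ≤ N + 1)
    (he : ∀ x, e.test x 0 = true → ∃ i : Fin d, encode i = fun a => x (j a))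
    {u v : Fin d → ℝ} (hu : IsInputOracle Ou u) (hv : IsInputOracle Ov v) :
    ℒ.Implements Ou Ov (ℒ.groverCircuit l e f j c hef) (groverOp l c (marked u v e f j)) := by
  have h1 : ℒ.Implements Ou Ov (ℒ.markCircuit e f j c hef)
      (mulOp fun x => if x c = true ∧ marked u v e f j x = true then -1 else 1) := by
    refine implements_mulOp fun A => ?_
    rw [run_markCircuit ℒ e f j c hef hd hs he hu hv _ fun b hb => clean_of_lift_ne_zero hb]
    simp only [marked, Bool.and_eq_true]
  have h2 : ℒ.Implements Ou Ov (ℒ.rejectCircuit (.isZero l) c)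
      (mulOp fun x => if x c = true ∧ ¬ ∀ q ∈ l, x q = false then -1 else 1) := by
    refine implements_mulOp fun A => ?_
    rw [run_rejectCircuit ℒ _ c (by rw [Expr.size_isZero]; exact hl) Ou Ov _
      fun b hb => clean_of_lift_ne_zero hb]
    funext b
    congr 1
    refine if_congr (and_congr_right fun _ => ?_) rfl rfl
    rw [← Expr.test_isZero l _ 0, Bool.not_eq_true]
  exact h1.append ((implements_layer l).append (h2.append (implements_layer l.reverse)))

/-- A phase test. -/
noncomputable def testCircuit (ℒ : Layout Q d N n m) (l : List Q) (e f : Expr Q)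
    (j : Fin (indexBits d) → Q) (c : Q) (hef : ℒ.flag e.size ≠ ℒ.flag 0) (w : List (Q × ℝ))
    (k : ℕ) : List (Gate d n m) :=
  ℒ.layerCircuit [c] ++ (ℒ.phaseCircuit c w ++
    ((List.replicate k (ℒ.groverCircuit l e f j c hef)).flatten ++ ℒ.layerCircuit [c]))

theorem implements_test [Fintype Q] (l : List Q) (e f : Expr Q) (j : Fin (indexBits d) → Q)
    (c : Q) (hef : ℒ.flag e.size ≠ ℒ.flag 0) (hd : 0 < d) (hs : e.size + f.size ≤ N + 1)
    (hl : 4 * l.length + 3 ≤ N + 1)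
    (he : ∀ x, e.test x 0 = true → ∃ i : Fin d, encode i = fun a => x (j a))
    {u v : Fin d → ℝ} (hu : IsInputOracle Ou u) (hv : IsInputOracle Ov v) (w : List (Q × ℝ))
    (hw : ∀ p ∈ w, p.1 ≠ c) (k : ℕ) :
    ℒ.Implements Ou Ov (ℒ.testCircuit l e f j c hef w k)
      (testOp l c (marked u v e f j) w k) :=
  (implements_layer [c]).append ((implements_phase c w hw).append
    (((implements_grover l e f j c hef hd hs hl he hu hv).power k).append (implements_layer [c])))

end Layout

end QuantumIP

namespace QuantumIP

/-! ### Phase estimation on two search registers in several rounds. -/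

section Estimation

/-- The qubits of the estimation algorithm: the digits of `r` pairs of phases, the two search
registers with an index part and a grid part, and `g` random bits. -/
abbrev Core (r t q b g : ℕ) : Type :=
  (Fin r × Bool × Fin t) ⊕ (Bool × (Fin q ⊕ Fin b)) ⊕ Fin g

variable {r t q b g : ℕ}

/-- A qubit for a digit of a phase. -/
def digit (c : Fin r × Bool × Fin t) : Core r t q b g := Sum.inl c

/-- A qubit of the search register `s`. -/
def searchQubit (s : Bool) (i : Fin q ⊕ Fin b) : Core r t q b g := Sum.inr (Sum.inl (s, i))

/-- A random bit. -/
def guessQubit (i : Fin g) : Core r t q b g := Sum.inr (Sum.inr i)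

/-- The qubits of the search register `s`. -/
noncomputable def searchList (s : Bool) : List (Core r t q b g) :=
  (Finset.univ : Finset (Fin q ⊕ Fin b)).toList.map (searchQubit s)

theorem mem_searchList {s : Bool} {a : Core r t q b g} :
    a ∈ searchList s ↔ ∃ i, searchQubit s i = a := by
  simp [searchList]

theorem nodup_searchList (s : Bool) : (searchList s : List (Core r t q b g)).Nodup := by
  refine (Finset.nodup_toList _).map fun i j h => ?_
  simpa [searchQubit] using h

theorem length_searchList (s : Bool) : (searchList s : List (Core r t q b g)).length = q + b := by
  simp [searchList]

theorem digit_notMem_searchList (c : Fin r × Bool × Fin t) (s : Bool) :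
    (digit c : Core r t q b g) ∉ searchList s := by
  rw [mem_searchList]
  rintro ⟨i, hi⟩
  simp [digit, searchQubit] at hi

theorem notMem_searchList_not {s : Bool} {a : Core r t q b g} (ha : a ∈ searchList s) :
    a ∉ searchList (!s) := by
  rw [mem_searchList] at ha ⊢
  obtain ⟨i, rfl⟩ := ha
  rintro ⟨j, hj⟩
  simp [searchQubit] at hj

/-- The qubits which are initially put into uniform superposition. -/
noncomputable def uniformList : List (Core r t q b g) :=
  searchList true ++ (searchList false ++ (List.finRange g).map guessQubit)

theorem nodup_uniformList : (uniformList : List (Core r t q b g)).Nodup := by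
  refine (nodup_searchList true).append ((nodup_searchList false).append
    ((List.nodup_finRange g).map fun i j h => ?_) ?_) ?_
  · simpa [guessQubit] using h
  · intro a h1 h2
    obtain ⟨i, rfl⟩ := mem_searchList.mp h1
    simp [guessQubit, searchQubit] at h2
  · intro a h1 h2
    rcases List.mem_append.mp h2 with h2 | h2
    · exact notMem_searchList_not h1 h2
    · obtain ⟨i, rfl⟩ := mem_searchList.mp h1
      simp [guessQubit, searchQubit] at h2

theorem length_uniformList :
    (uniformList : List (Core r t q b g)).length = 2 * (q + b) + g := by
  simp only [uniformList, List.length_append, length_searchList, List.length_map,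
    List.length_finRange]
  ring

theorem mem_uniformList {a : Core r t q b g} :
    a ∈ uniformList ↔ ∀ c, a ≠ digit c := by
  simp only [uniformList, List.mem_append, mem_searchList, List.mem_map, List.mem_finRange, true_and]
  constructor
  · rintro (⟨i, rfl⟩ | ⟨i, rfl⟩ | ⟨i, rfl⟩) <;> intro c <;> simp [searchQubit, guessQubit, digit]
  · intro h
    rcases a with c | ⟨s, i⟩ | i
    · exact absurd rfl (h c)
    · cases s
      · exact Or.inr (Or.inl ⟨i, rfl⟩)
      · exact Or.inl ⟨i, rfl⟩
    · exact Or.inr (Or.inr ⟨i, rfl⟩)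

/-- The digits of the phase `s` of round `ρ`. -/
def digits (x : Core r t q b g → Bool) (ρ : Fin r) (s : Bool) : Fin t → Bool :=
  fun l => x (digit (ρ, s, l))

/-- The angles by which a phase test is corrected. -/
noncomputable def corrections (c : Fin r × Bool × Fin t) : List (Core r t q b g × ℝ) :=
  ((List.finRange t).filter fun k => k < c.2.2).map fun k =>
    (digit (c.1, c.2.1, k), Real.pi * 2 ^ (k : ℕ) / 2 ^ (c.2.2 : ℕ))

theorem angleSum_corrections (c : Fin r × Bool × Fin t) (x : Core r t q b g → Bool) :
    angleSum (corrections c) x =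
      Real.pi * bitSum (digits x c.1 c.2.1) c.2.2 / 2 ^ (c.2.2 : ℕ) := by
  have h : ∀ (l : List (Fin t)) (p : Fin t → Bool) (F : Fin t → ℝ),
      ((l.filter p).map F).sum = (l.map fun k => if p k then F k else 0).sum := by
    intro l p F
    induction l with
    | nil => rfl
    | cons a l ih => cases hp : p a <;> simp [hp, ih]
  simp only [angleSum, corrections, List.map_map, Function.comp_def]
  rw [h, ← List.ofFn_eq_map, List.sum_ofFn, bitSum, Finset.mul_sum, Finset.sum_div]
  refine Finset.sum_congr rfl fun k _ => ?_
  have : ((k : ℕ) < (c.2.2 : ℕ)) ↔ k < c.2.2 := Iff.rfl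
  simp only [decide_eq_true_eq, digits, this]
  by_cases h1 : k < c.2.2 <;> by_cases h2 : x (digit (c.1, c.2.1, k)) = true <;> simp [h1, h2]

theorem length_corrections (c : Fin r × Bool × Fin t) :
    (corrections c : List (Core r t q b g × ℝ)).length ≤ t := by
  simp only [corrections, List.length_map]
  exact (List.length_filter_le _ _).trans (by simp)

theorem mem_corrections {c : Fin r × Bool × Fin t} {p : Core r t q b g × ℝ}
    (hp : p ∈ corrections c) : ∃ k < c.2.2, p.1 = digit (c.1, c.2.1, k) := by
  simp only [corrections, List.mem_map, List.mem_filter, List.mem_finRange, true_and,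
    decide_eq_true_eq] at hp
  obtain ⟨k, hk, rfl⟩ := hp
  exact ⟨k, hk, rfl⟩

/-- The amplitude factor of a phase test. -/
noncomputable def testFactor (φ : Bool → ℝ) (c : Fin r × Bool × Fin t)
    (x : Core r t q b g → Bool) : ℂ :=
  (1 + (if x (digit c) then -1 else 1) *
    Complex.exp ((residual (2 ^ t * (φ c.2.1 / 2)) (digits x c.1 c.2.1) c.2.2 : ℝ) *
      Complex.I)) / 2

theorem bitSum_succ (y : Fin t → Bool) (l : Fin t) :
    bitSum y (l + 1) = bitSum y l + if y l then 2 ^ (l : ℕ) else 0 := by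
  have : ∀ k : Fin t, (if (k : ℕ) < l + 1 ∧ y k = true then (2 : ℝ) ^ (k : ℕ) else 0) =
      (if (k : ℕ) < l ∧ y k = true then 2 ^ (k : ℕ) else 0) +
        if k = l then (if y l then 2 ^ (l : ℕ) else 0) else 0 := by
    intro k
    by_cases h : k = l
    · subst h; simp
    · have h2 : (k : ℕ) ≠ l := fun e => h (Fin.ext e)
      have h3 : (k : ℕ) < l + 1 ↔ (k : ℕ) < l := by omega
      simp [h, h3]
  simp only [bitSum, this, Finset.sum_add_distrib, Finset.sum_ite_eq', Finset.mem_univ, if_true]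

/-- With `α` the residual phase, `|1 ± exp (iα)| ^ 2 / 4` is `cos (α / 2) ^ 2` or `sin (α / 2) ^ 2`.
Recording the new digit shifts `α / 2` by `π / 2` in the second case, so both are a factor of
`chain`. -/
theorem normSq_testFactor (φ : Bool → ℝ) (c : Fin r × Bool × Fin t)
    (x : Core r t q b g → Bool) :
    ‖testFactor φ c x‖ ^ 2 =
      Real.cos (residual (2 ^ t * (φ c.2.1 / 2)) (digits x c.1 c.2.1) (c.2.2 + 1)) ^ 2 := by
  have hr : residual (2 ^ t * (φ c.2.1 / 2)) (digits x c.1 c.2.1) (c.2.2 + 1) =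
      (residual (2 ^ t * (φ c.2.1 / 2)) (digits x c.1 c.2.1) c.2.2 -
        Real.pi * if x (digit c) then 1 else 0) / 2 := by
    have : digits x c.1 c.2.1 c.2.2 = x (digit c) := rfl
    rw [residual, residual, bitSum_succ, this, pow_succ]
    cases x (digit c)
    · simp only [Bool.false_eq_true, if_false]
      field_simp
      ring
    · simp only [if_true]
      field_simp
      ring
  rw [hr, testFactor]
  set α := residual (2 ^ t * (φ c.2.1 / 2)) (digits x c.1 c.2.1) c.2.2
  have hα : Real.cos α = 2 * Real.cos (α / 2) ^ 2 - 1 := by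
    rw [← Real.cos_two_mul]; ring_nf
  have hsq := Real.sin_sq_add_cos_sq α
  have hsq2 := Real.sin_sq_add_cos_sq (α / 2)
  rw [← Complex.normSq_eq_norm_sq, Complex.exp_mul_I, ← Complex.ofReal_cos, ← Complex.ofReal_sin]
  cases x (digit c)
  · simp [Complex.normSq_apply, -Complex.ofReal_cos, -Complex.ofReal_sin]
    linarith
  · simp only [if_true, cos_half_sub_pi]
    simp [Complex.normSq_apply, -Complex.ofReal_cos, -Complex.ofReal_sin]
    linarith

theorem indep_digits {x : Core r t q b g} {ρ : Fin r} {s : Bool} (h : ∀ l, x ≠ digit (ρ, s, l)) :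
    Indep x fun y => digits y ρ s := by
  intro y v
  funext l
  exact Function.update_of_ne (h l).symm _ _

theorem indep_testFactor (φ : Bool → ℝ) {c : Fin r × Bool × Fin t} {x : Core r t q b g}
    (h : ∀ l ≤ c.2.2, x ≠ digit (c.1, c.2.1, l)) : Indep x (testFactor φ c) := by
  intro y v
  have h1 : Function.update y x v (digit c) = y (digit c) :=
    Function.update_of_ne (h c.2.2 le_rfl).symm _ _
  have h2 : bitSum (digits (Function.update y x v) c.1 c.2.1) c.2.2 =
      bitSum (digits y c.1 c.2.1) c.2.2 := by
    refine Finset.sum_congr rfl fun k _ => ?_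
    by_cases hk : k ≤ c.2.2
    · have : digits (Function.update y x v) c.1 c.2.1 k = digits y c.1 c.2.1 k :=
        Function.update_of_ne (h k hk).symm _ _
      rw [this]
    · have : ¬ ((k : ℕ) < c.2.2) := fun h => hk h.le
      simp [this]
  rw [testFactor, testFactor, h1, residual, residual, h2]

/-- The composition of phase tests. -/
noncomputable def testsOp (f : Bool → (Core r t q b g → Bool) → Bool) :
    List (Fin r × Bool × Fin t) →
      (((Core r t q b g → Bool) → ℂ) →ₗ[ℂ] ((Core r t q b g → Bool) → ℂ))
  | [] => LinearMap.id
  | c :: L => testsOp f L ∘ₗ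
      testOp (searchList c.2.1) (digit c) (f c.2.1) (corrections c) (2 ^ (t - 1 - c.2.2))

/-- Each test contributes one factor, which is absorbed into `B`. It depends on digits of the same
phase up to its own position; since the tests are ordered by position, the controls of later tests
are not among them and are still zero. -/
theorem testsOp_apply {f : Bool → (Core r t q b g → Bool) → Bool}
    (hf : ∀ s a, a ∉ searchList s → Indep a (f s)) {φ : Bool → ℝ}
    {Φ : Bool → (Core r t q b g → Bool) → ℂ} (hΦ : ∀ s a, a ∉ searchList s → Indep a (Φ s))
    (hφ : ∀ s x, 2 * mean (fun y => (if f s y then -1 else 1) * Φ s y) -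
      (if f s x then -1 else 1) * Φ s x = Complex.exp (φ s * Complex.I) * Φ s x)
    {L : List (Fin r × Bool × Fin t)} (hL : L.Nodup)
    (hL' : L.Pairwise fun c c' => c.2.2 ≤ c'.2.2) {B : (Core r t q b g → Bool) → ℂ}
    (hB : ∀ s, ∀ a ∈ searchList s, Indep a B) (hB' : ∀ c ∈ L, Indep (digit c) B) :
    testsOp f L (B * zeroOn (L.map digit) * (Φ true * Φ false)) =
      B * (L.map (testFactor φ)).prod * (Φ true * Φ false) := by
  induction L generalizing B with
  | nil => funext x; simp [testsOp, zeroOn]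
  | cons c L ih =>
    rw [List.nodup_cons] at hL
    rw [List.pairwise_cons] at hL'
    -- The eigenvector in the other search register is a spectator.
    have hprod : Φ true * Φ false = Φ (!c.2.1) * Φ c.2.1 := by
      cases c.2.1 <;> simp [mul_comm]
    have hdig : ∀ c' ∈ L, digit c ≠ (digit c' : Core r t q b g) := fun c' hc' h =>
      hL.1 (Sum.inl_injective h ▸ hc')
    have iZ : ∀ s, ∀ a ∈ searchList s, Indep a (zeroOn (L.map digit) : (Core r t q b g → Bool) → ℂ) := by
      intro s a ha
      refine indep_zeroOn fun h => ?_
      obtain ⟨c', -, rfl⟩ := List.mem_map.mp h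
      exact digit_notMem_searchList c' s ha
    have step : testOp (searchList c.2.1) (digit c) (f c.2.1) (corrections c)
        (2 ^ (t - 1 - c.2.2)) (B * zeroOn ((c :: L).map digit) * (Φ true * Φ false)) =
        (B * testFactor φ c) * zeroOn (L.map digit) * (Φ true * Φ false) := by
      have h1 : B * zeroOn ((c :: L).map digit) * (Φ true * Φ false) =
          (B * zeroOn (L.map digit) * Φ (!c.2.1)) * zeroOn [digit c] * Φ c.2.1 := by
        rw [hprod, List.map_cons, zeroOn_cons]
        ring
      rw [h1, testOp_apply (nodup_searchList _) (digit_notMem_searchList _ _) (hf _) (B :=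
        B * zeroOn (L.map digit) * Φ (!c.2.1)) (φ := φ c.2.1) _ _ _ (hΦ _) (hφ _), hprod]
      · have : (fun x => (1 + (if x (digit c) = true then -1 else 1) * Complex.exp
            (((2 ^ (t - 1 - c.2.2) : ℕ) * φ c.2.1 - angleSum (corrections c) x : ℝ) * Complex.I)) / 2) =
            (testFactor φ c : (Core r t q b g → Bool) → ℂ) := by
          funext x
          rw [testFactor, angleSum_corrections, residual]
          -- Testing this power makes the kicked-back phase `2 ^ t * (φ / 2) / 2 ^ l`; the natural
          -- subtraction is exact because `l < t`.
          have hlt : ((2 ^ (t - 1 - (c.2.2 : ℕ)) : ℕ) : ℝ) = 2 ^ t / 2 / 2 ^ (c.2.2 : ℕ) := by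
            have : (2 : ℝ) ^ t = 2 ^ (t - 1 - (c.2.2 : ℕ)) * 2 ^ (c.2.2 : ℕ) * 2 := by
              rw [← pow_add, ← pow_succ]
              congr 1
              have := c.2.2.2
              omega
            rw [this]
            push_cast
            field_simp
          rw [hlt]
          congr 6
          ring
        rw [this]
        ring
      · intro p hp
        obtain ⟨k, hk, h2⟩ := mem_corrections hp
        rw [h2]
        refine ⟨fun h => ?_, digit_notMem_searchList _ _⟩
        have := Sum.inl_injective h
        rw [← this] at hk
        exact lt_irrefl _ hk
      · intro a ha
        exact ((hB _ a ha).mul (iZ _ a ha)).mul (hΦ _ a (notMem_searchList_not ha))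
      · refine ((hB' c (by simp)).mul (indep_zeroOn fun h => ?_)).mul
          (hΦ _ _ (digit_notMem_searchList _ _))
        obtain ⟨c', hc', h2⟩ := List.mem_map.mp h
        exact hdig c' hc' h2.symm
    have hcomp : testsOp f (c :: L) (B * zeroOn ((c :: L).map digit) * (Φ true * Φ false)) =
        testsOp f L (testOp (searchList c.2.1) (digit c) (f c.2.1) (corrections c)
        (2 ^ (t - 1 - c.2.2)) (B * zeroOn ((c :: L).map digit) * (Φ true * Φ false))) := rfl
    rw [hcomp, step, ih hL.2 hL'.2]
    · rw [List.map_cons, List.prod_cons, mul_assoc B]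
    · intro s a ha
      refine (hB s a ha).mul (indep_testFactor φ fun l _ h => ?_)
      exact digit_notMem_searchList _ s (h ▸ ha)
    · intro c' hc'
      refine (hB' c' (by simp [hc'])).mul (indep_testFactor φ fun l hl h => ?_)
      have h2 := Sum.inl_injective h
      have h3 := hL'.1 c' hc'
      rw [h2] at h3
      have h4 : l = c.2.2 := le_antisymm hl h3
      rw [h4] at h2
      exact hL.1 (by rw [h2] at hc'; exact hc')

/-- All phase tests, the most significant powers first. -/
noncomputable def testList (r t : ℕ) : List (Fin r × Bool × Fin t) :=
  (List.finRange t).flatMap fun l =>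
    (Finset.univ : Finset (Fin r × Bool)).toList.map fun p => (p.1, p.2, l)

theorem mem_testList (c : Fin r × Bool × Fin t) : c ∈ testList r t := by
  simp only [testList, List.mem_flatMap, List.mem_finRange, List.mem_map, Finset.mem_toList,
    Finset.mem_univ, true_and]
  exact ⟨c.2.2, (c.1, c.2.1), rfl⟩

theorem pairwise_testList : (testList r t).Pairwise fun c c' => c.2.2 ≤ c'.2.2 := by
  rw [testList, List.pairwise_flatMap]
  refine ⟨fun l _ => ?_, ?_⟩
  · rw [List.pairwise_map]
    exact List.pairwise_of_forall (R := fun _ _ => l ≤ l) fun _ _ => le_rfl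
  · refine (List.pairwise_le_finRange t).imp fun h x hx y hy => ?_
    obtain ⟨_, -, rfl⟩ := List.mem_map.mp hx
    obtain ⟨_, -, rfl⟩ := List.mem_map.mp hy
    exact h

theorem nodup_testList : (testList r t).Nodup := by
  rw [testList, List.nodup_flatMap]
  refine ⟨fun l _ => (Finset.nodup_toList _).map fun p p' h => ?_, ?_⟩
  · simp only [Prod.mk.injEq, and_true] at h
    exact Prod.ext h.1 h.2
  · refine (List.nodup_finRange t).imp fun h x hx hy => ?_
    obtain ⟨_, -, rfl⟩ := List.mem_map.mp hx
    obtain ⟨_, -, h2⟩ := List.mem_map.mp hy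
    simp only [Prod.mk.injEq] at h2
    exact h h2.2.2.symm

end Estimation

end QuantumIP

namespace QuantumIP

/-! ### The distribution of the measured digits. -/

section Probability

variable {r t q b g : ℕ}

theorem zeroOn_append {Q : Type} (l l' : List Q) : zeroOn (l ++ l') = zeroOn l * zeroOn l' := by
  induction l with
  | nil => funext x; simp [zeroOn]
  | cons a l ih => rw [List.cons_append, zeroOn_cons, ih, zeroOn_cons a l, mul_assoc]

theorem layer_reverse_zeroOn {Q : Type} [DecidableEq Q] {l : List Q} (hl : l.Nodup) :
    layer l.reverse (zeroOn l) = fun _ => (1 / (Real.sqrt 2 : ℂ)) ^ l.length := by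
  have h2 : (Real.sqrt 2 : ℂ) ≠ 0 := by
    rw [Ne, Complex.ofReal_eq_zero]; positivity
  have h : zeroOn l = ((1 / (Real.sqrt 2 : ℂ)) ^ l.length) • layer l 1 := by
    rw [layer_one hl, smul_smul, ← mul_pow, one_div_mul_cancel h2, one_pow, one_smul]
  rw [h, map_smul, layer_reverse]
  funext x
  simp

/-- The amplitudes of the core qubits after the phase tests. -/
noncomputable def finalAmplitude (f : Bool → (Core r t q b g → Bool) → Bool) :
    (Core r t q b g → Bool) → ℂ :=
  testsOp f (testList r t) (layer uniformList.reverse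
    (zeroOn ((testList r t).map digit ++ uniformList)))

/-- The probability that the phase tests of all rounds yield the digits in `x`, if the phases are
`φ`. -/
noncomputable def digitProb (φ : Bool → ℝ) (x : Core r t q b g → Bool) : ℝ :=
  ∏ ρ, ∏ s, chain (2 ^ t * (φ s / 2)) (digits x ρ s)

theorem list_prod_testFactor (φ : Bool → ℝ) (x : Core r t q b g → Bool) :
    ‖((testList r t).map (testFactor φ)).prod x‖ ^ 2 = digitProb φ x := by
  have h1 : ((testList r t).map (testFactor φ)).prod x =
      ∏ c : Fin r × Bool × Fin t, testFactor φ c x := by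
    have h2 : (testList r t).toFinset = Finset.univ :=
      Finset.eq_univ_iff_forall.mpr fun c => List.mem_toFinset.mpr (mem_testList c)
    rw [← List.prod_toFinset _ nodup_testList, h2, Finset.prod_apply]
  rw [h1, norm_prod, ← Finset.prod_pow, digitProb]
  simp only [normSq_testFactor, Fintype.prod_prod_type, chain]

/-- In each search register the uniform state is the sum of two eigenvectors. Expanding the product
gives four terms, on which the tests act by scalar functions of the digits. -/
theorem finalAmplitude_eq {f : Bool → (Core r t q b g → Bool) → Bool}
    (hf : ∀ s a, a ∉ searchList s → Indep a (f s)) {φ : Bool → Bool → ℝ}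
    {Φ : Bool → Bool → (Core r t q b g → Bool) → ℂ}
    (hΦ : ∀ s σ a, a ∉ searchList s → Indep a (Φ s σ))
    (hsum : ∀ s x, Φ s true x + Φ s false x = 1)
    (hφ : ∀ s σ x, 2 * mean (fun y => (if f s y then -1 else 1) * Φ s σ y) -
      (if f s x then -1 else 1) * Φ s σ x = Complex.exp (φ s σ * Complex.I) * Φ s σ x) :
    finalAmplitude f = fun x => (1 / (Real.sqrt 2 : ℂ)) ^ (2 * (q + b) + g) *
      ∑ a : Bool × Bool, ((testList r t).map
        (testFactor fun s => φ s (if s then a.1 else a.2))).prod x *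
          (Φ true a.1 x * Φ false a.2 x) := by
  have h1 : layer uniformList.reverse (zeroOn ((testList r t).map digit ++ uniformList)) =
      ((1 / (Real.sqrt 2 : ℂ)) ^ (2 * (q + b) + g)) • ∑ a : Bool × Bool,
        (1 * zeroOn ((testList r t).map (digit (q := q) (b := b) (g := g))) *
          (Φ true a.1 * Φ false a.2)) := by
    rw [zeroOn_append, layer_mul, layer_reverse_zeroOn nodup_uniformList, length_uniformList]
    · have hone : ∑ a : Bool × Bool, Φ true a.1 * Φ false a.2 = 1 := by
        funext x
        simp only [Finset.sum_apply, Pi.mul_apply, Fintype.sum_prod_type, Fintype.sum_bool,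
          ← mul_add, hsum, mul_one, Pi.one_apply]
      rw [← Finset.mul_sum, hone]
      funext x
      simp [mul_comm]
    · intro a ha
      refine indep_zeroOn fun h => ?_
      obtain ⟨c, -, rfl⟩ := List.mem_map.mp h
      exact mem_uniformList.mp (List.mem_reverse.mp ha) c rfl
  rw [finalAmplitude, h1, map_smul, map_sum]
  have h2 : ∀ a : Bool × Bool, testsOp f (testList r t)
      (1 * zeroOn ((testList r t).map digit) * (Φ true a.1 * Φ false a.2)) =
      1 * ((testList r t).map (testFactor fun s => φ s (if s then a.1 else a.2))).prod *
        (Φ true a.1 * Φ false a.2) := by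
    intro a
    have := testsOp_apply (f := f) hf (φ := fun s => φ s (if s then a.1 else a.2))
      (Φ := fun s => Φ s (if s then a.1 else a.2)) (fun s => hΦ s _) (fun s => hφ s _)
      nodup_testList pairwise_testList (B := 1) (fun _ _ _ => indep_const _ _)
      (fun _ _ => indep_const _ _)
    simpa using this
  rw [Finset.sum_congr rfl fun a _ => h2 a]
  funext x
  simp

open Classical in
/-- The distribution of the measured digits is a mixture of products of phase test
distributions. -/
theorem exists_mixture {f : Bool → (Core r t q b g → Bool) → Bool}
    (hf : ∀ s a, a ∉ searchList s → Indep a (f s)) :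
    ∃ w : Bool × Bool → ℝ, (∀ a, 0 ≤ w a) ∧ ∑ a, w a = 1 ∧
      ∀ good : (Core r t q b g → Bool) → Prop, (∀ s, ∀ a ∈ searchList s, Indep a good) →
        ∑ x, (if good x then ‖finalAmplitude f x‖ ^ 2 else 0) = ∑ a, w a *
          ((∑ x, if good x then digitProb (fun s => groverPhase (f s) (if s then a.1 else a.2)) x
            else 0) / 2 ^ (2 * (q + b) + g)) := by
  choose Φ hΦ hsum horth hφ using fun s => exists_grover_eigenvectors (hf s)
  have hfin := finalAmplitude_eq hf hΦ hsum hφ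
  set Ψ : Bool × Bool → (Core r t q b g → Bool) → ℂ := fun a x => Φ true a.1 x * Φ false a.2 x
    with hΨ
  set P : Bool × Bool → (Core r t q b g → Bool) → ℂ := fun a =>
    ((testList r t).map (testFactor fun s => groverPhase (f s) (if s then a.1 else a.2))).prod
    with hP
  set K : ℝ := 2 ^ Fintype.card (Core r t q b g) with hK
  have hK0 : (0 : ℝ) < K := by positivity
  set w : Bool × Bool → ℝ := fun a => (∑ x, ‖Ψ a x‖ ^ 2) / K with hw
  -- The reverse order of the two eigenvectors follows by conjugation.
  have orth : ∀ s σ σ', σ ≠ σ' → mean (fun x => Φ s σ x * star (Φ s σ' x)) = 0 := by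
    intro s σ σ' hne
    have h := horth s
    cases σ <;> cases σ' <;> first | exact absurd rfl hne | exact h | skip
    have h2 := congrArg star h
    simp only [mean, star_div₀, star_sum, star_mul', star_star, star_zero] at h2 ⊢
    rw [← h2]
    congr 1
    · exact Finset.sum_congr rfl fun x _ => mul_comm _ _
    · simp
  -- Means over the two search registers factor, and a pair differs from another in at least one
  -- register.
  have cross : ∀ a a', a ≠ a' → mean (fun x => Ψ a x * star (Ψ a' x)) = 0 := by
    intro a a' hne
    have h1 : (fun x => Ψ a x * star (Ψ a' x)) =
        (fun x => Φ true a.1 x * star (Φ true a'.1 x)) *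
          fun x => Φ false a.2 x * star (Φ false a'.2 x) := by
      funext x
      simp only [hΨ, Pi.mul_apply, star_mul']
      ring
    rw [h1, mean_mul (l := searchList false)]
    · by_cases h : a.1 = a'.1
      · rw [orth false _ _ fun h2 => hne (Prod.ext h h2), mul_zero]
      · rw [orth true _ _ h, zero_mul]
    · intro c hc
      exact (hΦ true _ c (notMem_searchList_not hc)).comp₂
        (hΦ true _ c (notMem_searchList_not hc)) fun z z' => z * star z'
    · intro c hc
      exact (hΦ false _ c hc).comp₂ (hΦ false _ c hc) fun z z' => z * star z'
  have diag : ∀ a, mean (fun x => Ψ a x * star (Ψ a x)) = (w a : ℂ) := by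
    intro a
    simp only [mean, hw, hK]
    push_cast
    congr 1
    refine Finset.sum_congr rfl fun x _ => ?_
    exact Complex.mul_conj' _
  -- Coefficients that do not involve the search registers leave the mean, so orthogonality removes
  -- all interference between different eigenvector pairs.
  have key : ∀ h : Bool × Bool → Bool × Bool → (Core r t q b g → Bool) → ℂ,
      (∀ a a' s, ∀ c ∈ searchList s, Indep c (h a a')) →
      mean (fun x => ∑ a, ∑ a', h a a' x * (Ψ a x * star (Ψ a' x))) =
        ∑ a, mean (h a a) * w a := by
    intro h hh
    have h1 : mean (fun x => ∑ a, ∑ a', h a a' x * (Ψ a x * star (Ψ a' x))) =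
        ∑ a, ∑ a', mean (h a a' * fun x => Ψ a x * star (Ψ a' x)) := by
      simp only [mean, Pi.mul_apply, ← Finset.sum_div]
      congr 1
      rw [Finset.sum_comm]
      refine Finset.sum_congr rfl fun a _ => ?_
      rw [Finset.sum_comm]
    rw [h1]
    refine Finset.sum_congr rfl fun a _ => ?_
    have h2 : ∀ a', mean (h a a' * fun x => Ψ a x * star (Ψ a' x)) =
        mean (h a a') * mean (fun x => Ψ a x * star (Ψ a' x)) := by
      intro a'
      refine mean_mul (l := searchList true ++ searchList false) (fun c hc => ?_) fun c hc => ?_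
      · rcases List.mem_append.mp hc with hc | hc
        · exact hh a a' _ c hc
        · exact hh a a' _ c hc
      · rw [List.mem_append, not_or] at hc
        have hi : ∀ a, Indep c (Ψ a) := fun a =>
          (hΦ true _ c hc.1).comp₂ (hΦ false _ c hc.2) fun z z' => z * z'
        exact (hi a).comp₂ (hi a') fun z z' => z * star z'
    simp only [h2]
    rw [Finset.sum_eq_single a]
    · rw [diag]
    · intro a' _ hne
      rw [cross a a' hne.symm, mul_zero]
    · simp
  refine ⟨w, fun a => div_nonneg (Finset.sum_nonneg fun x _ => sq_nonneg _) hK0.le, ?_, ?_⟩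
  -- The four components add up to the constant `1`, whose squared norm is the sum of theirs.
  · have h1 := key (fun _ _ _ => 1) fun _ _ _ _ _ => indep_const _ _
    have h2 : (fun x => ∑ a, ∑ a', 1 * (Ψ a x * star (Ψ a' x))) = fun _ => (1 : ℂ) := by
      funext x
      have h3 : ∑ a, Ψ a x = 1 := by
        simp only [hΨ, Fintype.sum_prod_type, Fintype.sum_bool, ← mul_add, hsum, mul_one]
      simp only [one_mul, ← Finset.mul_sum, ← star_sum, ← Finset.sum_mul, h3, star_one]
    rw [h2, mean_const] at h1
    simp only [one_mul] at h1
    exact_mod_cast h1.symm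
  · intro good hgood
    set κ : ℂ := (1 / (Real.sqrt 2 : ℂ)) ^ (2 * (q + b) + g) with hκ
    have hκ2 : κ * star κ = ((1 / 2 ^ (2 * (q + b) + g) : ℝ) : ℂ) := by
      have h1 : star κ = κ := by
        rw [hκ]
        simp
      rw [h1, hκ, ← mul_pow, inv_sqrt_two_mul_self]
      push_cast
      rw [one_div_pow]
    have iP : ∀ a s, ∀ c ∈ searchList s, Indep c (P a) := by
      intro a s c hc x v
      simp only [hP]
      have hl : ∀ L : List (Fin r × Bool × Fin t), (L.map (testFactor fun s => groverPhase (f s)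
          (if s then a.1 else a.2))).prod (Function.update x c v) =
          (L.map (testFactor fun s => groverPhase (f s) (if s then a.1 else a.2))).prod x := by
        intro L
        induction L with
        | nil => rfl
        | cons p L ih =>
          simp only [List.map_cons, List.prod_cons, Pi.mul_apply, ih]
          rw [indep_testFactor _ (fun l _ h => digit_notMem_searchList _ s (h ▸ hc)) x v]
      exact hl _
    have h1 := key (fun a a' x => (if good x then (1 : ℂ) else 0) * (P a x * star (P a' x)))
      fun a a' s c hc => (hgood s c hc).comp₂
        ((iP a s c hc).comp₂ (iP a' s c hc) fun z z' => z * star z')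
          fun (p : Prop) (z : ℂ) => (if p then (1 : ℂ) else 0) * z
    have h2 : ((∑ x, (if good x then ‖finalAmplitude f x‖ ^ 2 else 0) : ℝ) : ℂ) =
        κ * star κ * (K * mean (fun x => ∑ a, ∑ a', (if good x then (1 : ℂ) else 0) *
          (P a x * star (P a' x)) * (Ψ a x * star (Ψ a' x)))) := by
      have hKc : (2 : ℂ) ^ Fintype.card (Core r t q b g) = (K : ℂ) := by rw [hK]; push_cast; rfl
      have hKc0 : (K : ℂ) ≠ 0 := by exact_mod_cast hK0.ne'
      rw [mean, hKc, mul_div_cancel₀ _ hKc0, Finset.mul_sum, Complex.ofReal_sum]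
      refine Finset.sum_congr rfl fun x _ => ?_
      by_cases hg : good x
      · simp only [hg, if_true, one_mul]
        rw [Complex.ofReal_pow, ← Complex.mul_conj', hfin]
        have : ∀ a a', P a x * star (P a' x) * (Ψ a x * star (Ψ a' x)) =
            (P a x * Ψ a x) * star (P a' x * Ψ a' x) := by
          intro a a'
          rw [star_mul' (P a' x) (Ψ a' x)]; ring
        simp only [this, ← Finset.mul_sum, ← star_sum, ← Finset.sum_mul]
        rw [map_mul]
        change _ * _ * (star κ * star _) = _
        ring
      · simp [hg]
    have h3 : ∀ a, mean (fun x => (if good x then (1 : ℂ) else 0) * (P a x * star (P a x))) =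
        ((∑ x, if good x then digitProb (fun s => groverPhase (f s) (if s then a.1 else a.2)) x
            else 0 : ℝ) : ℂ) / K := by
      intro a
      rw [mean, hK]
      push_cast
      congr 1
      refine Finset.sum_congr rfl fun x _ => ?_
      by_cases hg : good x
      · simp only [hg, if_true, one_mul]
        rw [← list_prod_testFactor]
        push_cast
        exact Complex.mul_conj' _
      · simp [hg]
    rw [h1, hκ2] at h2
    simp only [h3] at h2
    have hKc0 : (K : ℂ) ≠ 0 := by exact_mod_cast hK0.ne'
    apply Complex.ofReal_injective
    rw [h2]
    rw [Finset.mul_sum, Finset.mul_sum, Complex.ofReal_sum]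
    refine Finset.sum_congr rfl fun a _ => ?_
    rw [Complex.ofReal_mul, Complex.ofReal_div, Complex.ofReal_div]
    push_cast
    field_simp

end Probability

end QuantumIP

namespace QuantumIP

/-! ### Output probabilities as finite sums over the core qubits. -/

section Output

variable {Q : Type} [DecidableEq Q] [Fintype Q] {d N n m : ℕ}

/-- The final computation only permutes labels, so the sum over outcomes can be taken over the
labels before it. Those with nonzero amplitude are clean and determined by their core qubits. -/
theorem run_append_compile {ℒ : Layout Q d N n m} {Ou Ov : OracleSpace d ≃ₗᵢ[ℂ] OracleSpace d}
    {C : List (Gate d n m)} {A : (Q → Bool) → ℂ} (hC : run Ou Ov C (initial n m) = ℒ.lift A)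
    (e : Expr Q) (he : e.size ≤ N + 1) (S : Set ℝ) [DecidablePred (· ∈ S)] :
    (Algorithm.mk n m (C ++ CGate.gates d (ℒ.compile e 0)) (ℒ.reg 0)).outputProb Ou Ov S =
      ∑ x, if e.eval x 0 ∈ S then ‖A x‖ ^ 2 else 0 := by
  classical
  set σ := CGate.permL (ℒ.compile e 0) with hσ
  have hfin : (Algorithm.mk n m (C ++ CGate.gates d (ℒ.compile e 0)) (ℒ.reg 0)).finalState Ou Ov =
      fun b => ℒ.lift A (σ.symm b) := by
    change run Ou Ov (C ++ CGate.gates d (ℒ.compile e 0)) (initial n m) = _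
    rw [run_append, hC, CGate.run_gates]
  rw [Algorithm.outputProb, hfin]
  simp only
  rw [← σ.tsum_eq]
  simp only [Equiv.symm_apply_apply]
  set ι : (Q → Bool) → Label n m := fun x =>
    (Function.extend ℒ.core x (fun _ => false), fun _ => 0) with hι
  have hcore : ∀ x, (fun q => (ι x).1 (ℒ.core q)) = x := fun x =>
    funext fun q => ℒ.core.injective.extend_apply x (fun _ => false) q
  have hinj : Function.Injective ι := fun x y h => by rw [← hcore x, ← hcore y, h]
  have hclean : ∀ x, ℒ.Clean (ι x) := fun x => ⟨rfl, fun q hq =>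
    Function.extend_apply' x (fun _ => false) q fun ⟨a, ha⟩ => hq a ha.symm⟩
  rw [← hinj.tsum_eq, tsum_fintype]
  · refine Finset.sum_congr rfl fun x _ => ?_
    have h1 := (ℒ.compile_spec e 0 (by omega) (ι x) ((hclean x).fresh _ _)).1
    rw [← hσ, hcore] at h1
    have h2 : ((ι x).2 ℒ.ru * (ι x).2 ℒ.rv) = 0 := by simp [hι]
    rw [h2] at h1
    simp only [h1, Layout.lift, if_pos (hclean x), hcore]
  · intro b hb
    rw [Function.mem_support] at hb
    have hcl : ℒ.Clean b := by
      by_contra h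
      apply hb
      simp [Layout.lift, h]
    refine ⟨fun q => b.1 (ℒ.core q), Prod.ext (funext fun q => ?_) hcl.1.symm⟩
    by_cases hq : ∃ a, ℒ.core a = q
    · obtain ⟨a, rfl⟩ := hq
      exact ℒ.core.injective.extend_apply (fun q => b.1 (ℒ.core q)) (fun _ => false) a
    · exact (Function.extend_apply' (fun q => b.1 (ℒ.core q)) (fun _ => false) q hq).trans
        (hcl.2 q fun a h => hq ⟨a, h.symm⟩).symm

omit [DecidableEq Q] [Fintype Q] in
theorem initial_eq_lift (ℒ : Layout Q d N n m) {l : List Q} (hl : ∀ q, q ∈ l) :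
    initial n m = ℒ.lift (zeroOn l) := by
  classical
  funext b
  simp only [initial, Layout.lift, zeroOn]
  by_cases hb : b = (fun _ => false, fun _ => 0)
  · subst hb
    rw [Pi.single_eq_same, if_pos ⟨rfl, fun _ _ => rfl⟩, if_pos fun _ _ => rfl]
  · rw [Pi.single_eq_of_ne hb]
    split_ifs with h1 h2
    · refine absurd (Prod.ext (funext fun q => ?_) h1.1) hb
      by_cases hq : ∃ a, q = ℒ.core a
      · obtain ⟨a, rfl⟩ := hq
        exact h2 a (hl a)
      · exact h1.2 q fun a ha => hq ⟨a, ha⟩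
    · rfl
    · rfl

end Output

/-! ### Boosting by independent rounds, and random guessing. -/

section Majority

-- An exponential moment bound: the weight `2` for a bad and `1 / 2` for a good round has mean at
-- most `1 / 2 + 3 / 2 * (1 / 6) = 3 / 4`, while the product of the weights is at least `1` unless
-- the good rounds form a majority.
open Classical in
theorem majority_bound {Y : Type} [Fintype Y] {μ : Y → ℝ} (hμ : ∀ y, 0 ≤ μ y)
    (hsum : ∑ y, μ y = 1) {bad : Y → Prop} (hbad : ∑ y, (if bad y then μ y else 0) ≤ 1 / 6) (r : ℕ) :
    1 - (3 / 4) ^ r ≤ ∑ y : Fin r → Y, if r < 2 * (Finset.univ.filter fun ρ => ¬ bad (y ρ)).card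
      then ∏ ρ, μ (y ρ) else 0 := by
  set c : Y → ℝ := fun y => if bad y then 2 else 1 / 2 with hc
  have h1 : ∑ y : Fin r → Y, ∏ ρ, μ (y ρ) = 1 := by
    rw [← Fintype.sum_pow, hsum, one_pow]
  have h2 : ∑ y : Fin r → Y, ∏ ρ, (μ (y ρ) * c (y ρ)) ≤ (3 / 4) ^ r := by
    rw [← Fintype.sum_pow (fun y => μ y * c y)]
    refine pow_le_pow_left₀ (Finset.sum_nonneg fun y _ => mul_nonneg (hμ y) ?_) ?_ r
    · simp only [hc]; split_ifs <;> norm_num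
    · have : ∀ y, μ y * c y = 1 / 2 * μ y + 3 / 2 * (if bad y then μ y else 0) := by
        intro y
        simp only [hc]
        split_ifs <;> ring
      simp only [this, Finset.sum_add_distrib, ← Finset.mul_sum, hsum]
      linarith
  have h3 : ∀ y : Fin r → Y, ∏ ρ, μ (y ρ) ≤
      (if r < 2 * (Finset.univ.filter fun ρ => ¬ bad (y ρ)).card then ∏ ρ, μ (y ρ) else 0) +
        ∏ ρ, (μ (y ρ) * c (y ρ)) := by
    intro y
    have hp : 0 ≤ ∏ ρ, μ (y ρ) := Finset.prod_nonneg fun _ _ => hμ _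
    have hcn : ∀ ρ, 0 ≤ c (y ρ) := fun ρ => by simp only [hc]; split_ifs <;> norm_num
    split_ifs with h
    · have : 0 ≤ ∏ ρ, (μ (y ρ) * c (y ρ)) :=
        Finset.prod_nonneg fun ρ _ => mul_nonneg (hμ _) (hcn ρ)
      linarith
    · rw [zero_add, Finset.prod_mul_distrib]
      refine le_mul_of_one_le_right hp ?_
      simp only [hc]
      rw [Finset.prod_ite, Finset.prod_const, Finset.prod_const, one_div, inv_pow,
        ← div_eq_mul_inv, one_le_div (by positivity)]
      refine pow_le_pow_right₀ (by norm_num) ?_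
      have := Finset.card_filter_add_card_filter_not (s := (Finset.univ : Finset (Fin r)))
        (fun ρ => bad (y ρ))
      rw [Finset.card_univ, Fintype.card_fin] at this
      omega
  have h4 := Finset.sum_le_sum fun y (_ : y ∈ (Finset.univ : Finset (Fin r → Y))) => h3 y
  rw [h1, Finset.sum_add_distrib] at h4
  linarith

-- By `sum_chain_far` with `e = 5`, each phase is missed with probability at most `2 / 32`; the
-- union bound gives `1 / 8`.
open Classical in
theorem sum_pair_bound {t : ℕ} (a : Bool → ℝ) :
    (∑ y : Bool → Fin t → Bool, ∏ s, chain (a s) (y s) = 1) ∧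
    ∑ y : Bool → Fin t → Bool, (if ∃ s, 32 < 2 ^ t * |Real.sin (residual (a s) (y s) t)|
      then ∏ s, chain (a s) (y s) else 0) ≤ 1 / 6 := by
  have hprod : ∀ G : Bool → (Fin t → Bool) → ℝ,
      ∑ y : Bool → Fin t → Bool, ∏ s, G s (y s) = ∏ s, ∑ z, G s z := fun G => by
    rw [Finset.prod_univ_sum, Fintype.piFinset_univ]
  have h0 : ∑ y : Bool → Fin t → Bool, ∏ s, chain (a s) (y s) = 1 := by
    rw [hprod fun s => chain (a s)]
    simp [sum_chain]
  refine ⟨h0, ?_⟩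
  set far : Bool → (Fin t → Bool) → ℝ := fun s z =>
    if 2 ^ 5 < 2 ^ t * |Real.sin (residual (a s) z t)| then 1 else 0 with hfar
  have hfar_bound : ∀ s, ∑ z, chain (a s) z * far s z ≤ 1 / 16 := by
    intro s
    refine (sum_chain_far 5 (a s)).trans ?_
    have := Real.sin_sq_le_one (a s)
    norm_num
    linarith
  have h1 : ∀ y : Bool → Fin t → Bool,
      (if ∃ s, 32 < 2 ^ t * |Real.sin (residual (a s) (y s) t)|
        then ∏ s, chain (a s) (y s) else 0) ≤
      (∏ s, chain (a s) (y s) * if s then far s (y s) else 1) +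
        ∏ s, chain (a s) (y s) * if s then 1 else far s (y s) := by
    intro y
    have hn := chain_nonneg (a true) (y true)
    have hn' := chain_nonneg (a false) (y false)
    have hnn := mul_nonneg hn hn'
    simp only [Fintype.prod_bool, if_true, Bool.false_eq_true, if_false, mul_one]
    have hf : ∀ s, 0 ≤ far s (y s) := fun s => by simp only [hfar]; split_ifs <;> norm_num
    split_ifs with h
    · obtain ⟨s, hs⟩ := h
      have hs1 : far s (y s) = 1 := by
        simp only [hfar]
        rw [if_pos (by norm_num; exact hs)]
      cases s
      · rw [hs1]
        have := mul_nonneg (mul_nonneg hn (hf true)) hn'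
        linarith
      · rw [hs1]
        have := mul_nonneg hn (mul_nonneg hn' (hf false))
        linarith
    · exact add_nonneg (mul_nonneg (mul_nonneg hn (hf true)) hn')
        (mul_nonneg hn (mul_nonneg hn' (hf false)))
  refine (Finset.sum_le_sum fun y _ => h1 y).trans ?_
  rw [Finset.sum_add_distrib, hprod fun s z => chain (a s) z * if s then far s z else 1,
    hprod fun s z => chain (a s) z * if s then 1 else far s z]
  simp only [Fintype.prod_bool, if_true, Bool.false_eq_true, if_false, mul_one, sum_chain, one_mul]
  have h2 := hfar_bound true
  have h3 := hfar_bound false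
  linarith

variable {r t q b g : ℕ}

theorem sum_core {R : Type} [AddCommMonoid R] (F : (Core r t q b g → Bool) → R) :
    ∑ x, F x = ∑ m, ∑ w, ∑ γ, F (Sum.elim m (Sum.elim w γ)) := by
  let e : ((Fin r × Bool × Fin t → Bool) × (Bool × (Fin q ⊕ Fin b) → Bool) × (Fin g → Bool)) ≃
      (Core r t q b g → Bool) :=
    ((Equiv.refl _).prodCongr (Equiv.sumArrowEquivProdArrow _ _ _).symm).trans
      (Equiv.sumArrowEquivProdArrow _ _ _).symm
  rw [← e.sum_comp, Fintype.sum_prod_type]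
  refine Finset.sum_congr rfl fun m _ => ?_
  rw [Fintype.sum_prod_type]
  rfl

/-- In round `ρ`, both measured phases are close to the phases `φ`. -/
def RoundGood (φ : Bool → ℝ) (x : Core r t q b g → Bool) (ρ : Fin r) : Prop :=
  ∀ s, 2 ^ t * |Real.sin (φ s / 2 - Real.pi * bitSum (digits x ρ s) t / 2 ^ t)| ≤ 32

open Classical in
/-- More than half of the rounds are good. -/
def MostGood (φ : Bool → ℝ) (x : Core r t q b g → Bool) : Prop :=
  r < 2 * (Finset.univ.filter fun ρ => RoundGood φ x ρ).card

-- Whether most rounds are good depends on the digits alone. For such digits, some value of the `g`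
-- uniform bits makes the outcome good, which costs at most the factor `2 ^ g`.
open Classical in
theorem success_bound (φ : Bool → ℝ) {good : (Core r t q b g → Bool) → Prop}
    (h : ∀ m w, (∀ γ, MostGood φ (Sum.elim m (Sum.elim w γ) : Core r t q b g → Bool)) →
      ∃ γ, good (Sum.elim m (Sum.elim w γ))) :
    (1 - (3 / 4) ^ r) / 2 ^ g ≤
      (∑ x : Core r t q b g → Bool, if good x then digitProb φ x else 0) /
        2 ^ (2 * (q + b) + g) := by
  set a : Bool → ℝ := fun s => 2 ^ t * (φ s / 2) with ha
  set D : (Fin r × Bool × Fin t → Bool) → ℝ := fun m =>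
    ∏ ρ, ∏ s, chain (a s) (fun l => m (ρ, s, l)) with hD
  have hD0 : ∀ m, 0 ≤ D m := fun m =>
    Finset.prod_nonneg fun _ _ => Finset.prod_nonneg fun _ _ => chain_nonneg _ _
  have hres : ∀ s (y : Fin t → Bool),
      residual (a s) y t = φ s / 2 - Real.pi * bitSum y t / 2 ^ t := by
    intro s y
    rw [residual, ha]
    field_simp
  set M : (Fin r × Bool × Fin t → Bool) → Prop := fun m =>
    r < 2 * (Finset.univ.filter fun ρ => ¬ ∃ s,
      32 < 2 ^ t * |Real.sin (residual (a s) (fun l => m (ρ, s, l)) t)|).card with hM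
  have hmaj : 1 - (3 / 4) ^ r ≤ ∑ m, if M m then D m else 0 := by
    obtain ⟨h1, h2⟩ := sum_pair_bound (t := t) a
    have := majority_bound (fun y => Finset.prod_nonneg fun s _ => chain_nonneg (a s) (y s)) h1
      (bad := fun y => ∃ s, 32 < 2 ^ t * |Real.sin (residual (a s) (y s) t)|)
      (by convert h2) r
    refine this.trans (le_of_eq ?_)
    let e : (Fin r × Bool × Fin t → Bool) ≃ (Fin r → Bool → Fin t → Bool) :=
      (Equiv.curry _ _ _).trans (Equiv.piCongrRight fun _ => Equiv.curry _ _ _)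
    rw [← e.sum_comp]
    refine Finset.sum_congr rfl fun m _ => if_congr (Iff.of_eq ?_) rfl rfl
    simp only [hM]
    congr!
  have hDP : ∀ m w γ, digitProb φ (Sum.elim m (Sum.elim w γ) : Core r t q b g → Bool) = D m :=
    fun m w γ => rfl
  have hMG : ∀ m w γ, M m → MostGood φ (Sum.elim m (Sum.elim w γ) : Core r t q b g → Bool) := by
    intro m w γ hm
    have : (Finset.univ.filter fun ρ => RoundGood φ (Sum.elim m (Sum.elim w γ) :
        Core r t q b g → Bool) ρ) = Finset.univ.filter fun ρ => ¬ ∃ s,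
        32 < 2 ^ t * |Real.sin (residual (a s) (fun l => m (ρ, s, l)) t)| := by
      refine Finset.filter_congr fun ρ _ => ?_
      simp only [RoundGood, not_exists, not_lt, hres]
      rfl
    rw [MostGood, this]
    exact hm
  have hlow : ∀ m w, (if M m then D m else 0) ≤
      ∑ γ, if good (Sum.elim m (Sum.elim w γ)) then D m else 0 := by
    intro m w
    split_ifs with hm
    · obtain ⟨γ, hγ⟩ := h m w fun γ => hMG m w γ hm
      refine le_trans (le_of_eq (if_pos hγ).symm) (Finset.single_le_sum
        (f := fun γ => if good (Sum.elim m (Sum.elim w γ)) then D m else 0) (fun γ _ => ?_)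
        (Finset.mem_univ γ))
      split_ifs
      exacts [hD0 m, le_rfl]
    · exact Finset.sum_nonneg fun γ _ => by
        split_ifs
        exacts [hD0 m, le_rfl]
  rw [sum_core, pow_add, ← div_div, div_le_div_iff_of_pos_right (by positivity),
    le_div_iff₀ (by positivity)]
  simp only [hDP]
  have h3 : ∑ m, ∑ _w : Bool × (Fin q ⊕ Fin b) → Bool, (if M m then D m else 0) ≤
      ∑ m, ∑ w, ∑ γ, if good (Sum.elim m (Sum.elim w γ)) then D m else 0 :=
    Finset.sum_le_sum fun m _ => Finset.sum_le_sum fun w _ => hlow m w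
  refine le_trans ?_ h3
  simp only [Finset.sum_const, Finset.card_univ, Fintype.card_fun, Fintype.card_bool,
    Fintype.card_prod, Fintype.card_sum, Fintype.card_fin, nsmul_eq_mul, ← Finset.mul_sum]
  rw [mul_comm]
  push_cast
  exact mul_le_mul_of_nonneg_left hmaj (by positivity)

end Majority

end QuantumIP

namespace QuantumIP

/-! ### Binary digits and rounding to a grid. -/

section Binary

/-- Binary digits. -/
noncomputable def binary (t : ℕ) : Fin (2 ^ t) ≃ (Fin t → Bool) :=
  Equiv.ofBijective (fun n i => (n : ℕ).testBit i) <| by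
    rw [Fintype.bijective_iff_injective_and_card]
    refine ⟨fun i j h => Fin.ext (Nat.eq_of_testBit_eq fun k => ?_), by simp⟩
    by_cases hk : k < t
    · exact congrFun h ⟨k, hk⟩
    · have h2 : 2 ^ t ≤ 2 ^ k := Nat.pow_le_pow_right (by norm_num) (not_lt.mp hk)
      rw [Nat.testBit_lt_two_pow (i.2.trans_le h2), Nat.testBit_lt_two_pow (j.2.trans_le h2)]

theorem bitSum_testBit (t n : ℕ) (hn : n < 2 ^ t) :
    bitSum (fun i : Fin t => n.testBit i) t = n := by
  induction t generalizing n with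
  | zero =>
    obtain rfl : n = 0 := by simpa using hn
    simp [bitSum]
  | succ t ih =>
    have h1 : (fun i : Fin (t + 1) => n.testBit i) =
        Fin.cons (n.testBit 0) fun i : Fin t => (n / 2).testBit i := by
      funext i
      refine Fin.cases ?_ (fun i => ?_) i
      · simp
      · rw [Fin.cons_succ, Fin.val_succ, Nat.testBit_succ]
    rw [h1, bitSum_cons, ih (n / 2) (by rw [pow_succ] at hn; omega), Nat.testBit_zero]
    have h2 := Nat.mod_add_div n 2
    have h3 : ((n % 2 : ℕ) : ℝ) + 2 * ((n / 2 : ℕ) : ℝ) = n := by exact_mod_cast h2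
    rcases Nat.mod_two_eq_zero_or_one n with h | h <;> simp [h] at h3 ⊢ <;> exact h3

theorem bitSum_binary (t : ℕ) (n : Fin (2 ^ t)) : bitSum (binary t n) t = (n : ℕ) :=
  bitSum_testBit t n n.2

theorem angleSum_digits {Q : Type} (t : ℕ) (p : Fin t → Q) (c : ℝ) (x : Q → Bool) :
    angleSum ((List.finRange t).map fun i => (p i, 2 ^ (i : ℕ) * c)) x =
      bitSum (fun i => x (p i)) t * c := by
  simp only [angleSum, List.map_map, Function.comp_def]
  rw [← List.ofFn_eq_map, List.sum_ofFn, bitSum, Finset.sum_mul]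
  refine Finset.sum_congr rfl fun k _ => ?_
  by_cases h2 : x (p k) = true <;> simp [h2]

/-- The condition is `(k + 1) * h ≤ P`, whose shift by one cell makes the count an exact floor. It
is zero for negative `P`, as is the natural floor. -/
theorem card_grid_points {h P : ℝ} (hh : 0 < h) (n : ℕ) (hP : P ≤ n * h) :
    ((Finset.univ.filter fun k : Fin n => (k : ℕ) * h + h ≤ P).card : ℝ) = ⌊P / h⌋₊ := by
  have h1 : ⌊P / h⌋₊ ≤ n := by
    apply Nat.floor_le_of_le
    rw [div_le_iff₀ hh]
    exact hP
  have h2 : (Finset.univ.filter fun k : Fin n => ((k : ℕ) : ℝ) * h + h ≤ P) =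
      Finset.univ.filter fun k : Fin n => (k : ℕ) < ⌊P / h⌋₊ := by
    refine Finset.filter_congr fun k _ => ?_
    rw [← Nat.succ_le_iff, Nat.le_floor_iff' (by simp), le_div_iff₀ hh]
    push_cast
    rw [add_mul, one_mul]
  have h3 : (Finset.univ.filter fun k : Fin n => (k : ℕ) < ⌊P / h⌋₊).card = ⌊P / h⌋₊ := by
    rw [Fin.card_filter_val_lt]
    exact min_eq_right h1
  rw [h2, h3]

theorem floor_div_mul_le {h : ℝ} (hh : 0 < h) (P : ℝ) : (⌊P / h⌋₊ : ℝ) * h ≤ |P| := by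
  rcases le_or_gt 0 P with hP | hP
  · rw [abs_of_nonneg hP, ← le_div_iff₀ hh]
    exact Nat.floor_le (div_nonneg hP hh.le)
  · rw [Nat.floor_of_nonpos (div_nonpos_of_nonpos_of_nonneg hP.le hh.le)]
    simp

/-- One of the two floors is always zero, so the difference is `P / h` rounded towards zero. -/
theorem abs_floor_sub_floor_le {h : ℝ} (hh : 0 < h) (P : ℝ) :
    |((⌊P / h⌋₊ : ℝ) - (⌊-P / h⌋₊ : ℝ)) * h - P| ≤ h := by
  have key : ∀ P : ℝ, 0 ≤ P → |((⌊P / h⌋₊ : ℝ) - (⌊-P / h⌋₊ : ℝ)) * h - P| ≤ h := by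
    intro P hP
    have h1 : ⌊-P / h⌋₊ = 0 :=
      Nat.floor_of_nonpos (div_nonpos_of_nonpos_of_nonneg (by linarith) hh.le)
    have h2 := Nat.floor_le (div_nonneg hP hh.le)
    have h3 := (Nat.lt_floor_add_one (P / h)).le
    rw [le_div_iff₀ hh] at h2
    rw [div_le_iff₀ hh] at h3
    rw [h1, Nat.cast_zero, sub_zero, abs_le]
    constructor <;> linarith
  rcases le_total 0 P with hP | hP
  · exact key P hP
  · have := key (-P) (by linarith)
    rw [neg_neg, ← abs_neg] at this
    convert this using 2
    ring

end Binary

/-! ### Marked points and the inner product. -/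

section Density

variable {r t b g d : ℕ}

/-- The index is less than `d`. -/
noncomputable def validExpr (r t b g d : ℕ) (s : Bool) : Expr (Core r t (indexBits d) b g) :=
  .le (.weightedSum ((List.finRange (indexBits d)).map fun i =>
    (searchQubit s (Sum.inl i), 2 ^ (i : ℕ) * 1))) (.const (d - 1))

/-- The point of the grid of width `h` is below the product of the oracle answers, with the
sign `s`. -/
noncomputable def belowExpr (r t b g d : ℕ) (h : ℝ) (s : Bool) :
    Expr (Core r t (indexBits d) b g) :=
  .le (.bin .add (.weightedSum ((List.finRange b).map fun i =>
    (searchQubit s (Sum.inr i), 2 ^ (i : ℕ) * h))) (.const h))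
    (.bin .mul (.const (if s then 1 else -1)) .prod)

theorem size_validExpr (s : Bool) : (validExpr r t b g d s).size = 4 * indexBits d + 3 := by
  simp [validExpr, Expr.size, Expr.size_weightedSum]

theorem size_belowExpr (h : ℝ) (s : Bool) : (belowExpr r t b g d h s).size = 4 * b + 7 := by
  simp [belowExpr, Expr.size, Expr.size_weightedSum]

theorem test_validExpr (s : Bool) (x : Core r t (indexBits d) b g → Bool) (p : ℝ) :
    (validExpr r t b g d s).test x p = true ↔
      ∃ j : Fin d, encode j = fun i => x (searchQubit s (Sum.inl i)) := by
  have hd : d ≤ 2 ^ indexBits d := Nat.le_pow_clog (by norm_num) d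
  simp only [validExpr, Expr.test, Expr.eval_weightedSum, Expr.eval, decide_eq_true_eq,
    angleSum_digits]
  obtain ⟨n, hn⟩ := (binary (indexBits d)).surjective fun i => x (searchQubit s (Sum.inl i))
  rw [← hn, bitSum_binary, mul_one]
  constructor
  · intro h
    have h2 : ((n : ℕ) : ℝ) + 1 ≤ d := by linarith
    have h3 : (n : ℕ) < d := by exact_mod_cast h2
    exact ⟨⟨n, h3⟩, rfl⟩
  · rintro ⟨j, hj⟩
    have h2 : binary (indexBits d) ⟨j, j.2.trans_le hd⟩ = binary (indexBits d) n := hj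
    have h3 := congrArg Fin.val ((binary (indexBits d)).injective h2)
    simp only at h3
    have h4 : (n : ℕ) + 1 ≤ d := by rw [← h3]; exact j.2
    have h5 : ((n : ℕ) : ℝ) + 1 ≤ d := by exact_mod_cast h4
    linarith

theorem test_belowExpr (h : ℝ) (s : Bool) (x : Core r t (indexBits d) b g → Bool) (p : ℝ) :
    (belowExpr r t b g d h s).test x p = true ↔
      bitSum (fun i => x (searchQubit s (Sum.inr i))) b * h + h ≤ (if s then 1 else -1) * p := by
  simp only [belowExpr, Expr.test, Expr.eval_weightedSum, Expr.eval, decide_eq_true_eq,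
    angleSum_digits, Arith.fn]

/-- The marking function for the search register `s`. -/
noncomputable def markedPoint (r t b g : ℕ) (u v : Fin d → ℝ) (h : ℝ) (s : Bool) :
    (Core r t (indexBits d) b g → Bool) → Bool :=
  Layout.marked u v (validExpr r t b g d s) (belowExpr r t b g d h s)
    fun i => searchQubit s (Sum.inl i)

theorem markedPoint_iff (u v : Fin d → ℝ) (h : ℝ) (s : Bool)
    (x : Core r t (indexBits d) b g → Bool) :
    markedPoint r t b g u v h s x = true ↔
      ∃ j : Fin d, (encode j = fun i => x (searchQubit s (Sum.inl i))) ∧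
        bitSum (fun i => x (searchQubit s (Sum.inr i))) b * h + h ≤
          (if s then 1 else -1) * (u j * v j) := by
  simp only [markedPoint, Layout.marked, Bool.and_eq_true, test_validExpr, test_belowExpr]
  constructor
  · rintro ⟨⟨j, hj⟩, h2⟩
    refine ⟨j, hj, ?_⟩
    rwa [← hj, pad_encode, pad_encode] at h2
  · rintro ⟨j, hj, h2⟩
    refine ⟨⟨j, hj⟩, ?_⟩
    rwa [← hj, pad_encode, pad_encode]

theorem indep_markedPoint (u v : Fin d → ℝ) (h : ℝ) (s : Bool)
    (a : Core r t (indexBits d) b g) (ha : a ∉ searchList s) :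
    Indep a (markedPoint r t b g u v h s) := by
  intro x y
  have h1 : ∀ i, Function.update x a y (searchQubit s i) = x (searchQubit s i) := fun i =>
    Function.update_of_ne (fun e => ha (mem_searchList.mpr ⟨i, e⟩)) _ _
  rw [Bool.eq_iff_iff, markedPoint_iff, markedPoint_iff]
  simp only [h1]

/-- A density does not see the qubits on which the function does not depend. -/
theorem density_search (s : Bool) (F : (Core r t (indexBits d) b g → Bool) → Bool)
    (G : (Fin (indexBits d) → Bool) → (Fin b → Bool) → Bool)
    (hF : ∀ x, F x = G (fun i => x (searchQubit s (Sum.inl i)))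
      fun i => x (searchQubit s (Sum.inr i))) :
    density F = (∑ y, ∑ z, if G y z then 1 else 0) / (2 ^ indexBits d * 2 ^ b) := by
  have h1 : ∑ w : Bool × (Fin (indexBits d) ⊕ Fin b) → Bool,
      (if G (fun i => w (s, Sum.inl i)) (fun i => w (s, Sum.inr i)) then (1 : ℝ) else 0) =
      (2 ^ indexBits d * 2 ^ b) * ∑ y, ∑ z, if G y z then 1 else 0 := by
    let e : (Bool × (Fin (indexBits d) ⊕ Fin b) → Bool) ≃
        ((Fin (indexBits d) → Bool) × (Fin b → Bool)) ×
          ((Fin (indexBits d) → Bool) × (Fin b → Bool)) :=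
      (Equiv.curry _ _ _).trans ((Equiv.boolArrowEquivProd _).trans
        ((Equiv.sumArrowEquivProdArrow _ _ _).prodCongr (Equiv.sumArrowEquivProdArrow _ _ _)))
    obtain ⟨H, hH⟩ : ∃ H : (Fin (indexBits d) → Bool) → (Fin b → Bool) → ℝ,
        H = fun y z => if G y z then 1 else 0 := ⟨_, rfl⟩
    have hH' : (∑ y, ∑ z, if G y z then (1 : ℝ) else 0) = ∑ y, ∑ z, H y z := by rw [hH]
    rw [hH']
    have hcard : (Fintype.card ((Fin (indexBits d) → Bool) × (Fin b → Bool)) : ℝ) =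
        2 ^ indexBits d * 2 ^ b := by simp
    cases s
    · refine (Fintype.sum_equiv e _ (fun p => H p.1.1 p.1.2) fun w => by rw [hH]; rfl).trans ?_
      simp only [Fintype.sum_prod_type, Finset.sum_const, Finset.card_univ, nsmul_eq_mul,
        ← Finset.mul_sum, hcard]
    · refine (Fintype.sum_equiv e _ (fun p => H p.2.1 p.2.2) fun w => by rw [hH]; rfl).trans ?_
      simp only [Fintype.sum_prod_type, Finset.sum_const, Finset.card_univ, nsmul_eq_mul,
        hcard]
  have h2 : ∀ (m : Fin r × Bool × Fin t → Bool) (w : Bool × (Fin (indexBits d) ⊕ Fin b) → Bool)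
      (γ : Fin g → Bool), F (Sum.elim m (Sum.elim w γ)) =
        G (fun i => w (s, Sum.inl i)) (fun i => w (s, Sum.inr i)) := fun m w γ => hF _
  rw [density, sum_core]
  simp only [h2, Finset.sum_const, nsmul_eq_mul, ← Finset.mul_sum, h1, Finset.card_univ]
  simp only [Fintype.card_fun, Fintype.card_bool, Fintype.card_sum, Fintype.card_prod,
    Fintype.card_fin]
  push_cast
  rw [div_eq_div_iff (by positivity) (by positivity)]
  ring

-- Each index contributes its number of grid cells below `± u j * v j`; `hb` ensures that the grid
-- is long enough. Invalid contents of the index register contribute nothing.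
open Classical in
theorem density_markedPoint (u v : Fin d → ℝ) {h : ℝ} (hh : 0 < h)
    (hb : ∀ j, |u j * v j| ≤ 2 ^ b * h) (s : Bool) :
    density (markedPoint r t b g u v h s) =
      (∑ j, (⌊(if s then 1 else -1) * (u j * v j) / h⌋₊ : ℝ)) / (2 ^ indexBits d * 2 ^ b) := by
  rw [density_search s _ (fun y z => decide (∃ j : Fin d, encode j = y ∧ bitSum z b * h + h ≤
    (if s then 1 else -1) * (u j * v j))) fun x => by
      rw [Bool.eq_iff_iff, markedPoint_iff, decide_eq_true_eq]]
  congr 1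
  have h1 : ∀ y : Fin (indexBits d) → Bool, y ∉ Set.range (encode : Fin d → _) →
      (∑ z : Fin b → Bool, if decide (∃ j : Fin d, encode j = y ∧ bitSum z b * h + h ≤
        (if s then 1 else -1) * (u j * v j)) = true then (1 : ℝ) else 0) = 0 := by
    intro y hy
    refine Finset.sum_eq_zero fun z _ => if_neg ?_
    rw [decide_eq_true_eq]
    rintro ⟨j, hj, -⟩
    exact hy ⟨j, hj⟩
  have h2 : ∀ j : Fin d, (∑ z : Fin b → Bool, if decide (∃ i : Fin d, encode i = encode j ∧
      bitSum z b * h + h ≤ (if s then 1 else -1) * (u i * v i)) = true then (1 : ℝ) else 0) =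
      ⌊(if s then 1 else -1) * (u j * v j) / h⌋₊ := by
    intro j
    rw [← card_grid_points hh (2 ^ b) (P := (if s then 1 else -1) * (u j * v j)),
      ← (binary b).sum_comp]
    · rw [Finset.card_filter]
      push_cast
      refine Finset.sum_congr rfl fun k _ => if_congr ?_ rfl rfl
      rw [decide_eq_true_eq, bitSum_binary]
      constructor
      · rintro ⟨i, hi, h3⟩
        rwa [encode_injective hi] at h3
      · exact fun h3 => ⟨j, rfl, h3⟩
    · push_cast
      refine le_trans ?_ (hb j)
      cases s
      · simpa using neg_le_abs (u j * v j)
      · simpa using le_abs_self (u j * v j)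
  rw [← Finset.sum_congr rfl fun j _ => h2 j]
  exact (Fintype.sum_of_injective encode encode_injective _ _ h1 fun j => rfl).symm

/-- Since `∑ j, |u j * v j| ≤ A * B`, at most `2 ^ b` cells are marked, as many as belong to a
single index. This bound is the source of `√d` in the query count. -/
theorem density_markedPoint_le {A B : ℝ} (hA : 0 < A) (hB : 0 < B) {u v : Fin d → ℝ}
    (hu : ‖u‖ ≤ A) (hv : l1Norm v ≤ B) (s : Bool) :
    density (markedPoint r t b g u v (A * B / 2 ^ b) s) ≤ 1 / 2 ^ indexBits d := by
  have hu' : ∀ j, |u j| ≤ A := fun j => (norm_le_pi_norm u j).trans hu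
  have hv' : ∀ j, |v j| ≤ B := fun j =>
    (Finset.single_le_sum (f := fun j => |v j|) (fun _ _ => abs_nonneg _)
      (Finset.mem_univ j)).trans hv
  have hh : 0 < A * B / 2 ^ b := by positivity
  have h2 : (0 : ℝ) < 2 ^ indexBits d := by positivity
  rw [density_markedPoint u v hh fun j => by
    rw [mul_div_cancel₀ _ (by positivity), abs_mul]
    exact mul_le_mul (hu' j) (hv' j) (abs_nonneg _) hA.le]
  rw [div_le_div_iff₀ (by positivity) h2, one_mul, mul_comm, mul_le_mul_iff_right₀ h2]
  have h3 : (∑ j, (⌊(if s then 1 else -1) * (u j * v j) / (A * B / 2 ^ b)⌋₊ : ℝ)) *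
      (A * B / 2 ^ b) ≤ A * B := by
    rw [Finset.sum_mul]
    calc _ ≤ ∑ j, A * |v j| := Finset.sum_le_sum fun j _ => by
          refine (floor_div_mul_le hh _).trans ?_
          have : |(if s then (1 : ℝ) else -1) * (u j * v j)| = |u j| * |v j| := by
            cases s <;> simp [abs_mul]
          rw [this]
          exact mul_le_mul_of_nonneg_right (hu' j) (abs_nonneg _)
      _ ≤ A * B := by
          rw [← Finset.mul_sum]
          exact mul_le_mul_of_nonneg_left hv hA.le
  rw [← le_div_iff₀ hh] at h3
  refine h3.trans (le_of_eq ?_)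
  field_simp

/-- Rounding to the grid costs at most one cell width per index. -/
theorem density_sub_density {A B : ℝ} (hA : 0 < A) (hB : 0 < B) {u v : Fin d → ℝ}
    (hu : ‖u‖ ≤ A) (hv : l1Norm v ≤ B) :
    |(density (markedPoint r t b g u v (A * B / 2 ^ b) true) -
      density (markedPoint r t b g u v (A * B / 2 ^ b) false)) * (2 ^ indexBits d * (A * B)) -
        ∑ j, u j * v j| ≤ d * (A * B / 2 ^ b) := by
  have hu' : ∀ j, |u j| ≤ A := fun j => (norm_le_pi_norm u j).trans hu
  have hv' : ∀ j, |v j| ≤ B := fun j =>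
    (Finset.single_le_sum (f := fun j => |v j|) (fun _ _ => abs_nonneg _)
      (Finset.mem_univ j)).trans hv
  have hh : 0 < A * B / 2 ^ b := by positivity
  have hb : ∀ j, |u j * v j| ≤ 2 ^ b * (A * B / 2 ^ b) := fun j => by
    rw [mul_div_cancel₀ _ (by positivity), abs_mul]
    exact mul_le_mul (hu' j) (hv' j) (abs_nonneg _) hA.le
  rw [density_markedPoint u v hh hb, density_markedPoint u v hh hb]
  set h := A * B / 2 ^ b with hh'
  have hAB : 2 ^ indexBits d * (A * B) = (2 ^ indexBits d * 2 ^ b) * h := by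
    rw [hh']; field_simp
  rw [hAB, ← sub_div, div_mul_eq_mul_div, ← mul_assoc, mul_comm _ (2 ^ indexBits d * 2 ^ b : ℝ),
    mul_assoc, mul_div_cancel_left₀ _ (by positivity), ← Finset.sum_sub_distrib, Finset.sum_mul,
    ← Finset.sum_sub_distrib]
  refine (Finset.abs_sum_le_sum_abs _ _).trans ?_
  calc _ ≤ ∑ _j : Fin d, h := Finset.sum_le_sum fun j _ => by
        have := abs_floor_sub_floor_le hh (u j * v j)
        simpa using this
    _ = d * h := by simp

end Density

end QuantumIP

namespace QuantumIP

/-! ### Expressions for sums and tables. -/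

namespace Expr

variable {Q : Type}

/-- The sum of a list of expressions. -/
noncomputable def sum : List (Expr Q) → Expr Q
  | [] => const 0
  | e :: l => bin .add e (sum l)

theorem eval_sum (l : List (Expr Q)) (x : Q → Bool) (p : ℝ) :
    (sum l).eval x p = (l.map fun e => e.eval x p).sum := by
  induction l with
  | nil => rfl
  | cons e l ih => simp only [sum, eval, Arith.fn, ih, List.map_cons, List.sum_cons]

theorem size_sum_le {l : List (Expr Q)} {k : ℕ} (h : ∀ e ∈ l, e.size ≤ k) :
    (sum l).size ≤ l.length * (k + 1) + 1 := by
  induction l with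
  | nil => simp [sum, size]
  | cons e l ih =>
    have h1 := ih fun f hf => h f (by simp [hf])
    have h2 := h e (by simp)
    simp only [sum, size, List.length_cons, add_mul]
    omega

theorem eval_sum_finRange {r : ℕ} (e : Fin r → Expr Q) (x : Q → Bool) (p : ℝ) :
    (sum ((List.finRange r).map e)).eval x p = ∑ i, (e i).eval x p := by
  rw [eval_sum, List.map_map, ← List.ofFn_eq_map, List.sum_ofFn]
  rfl

/-- The value `F n`, where `n ≤ M` is the natural number `e`. -/
noncomputable def table (F : ℕ → ℝ) (e : Expr Q) : ℕ → Expr Q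
  | 0 => const (F 0)
  | M + 1 => bin .add (table F e M) (bin .mul (const (F (M + 1) - F M)) (le (const (M + 1)) e))

/-- The increments `F (i + 1) - F i` with `i + 1 ≤ n` telescope. A table replaces functions such as
the sine, which are not elementary operations. -/
theorem eval_table (F : ℕ → ℝ) (e : Expr Q) (M : ℕ) (x : Q → Bool) (p : ℝ) {n : ℕ}
    (h : e.eval x p = n) : (table F e M).eval x p = F (min n M) := by
  induction M with
  | zero => simp [table, eval]
  | succ M ih =>
    simp only [table, eval, Arith.fn, ih, h]
    by_cases hn : M + 1 ≤ n
    · have h2 : (M : ℝ) + 1 ≤ n := by exact_mod_cast hn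
      rw [if_pos h2, min_eq_right hn, min_eq_right (by omega)]
      ring
    · have h2 : ¬ (M : ℝ) + 1 ≤ n := by exact_mod_cast hn
      rw [if_neg h2, min_eq_left (by omega), min_eq_left (by omega)]
      ring

theorem size_table (F : ℕ → ℝ) (e : Expr Q) (M : ℕ) :
    (table F e M).size = M * (e.size + 5) + 1 := by
  induction M with
  | zero => simp [table, size]
  | succ M ih =>
    simp only [table, size, ih]
    ring

end Expr

/-! ### A substitute for the median. -/

section Median

/-- The number of points at distance at most `ω`. -/
noncomputable def closeCount {r : ℕ} (z : Fin r → ℝ) (ω : ℝ) (i : Fin r) : ℝ :=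
  ∑ j, (if z i ≤ z j + ω then 1 else 0) * if z j ≤ z i + ω then 1 else 0

/-- The mean of the points with many points nearby. -/
noncomputable def clusterMean {r : ℕ} (z : Fin r → ℝ) (ω : ℝ) : ℝ :=
  (∑ i, z i * if (r + 1 : ℝ) / 2 ≤ closeCount z ω i then 1 else 0) /
    ∑ i, if (r + 1 : ℝ) / 2 ≤ closeCount z ω i then 1 else 0

open Classical in
theorem closeCount_eq {r : ℕ} (z : Fin r → ℝ) (ω : ℝ) (i : Fin r) :
    closeCount z ω i = (Finset.univ.filter fun j => |z i - z j| ≤ ω).card := by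
  rw [closeCount, Finset.card_filter]
  push_cast
  refine Finset.sum_congr rfl fun j _ => ?_
  by_cases h : |z i - z j| ≤ ω
  · rw [if_pos h]
    rw [abs_le] at h
    rw [if_pos (by linarith), if_pos (by linarith), mul_one]
  · rw [if_neg h]
    by_cases h1 : z i ≤ z j + ω
    · have h2 : ¬ z j ≤ z i + ω := fun h2 => h (abs_le.mpr ⟨by linarith, by linarith⟩)
      rw [if_neg h2, mul_zero]
    · rw [if_neg h1, zero_mul]

-- A good point has all good points within `2 * κ`, hence is selected. A selected point has a
-- majority of the points within `2 * κ`, and two majorities intersect, so it is within `3 * κ` of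
-- `a`. Averaging the selected points needs neither sorting nor a choice among them.
open Classical in
theorem abs_clusterMean_sub_le {r : ℕ} {z : Fin r → ℝ} {a κ : ℝ} {s : Finset (Fin r)}
    (hs : ∀ i ∈ s, |z i - a| ≤ κ) (hr : r < 2 * s.card) :
    |clusterMean z (2 * κ) - a| ≤ 3 * κ := by
  set V := Finset.univ.filter fun i => (r + 1 : ℝ) / 2 ≤ closeCount z (2 * κ) i with hV
  have hr' : (r : ℝ) + 1 ≤ 2 * s.card := by exact_mod_cast hr
  have hsV : s ⊆ V := by
    intro i hi
    rw [hV, Finset.mem_filter, closeCount_eq]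
    refine ⟨Finset.mem_univ _, ?_⟩
    have : s ⊆ Finset.univ.filter fun j => |z i - z j| ≤ 2 * κ := fun j hj => by
      rw [Finset.mem_filter]
      refine ⟨Finset.mem_univ _, ?_⟩
      have h1 := abs_le.mp (hs i hi)
      have h2 := abs_le.mp (hs j hj)
      exact abs_le.mpr ⟨by linarith, by linarith⟩
    have h2 : (s.card : ℝ) ≤ _ := Nat.cast_le.mpr (Finset.card_le_card this)
    linarith
  have hVpos : 0 < V.card := by
    have := Finset.card_le_card hsV
    omega
  have hVa : ∀ i ∈ V, |z i - a| ≤ 3 * κ := by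
    intro i hi
    rw [hV, Finset.mem_filter, closeCount_eq] at hi
    set W := Finset.univ.filter fun j => |z i - z j| ≤ 2 * κ with hW
    have h1 : r + 1 ≤ 2 * W.card := by
      have : (r : ℝ) + 1 ≤ 2 * W.card := by linarith [hi.2]
      exact_mod_cast this
    have h2 : ¬ Disjoint W s := fun h => by
      have h3 := Finset.card_le_univ (W ∪ s)
      rw [Finset.card_union_of_disjoint h, Fintype.card_fin] at h3
      omega
    obtain ⟨j, hj, hj'⟩ := Finset.not_disjoint_iff.mp h2
    have h4 := abs_le.mp (Finset.mem_filter.mp hj).2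
    have h5 := abs_le.mp (hs j hj')
    exact abs_le.mpr ⟨by linarith, by linarith⟩
  have hVpos' : (0 : ℝ) < V.card := by exact_mod_cast hVpos
  have h1 : clusterMean z (2 * κ) = (∑ i ∈ V, z i) / V.card := by
    rw [clusterMean, hV, Finset.sum_filter, Finset.card_filter]
    push_cast
    congr 1
    exact Finset.sum_congr rfl fun i _ => by split_ifs <;> simp
  have h2 : (∑ i ∈ V, z i) / V.card - a = (∑ i ∈ V, (z i - a)) / V.card := by
    rw [Finset.sum_sub_distrib, Finset.sum_const, nsmul_eq_mul]
    field_simp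
  rw [h1, h2, abs_div, abs_of_pos hVpos', div_le_iff₀ hVpos']
  refine (Finset.abs_sum_le_sum_abs _ _).trans ((Finset.sum_le_sum hVa).trans ?_)
  rw [Finset.sum_const, nsmul_eq_mul, mul_comm]

end Median

/-! ### The final estimate and its accuracy. -/

section Estimate

/-- The difference of squares is `sin (a - b) * sin (a + b)`, with `a + b = 2 * b - (b - a)`. The
bound is linear in the phase error only with the small factor `|sin b|`. -/
theorem abs_sin_sq_sub_sin_sq_le (a b : ℝ) :
    |Real.sin a ^ 2 - Real.sin b ^ 2| ≤
      |Real.sin (b - a)| * (|Real.sin (b - a)| + 2 * |Real.sin b|) := by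
  have h1 : Real.sin a ^ 2 - Real.sin b ^ 2 = -(Real.sin (b - a) * Real.sin (2 * b - (b - a))) := by
    have h2 : 2 * b - (b - a) = b + a := by ring
    rw [h2, Real.sin_sub, Real.sin_add]
    have ha := Real.sin_sq_add_cos_sq a
    have hb := Real.sin_sq_add_cos_sq b
    have ha' : Real.cos a ^ 2 = 1 - Real.sin a ^ 2 := by linarith
    have hb' : Real.cos b ^ 2 = 1 - Real.sin b ^ 2 := by linarith
    ring_nf
    rw [ha', hb']
    ring
  rw [h1, abs_neg, abs_mul]
  refine mul_le_mul_of_nonneg_left ?_ (abs_nonneg _)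
  rw [Real.sin_sub, Real.sin_two_mul]
  refine (abs_sub _ _).trans ?_
  rw [abs_mul, abs_mul, abs_mul, abs_mul, abs_two, add_comm]
  refine add_le_add ?_ ?_
  · exact mul_le_of_le_one_left (abs_nonneg _) (Real.abs_cos_le_one _)
  · have h3 := Real.abs_cos_le_one b
    have h4 := Real.abs_cos_le_one (b - a)
    have h5 : 2 * |Real.sin b| * |Real.cos b| ≤ 2 * |Real.sin b| :=
      mul_le_of_le_one_right (by positivity) h3
    exact (mul_le_of_le_one_right (by positivity) h4).trans h5

variable {r t q b g : ℕ}

/-- The estimate of the density from the digits of the phase `s` of round `ρ`. -/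
noncomputable def densityEstimate (x : Core r t q b g → Bool) (ρ : Fin r) (s : Bool) : ℝ :=
  Real.sin (Real.pi * bitSum (digits x ρ s) t / 2 ^ t) ^ 2

/-- The squared sine is the same for both eigenphases, so it does not matter which eigenvector was
met. -/
theorem abs_densityEstimate_sub_le {f : Bool → (Core r t q b g → Bool) → Bool} {D : ℝ}
    (hf : ∀ s, density (f s) ≤ 1 / D) {σ : Bool → Bool}
    {x : Core r t q b g → Bool} {ρ : Fin r}
    (h : RoundGood (fun s => groverPhase (f s) (σ s)) x ρ) (s : Bool) :
    |densityEstimate x ρ s - density (f s)| ≤ 32 / 2 ^ t * (32 / 2 ^ t + 2 / Real.sqrt D) := by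
  have hM : (0 : ℝ) < 2 ^ t := by positivity
  have h1 : |Real.sin (groverPhase (f s) (σ s) / 2)| = Real.sqrt (density (f s)) := by
    rw [groverPhase]
    split_ifs
    · rw [mul_div_cancel_left₀ _ two_ne_zero, sin_groverAngle, abs_of_nonneg (Real.sqrt_nonneg _)]
    · rw [neg_div, mul_div_cancel_left₀ _ two_ne_zero, Real.sin_neg, abs_neg, sin_groverAngle,
        abs_of_nonneg (Real.sqrt_nonneg _)]
  have h2 : density (f s) = Real.sin (groverPhase (f s) (σ s) / 2) ^ 2 := by
    rw [← sq_abs, h1, Real.sq_sqrt (density_nonneg _)]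
  have h3 := h s
  rw [mul_comm, ← le_div_iff₀ hM] at h3
  have h4 : |Real.sin (groverPhase (f s) (σ s) / 2)| ≤ 1 / Real.sqrt D := by
    rw [h1, one_div, ← Real.sqrt_inv, ← one_div]
    exact Real.sqrt_le_sqrt (hf s)
  rw [h2, densityEstimate]
  refine (abs_sin_sq_sub_sin_sq_le _ _).trans ?_
  have h5 : 2 / Real.sqrt D = 2 * (1 / Real.sqrt D) := by ring
  rw [h5]
  refine mul_le_mul h3 (by linarith) (by positivity) (by positivity)

/-- The estimate of the difference of the two densities in round `ρ`. -/
noncomputable def differenceExpr (q b g : ℕ) (ρ : Fin r) : Expr (Core r t q b g) :=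
  let e : Bool → Expr (Core r t q b g) := fun s =>
    .table (fun n => Real.sin (Real.pi * n / 2 ^ t) ^ 2)
      (.weightedSum ((List.finRange t).map fun i => (digit (ρ, s, i), 2 ^ (i : ℕ) * 1))) (2 ^ t)
  .bin .sub (e true) (e false)

theorem eval_differenceExpr (ρ : Fin r) (x : Core r t q b g → Bool) (p : ℝ) :
    (differenceExpr q b g ρ).eval x p = densityEstimate x ρ true - densityEstimate x ρ false := by
  have h : ∀ s, (Expr.table (fun n => Real.sin (Real.pi * n / 2 ^ t) ^ 2)
      (.weightedSum ((List.finRange t).map fun i => (digit (ρ, s, i), (2 : ℝ) ^ (i : ℕ) * 1)))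
        (2 ^ t)).eval x p = densityEstimate x ρ s := by
    intro s
    obtain ⟨n, hn⟩ := (binary t).surjective (digits x ρ s)
    have h1 : bitSum (digits x ρ s) t = (n : ℕ) := by rw [← hn, bitSum_binary]
    rw [Expr.eval_table _ _ _ _ _ (n := n), min_eq_left n.2.le, densityEstimate, h1]
    rw [Expr.eval_weightedSum, angleSum_digits, mul_one]
    exact h1
  simp only [differenceExpr, Expr.eval, Arith.fn, h]

theorem size_differenceExpr (ρ : Fin r) :
    (differenceExpr (t := t) q b g ρ).size = 2 * (2 ^ t * (4 * t + 6)) + 3 := by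
  simp only [differenceExpr, Expr.size, Expr.size_table, Expr.size_weightedSum, List.length_map,
    List.length_finRange]
  ring

/-- A multiple of the value given by the random bits. -/
noncomputable def offsetExpr (r t q b g : ℕ) (ε : ℝ) : Expr (Core r t q b g) :=
  .bin .add (.weightedSum ((List.finRange g).map fun i => (guessQubit i, 2 ^ (i : ℕ) * (2 * ε))))
    (.const (ε * (1 - 2 ^ g)))

theorem eval_offsetExpr (ε : ℝ) (x : Core r t q b g → Bool) (p : ℝ) :
    (offsetExpr r t q b g ε).eval x p =
      ε * (2 * bitSum (fun i => x (guessQubit i)) g + 1 - 2 ^ g) := by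
  simp only [offsetExpr, Expr.eval, Arith.fn, Expr.eval_weightedSum, angleSum_digits]
  ring

theorem size_offsetExpr (ε : ℝ) : (offsetExpr r t q b g ε).size = 4 * g + 3 := by
  simp [offsetExpr, Expr.size, Expr.size_weightedSum]

/-- The estimate of the inner product. -/
noncomputable def estimateExpr (r t q b g : ℕ) (ω c ε : ℝ) : Expr (Core r t q b g) :=
  let z : Fin r → Expr (Core r t q b g) := differenceExpr q b g
  let near : Fin r → Fin r → Expr (Core r t q b g) := fun i j =>
    .bin .mul (.le (z i) (.bin .add (z j) (.const ω))) (.le (z j) (.bin .add (z i) (.const ω)))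
  let v : Fin r → Expr (Core r t q b g) := fun i =>
    .le (.const ((r + 1) / 2)) (.sum ((List.finRange r).map (near i)))
  .bin .add (.bin .mul (.const c)
    (.bin .div (.sum ((List.finRange r).map fun i => .bin .mul (z i) (v i)))
      (.sum ((List.finRange r).map v)))) (offsetExpr r t q b g ε)

theorem eval_estimateExpr (ω c ε : ℝ) (x : Core r t q b g → Bool) (p : ℝ) :
    (estimateExpr r t q b g ω c ε).eval x p =
      c * clusterMean (fun ρ => densityEstimate x ρ true - densityEstimate x ρ false) ω +
        ε * (2 * bitSum (fun i => x (guessQubit i)) g + 1 - 2 ^ g) := by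
  simp only [estimateExpr, Expr.eval, Arith.fn, Expr.eval_sum_finRange, eval_differenceExpr,
    eval_offsetExpr, clusterMean, closeCount]

/-- Each pair of rounds is compared with freshly computed values, which gives `r ^ 2`; each value
uses tables with `2 ^ t` steps on `t` digits. -/
theorem size_estimateExpr_le (ω c ε : ℝ) :
    (estimateExpr r t q b g ω c ε).size ≤
      400 * ((r + 1) ^ 2 * (2 ^ t * (t + 1))) + 4 * g := by
  obtain ⟨Z, hZ⟩ : ∃ Z, Z = 2 * (2 ^ t * (4 * t + 6)) + 3 := ⟨_, rfl⟩
  have hz : ∀ ρ : Fin r, (differenceExpr (t := t) q b g ρ).size = Z := fun ρ => by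
    rw [size_differenceExpr, hZ]
  have hZ' : Z ≤ 15 * (2 ^ t * (t + 1)) := by
    have : 1 ≤ 2 ^ t := Nat.one_le_two_pow
    rw [hZ]
    nlinarith [Nat.zero_le (2 ^ t * t)]
  have hX : 1 ≤ 2 ^ t * (t + 1) := Nat.mul_pos (by positivity) (by omega)
  set X := 2 ^ t * (t + 1)
  have hv : ∀ i : Fin r, (Expr.le (.const ((r + 1) / 2)) (.sum ((List.finRange r).map fun j =>
      Expr.bin .mul
        (.le (differenceExpr q b g i) (.bin .add (differenceExpr q b g j) (.const ω)))
        (.le (differenceExpr q b g j) (.bin .add (differenceExpr q b g i) (.const ω))))) :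
      Expr (Core r t q b g)).size ≤ r * (4 * Z + 8) + 3 := by
    intro i
    have := Expr.size_sum_le (k := 4 * Z + 7) (l := (List.finRange r).map fun j =>
      (Expr.bin .mul
        (.le (differenceExpr q b g i) (.bin .add (differenceExpr q b g j) (.const ω)))
        (.le (differenceExpr q b g j) (.bin .add (differenceExpr q b g i) (.const ω))) :
      Expr (Core r t q b g))) (by
        intro e he
        obtain ⟨j, -, rfl⟩ := List.mem_map.mp he
        simp only [Expr.size, hz]
        omega)
    simp only [List.length_map, List.length_finRange] at this
    have h1 : 4 * Z + 7 + 1 = 4 * Z + 8 := rfl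
    rw [h1] at this
    simp only [Expr.size]
    omega
  have h1 := Expr.size_sum_le (k := Z + (r * (4 * Z + 8) + 3) + 1)
    (l := (List.finRange r).map fun i => (Expr.bin .mul (differenceExpr q b g i)
      (Expr.le (.const ((r + 1) / 2)) (.sum ((List.finRange r).map fun j =>
      Expr.bin .mul
        (.le (differenceExpr q b g i) (.bin .add (differenceExpr q b g j) (.const ω)))
        (.le (differenceExpr q b g j) (.bin .add (differenceExpr q b g i) (.const ω)))))) :
      Expr (Core r t q b g))) (by
        intro e he
        obtain ⟨i, -, rfl⟩ := List.mem_map.mp he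
        have := hv i
        rw [Expr.size, hz]
        omega)
  have h2 := Expr.size_sum_le (k := r * (4 * Z + 8) + 3)
    (l := (List.finRange r).map fun i =>
      (Expr.le (.const ((r + 1) / 2)) (.sum ((List.finRange r).map fun j =>
      Expr.bin .mul
        (.le (differenceExpr q b g i) (.bin .add (differenceExpr q b g j) (.const ω)))
        (.le (differenceExpr q b g j) (.bin .add (differenceExpr q b g i) (.const ω))))) :
      Expr (Core r t q b g))) (by
        intro e he
        obtain ⟨i, -, rfl⟩ := List.mem_map.mp he
        exact hv i)
  simp only [List.length_map, List.length_finRange] at h1 h2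
  rw [estimateExpr, Expr.size, Expr.size, Expr.size, Expr.size, size_offsetExpr]
  refine (by gcongr : _ ≤ 1 + (r * (Z + (r * (4 * Z + 8) + 3) + 1 + 1) + 1 +
    (r * (r * (4 * Z + 8) + 3 + 1) + 1) + 1) + 1 + (4 * g + 3) + 1).trans ?_
  calc _ ≤ r * (15 * X + (r * (4 * (15 * X) + 8) + 3) + 1 + 1) +
        (r * (r * (4 * (15 * X) + 8) + 3 + 1)) + 9 + 4 * g := by
        have : ∀ a c : ℕ, 1 + (a + 1 + (c + 1) + 1) + 1 + (4 * g + 3) + 1 = a + c + 9 + 4 * g := by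
          intro a c; ring
        rw [this]
        gcongr
    _ ≤ r * (15 * X + (r * (4 * (15 * X) + 8 * X) + 3 * X) + 1 * X + 1 * X) +
        (r * (r * (4 * (15 * X) + 8 * X) + 3 * X + 1 * X)) + 9 * X + 4 * g := by
        gcongr <;> exact Nat.le_mul_of_pos_right _ hX
    _ = (136 * r ^ 2 + 24 * r + 9) * X + 4 * g := by ring
    _ ≤ (400 * (r + 1) ^ 2) * X + 4 * g := by
        gcongr
        nlinarith
    _ = _ := by ring

/-- The offsets are the odd multiples of `ε` between `-2 ^ g * ε` and `2 ^ g * ε`, and every point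
of this interval is within `ε` of one of them. -/
theorem exists_guess {s a ε : ℝ} (hε : 0 < ε) (h : |a - s| ≤ 2 ^ g * ε) :
    ∃ γ : Fin g → Bool, |a + ε * (2 * bitSum γ g + 1 - 2 ^ g) - s| ≤ ε := by
  obtain ⟨y, hy⟩ : ∃ y, y = (s - a) / ε + 2 ^ g := ⟨_, rfl⟩
  have hs : s = a + ε * (y - 2 ^ g) := by rw [hy]; field_simp; ring
  have hy1 : |y - 2 ^ g| ≤ 2 ^ g := by
    have h1 : a - s = -(ε * (y - 2 ^ g)) := by rw [hs]; ring
    rw [h1, abs_neg, abs_mul, abs_of_pos hε, mul_comm] at h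
    exact le_of_mul_le_mul_right h hε
  rw [abs_le] at hy1
  have hy2 : 0 ≤ y / 2 := by linarith [hy1.1]
  have key : ∀ n : Fin (2 ^ g), |2 * ((n : ℕ) : ℝ) + 1 - y| ≤ 1 →
      ∃ γ : Fin g → Bool, |a + ε * (2 * bitSum γ g + 1 - 2 ^ g) - s| ≤ ε := by
    intro n hn
    refine ⟨binary g n, ?_⟩
    have h1 : a + ε * (2 * bitSum (binary g n) g + 1 - 2 ^ g) - s =
        ε * (2 * ((n : ℕ) : ℝ) + 1 - y) := by
      rw [bitSum_binary, hs]; ring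
    rw [h1, abs_mul, abs_of_pos hε]
    exact mul_le_of_le_one_right hε.le hn
  have h1 := Nat.floor_le hy2
  have h2 := Nat.lt_floor_add_one (y / 2)
  by_cases hlt : ⌊y / 2⌋₊ < 2 ^ g
  · refine key ⟨_, hlt⟩ (abs_le.mpr ⟨?_, ?_⟩) <;> simp only <;> linarith
  -- Only the right end `y = 2 ^ (g + 1)` is left; the last odd number is at distance one from it.
  · have h3 : (2 : ℝ) ^ g ≤ ⌊y / 2⌋₊ := by exact_mod_cast not_lt.mp hlt
    refine key ⟨2 ^ g - 1, Nat.sub_lt (by positivity) one_pos⟩ ?_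
    rw [Nat.cast_sub Nat.one_le_two_pow]
    push_cast
    exact abs_le.mpr ⟨by linarith [hy1.2], by linarith [hy1.2]⟩

-- The radius `κ` is twice the error of one density, since a difference of two is estimated; the
-- cluster mean multiplies it by three, and the guess removes the total error up to `ε`.
open Classical in
theorem exists_good_estimate {f : Bool → (Core r t q b g → Bool) → Bool} {D κ c s ε : ℝ}
    (hf : ∀ s, density (f s) ≤ 1 / D)
    (hκ : κ = 2 * (32 / 2 ^ t * (32 / 2 ^ t + 2 / Real.sqrt D))) (hε : 0 < ε) (hc : 0 < c)
    (hs : |(density (f true) - density (f false)) * c - s| + c * (3 * κ) ≤ 2 ^ g * ε)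
    {σ : Bool → Bool} (m : Fin r × Bool × Fin t → Bool) (w : Bool × (Fin q ⊕ Fin b) → Bool)
    (h : ∀ γ, MostGood (fun s => groverPhase (f s) (σ s))
      (Sum.elim m (Sum.elim w γ) : Core r t q b g → Bool)) :
    ∃ γ, |(estimateExpr r t q b g (2 * κ) c ε).eval (Sum.elim m (Sum.elim w γ)) 0 - s| ≤ ε := by
  set z : Fin r → ℝ := fun ρ =>
    densityEstimate (Sum.elim m (Sum.elim w fun _ => false) : Core r t q b g → Bool) ρ true -
    densityEstimate (Sum.elim m (Sum.elim w fun _ => false) : Core r t q b g → Bool) ρ false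
  have h1 : |clusterMean z (2 * κ) - (density (f true) - density (f false))| ≤ 3 * κ := by
    refine abs_clusterMean_sub_le (fun ρ hρ => ?_) (h fun _ => false)
    have h2 := (Finset.mem_filter.mp hρ).2
    have h3 := abs_le.mp (abs_densityEstimate_sub_le hf h2 true)
    have h4 := abs_le.mp (abs_densityEstimate_sub_le hf h2 false)
    rw [hκ]
    exact abs_le.mpr ⟨by linarith, by linarith⟩
  have h2 : |c * clusterMean z (2 * κ) - s| ≤ 2 ^ g * ε := by
    have h3 : c * clusterMean z (2 * κ) - s =
        ((density (f true) - density (f false)) * c - s) +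
          c * (clusterMean z (2 * κ) - (density (f true) - density (f false))) := by ring
    rw [h3]
    refine (abs_add_le _ _).trans (le_trans ?_ hs)
    rw [abs_mul c, abs_of_pos hc]
    gcongr
  obtain ⟨γ, hγ⟩ := exists_guess hε h2
  exact ⟨γ, by rw [eval_estimateExpr]; exact hγ⟩

theorem guessQubit_ne_searchQubit (i : Fin g) {s : Bool} {a : Core r t q b g}
    (ha : a ∈ searchList s) : guessQubit i ≠ a := by
  obtain ⟨j, rfl⟩ := mem_searchList.mp ha
  simp [guessQubit, searchQubit]

theorem indep_offsetExpr (ε p : ℝ) {s : Bool} {a : Core r t q b g} (ha : a ∈ searchList s) :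
    Indep a fun x => (offsetExpr r t q b g ε).eval x p := by
  intro x v
  simp only [eval_offsetExpr, Function.update_of_ne (guessQubit_ne_searchQubit _ ha)]

theorem indep_estimateExpr (ω c ε p : ℝ) {s : Bool} {a : Core r t q b g}
    (ha : a ∈ searchList s) : Indep a fun x => (estimateExpr r t q b g ω c ε).eval x p := by
  intro x v
  have h : ∀ ρ s', digits (Function.update x a v) ρ s' = digits x ρ s' := fun ρ s' =>
    indep_digits (fun l e => digit_notMem_searchList _ s (e ▸ ha)) x v
  simp only [eval_estimateExpr, densityEstimate, h,
    Function.update_of_ne (guessQubit_ne_searchQubit _ ha)]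

end Estimate

end QuantumIP

namespace QuantumIP

/-! ### Query and gate counts of the building blocks. -/

section Counting

variable {Q : Type} {d N n m : ℕ}

/-- A layout in which all resources are disjoint and nothing is left over. -/
noncomputable def Layout.standard (Q : Type) [Fintype Q] (d N : ℕ) :
    Layout Q d N (Fintype.card (Q ⊕ Fin (indexBits d) ⊕ Fin (N + 1)))
      (Fintype.card (Bool ⊕ Fin (N + 1))) where
  core := Function.Embedding.inl.trans (Fintype.equivFin _).toEmbedding
  idx := (Function.Embedding.inl.trans Function.Embedding.inr).trans
    (Fintype.equivFin _).toEmbedding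
  flagEmb := (Function.Embedding.inr.trans Function.Embedding.inr).trans
    (Fintype.equivFin _).toEmbedding
  regEmb := Function.Embedding.inr.trans (Fintype.equivFin _).toEmbedding
  ru := Fintype.equivFin _ (Sum.inl false)
  rv := Fintype.equivFin _ (Sum.inl true)
  core_ne_idx := by simp
  core_ne_flag := by simp
  idx_ne_flag := by simp
  ru_ne_rv := by simp
  ru_ne_reg := by simp
  rv_ne_reg := by simp

/-- The number of queries of a circuit. -/
def queries (C : List (Gate d n m)) : ℕ := C.countP fun g => g.isQuery

theorem queries_append (C C' : List (Gate d n m)) :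
    queries (C ++ C') = queries C + queries C' := List.countP_append

theorem queries_gates (l : List (CGate n m)) : queries (CGate.gates d l) = 0 := by
  rw [queries, List.countP_eq_zero]
  intro g hg
  obtain ⟨c, -, rfl⟩ := List.mem_map.mp hg
  cases c <;> simp [CGate.toGate, Gate.isQuery]

theorem length_gates (l : List (CGate n m)) : (CGate.gates d l).length = l.length :=
  List.length_map _

theorem length_invL (l : List (CGate n m)) : (CGate.invL l).length = l.length := by
  simp [CGate.invL]

namespace Layout

variable [DecidableEq Q] (ℒ : Layout Q d N n m)

omit [DecidableEq Q] in
theorem queries_layerCircuit (l : List Q) : queries (ℒ.layerCircuit l) = 0 := by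
  rw [queries, List.countP_eq_zero]
  intro g hg
  obtain ⟨c, -, rfl⟩ := List.mem_map.mp hg
  simp [Gate.isQuery]

theorem queries_phaseCircuit (c : Q) (w : List (Q × ℝ)) : queries (ℒ.phaseCircuit c w) = 0 := by
  rw [queries, List.countP_eq_zero]
  intro g hg
  obtain ⟨p, -, h⟩ := List.mem_flatMap.mp hg
  split_ifs at h
  · rw [List.mem_singleton] at h
    subst h
    simp [Gate.isQuery]
  · simp at h

omit [DecidableEq Q] in
theorem length_layerCircuit (l : List Q) : (ℒ.layerCircuit l).length = l.length :=
  List.length_map _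

omit [DecidableEq Q] in
theorem queries_markCircuit (e f : Expr Q) (j : Fin (indexBits d) → Q) (c : Q)
    (hef : ℒ.flag e.size ≠ ℒ.flag 0) : queries (ℒ.markCircuit e f j c hef) = 4 := by
  simp only [markCircuit, queries_append, queries_gates]
  rfl

omit [DecidableEq Q] in
theorem length_markCircuit (e f : Expr Q) (j : Fin (indexBits d) → Q) (c : Q)
    (hef : ℒ.flag e.size ≠ ℒ.flag 0) : (ℒ.markCircuit e f j c hef).length ≤
      4 * e.size + 2 * indexBits d + 4 * f.size + 5 := by
  have h1 := ℒ.length_compile e 0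
  have h2 := ℒ.length_compile f e.size
  simp only [markCircuit, prepare, copyGates, List.length_append, length_gates, length_invL,
    List.length_map, List.length_finRange, List.length_cons, List.length_nil]
  omega

omit [DecidableEq Q] in
theorem queries_rejectCircuit (e : Expr Q) (c : Q) : queries (ℒ.rejectCircuit e c) = 0 := by
  simp only [rejectCircuit, queries_append, queries_gates]
  rfl

omit [DecidableEq Q] in
theorem length_rejectCircuit (e : Expr Q) (c : Q) :
    (ℒ.rejectCircuit e c).length ≤ 4 * e.size + 1 := by
  have h1 := ℒ.length_compile e 0
  simp only [rejectCircuit, List.length_append, length_gates, length_invL, List.length_cons,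
    List.length_nil]
  omega

omit [DecidableEq Q] in
theorem queries_groverCircuit (l : List Q) (e f : Expr Q) (j : Fin (indexBits d) → Q) (c : Q)
    (hef : ℒ.flag e.size ≠ ℒ.flag 0) : queries (ℒ.groverCircuit l e f j c hef) = 4 := by
  simp only [groverCircuit, queries_append, queries_markCircuit, queries_layerCircuit,
    queries_rejectCircuit]

omit [DecidableEq Q] in
theorem length_groverCircuit (l : List Q) (e f : Expr Q) (j : Fin (indexBits d) → Q) (c : Q)
    (hef : ℒ.flag e.size ≠ ℒ.flag 0) : (ℒ.groverCircuit l e f j c hef).length ≤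
      4 * e.size + 2 * indexBits d + 4 * f.size + 18 * l.length + 18 := by
  have h1 := ℒ.length_markCircuit e f j c hef
  have h2 := ℒ.length_rejectCircuit (.isZero l) c
  rw [Expr.size_isZero] at h2
  simp only [groverCircuit, List.length_append, length_layerCircuit, List.length_reverse]
  omega

theorem queries_testCircuit (l : List Q) (e f : Expr Q) (j : Fin (indexBits d) → Q) (c : Q)
    (hef : ℒ.flag e.size ≠ ℒ.flag 0) (w : List (Q × ℝ)) (k : ℕ) :
    queries (ℒ.testCircuit l e f j c hef w k) = 4 * k := by
  have h : queries (List.replicate k (ℒ.groverCircuit l e f j c hef)).flatten = 4 * k := by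
    induction k with
    | zero => rfl
    | succ k ih =>
      rw [List.replicate_succ, List.flatten_cons, queries_append, ih, queries_groverCircuit]
      ring
  simp only [testCircuit, queries_append, queries_layerCircuit, queries_phaseCircuit, h]
  ring

theorem length_testCircuit (l : List Q) (e f : Expr Q) (j : Fin (indexBits d) → Q) (c : Q)
    (hef : ℒ.flag e.size ≠ ℒ.flag 0) (w : List (Q × ℝ)) (k : ℕ) :
    (ℒ.testCircuit l e f j c hef w k).length ≤ 2 + w.length +
      k * (4 * e.size + 2 * indexBits d + 4 * f.size + 18 * l.length + 18) := by
  have h1 := ℒ.length_phaseCircuit c w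
  have h2 := Nat.mul_le_mul_left k (ℒ.length_groverCircuit l e f j c hef)
  simp only [testCircuit, List.length_append, length_layerCircuit, List.length_flatten,
    List.map_replicate, List.sum_replicate, smul_eq_mul, List.length_cons, List.length_nil]
  omega

end Layout

end Counting

/-! ### The complete circuit, its cost and its success probability. -/

section Estimation

variable {r t b g d N n m : ℕ}

/-- The estimation circuit before the output is computed. -/
noncomputable def estimationCircuit (ℒ : Layout (Core r t (indexBits d) b g) d N n m) (h : ℝ)
    (hf : ℒ.flag (4 * indexBits d + 3) ≠ ℒ.flag 0) : List (Gate d n m) :=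
  ℒ.layerCircuit uniformList.reverse ++ (testList r t).flatMap fun c =>
    ℒ.testCircuit (searchList c.2.1) (validExpr r t b g d c.2.1) (belowExpr r t b g d h c.2.1)
      (fun i => searchQubit c.2.1 (Sum.inl i)) (digit c) (by rw [size_validExpr]; exact hf)
      (corrections c) (2 ^ (t - 1 - c.2.2))

theorem run_estimationCircuit (ℒ : Layout (Core r t (indexBits d) b g) d N n m) (h : ℝ)
    (hf : ℒ.flag (4 * indexBits d + 3) ≠ ℒ.flag 0) (hd : 0 < d)
    (hN : 4 * (indexBits d + b) + 10 ≤ N + 1) {Ou Ov : OracleSpace d ≃ₗᵢ[ℂ] OracleSpace d}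
    {u v : Fin d → ℝ} (hu : IsInputOracle Ou u) (hv : IsInputOracle Ov v) :
    run Ou Ov (estimationCircuit ℒ h hf) (initial n m) =
      ℒ.lift (finalAmplitude (markedPoint r t b g u v h)) := by
  have key : ∀ L : List (Fin r × Bool × Fin t), ℒ.Implements Ou Ov (L.flatMap fun c =>
      ℒ.testCircuit (searchList c.2.1) (validExpr r t b g d c.2.1) (belowExpr r t b g d h c.2.1)
        (fun i => searchQubit c.2.1 (Sum.inl i)) (digit c) (by rw [size_validExpr]; exact hf)
        (corrections c) (2 ^ (t - 1 - c.2.2))) (testsOp (markedPoint r t b g u v h) L) := by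
    intro L
    induction L with
    | nil => exact Layout.Implements.nil
    | cons c L ih =>
      rw [List.flatMap_cons]
      refine (Layout.implements_test _ _ _ _ _ _ hd ?_ ?_ ?_ hu hv _ ?_ _).append ih
      · rw [size_validExpr, size_belowExpr]
        omega
      · rw [length_searchList]
        omega
      · intro x hx
        exact (test_validExpr _ _ _).mp hx
      · intro p hp e
        obtain ⟨k, hk, h2⟩ := mem_corrections hp
        have h3 := Sum.inl_injective (h2.symm.trans e)
        have h4 : k = c.2.2 := congrArg (fun c : Fin r × Bool × Fin t => c.2.2) h3
        exact hk.ne h4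
  have hl : ∀ a : Core r t (indexBits d) b g, a ∈ (testList r t).map digit ++ uniformList := by
    intro a
    by_cases ha : ∃ c, a = digit c
    · obtain ⟨c, rfl⟩ := ha
      exact List.mem_append_left _ (List.mem_map_of_mem (mem_testList c))
    · exact List.mem_append_right _ (mem_uniformList.mpr fun c hc => ha ⟨c, hc⟩)
  rw [initial_eq_lift ℒ hl, estimationCircuit,
    ((Layout.implements_layer uniformList.reverse).append (key _))]
  rfl

theorem sum_map_testList (F : Fin r × Bool × Fin t → ℕ) :
    ((testList r t).map F).sum = ∑ c, F c := by
  have h : (testList r t).toFinset = Finset.univ :=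
    Finset.eq_univ_iff_forall.mpr fun c => List.mem_toFinset.mpr (mem_testList c)
  rw [← List.sum_toFinset _ nodup_testList, h]

/-- A Grover iteration makes four queries, the powers in one phase add up to `2 ^ t - 1`, and there
are two phases in each of `r` rounds. -/
theorem queries_estimationCircuit (ℒ : Layout (Core r t (indexBits d) b g) d N n m) (h : ℝ)
    (hf : ℒ.flag (4 * indexBits d + 3) ≠ ℒ.flag 0) :
    queries (estimationCircuit ℒ h hf) = 8 * r * (2 ^ t - 1) := by
  rw [estimationCircuit, queries_append, ℒ.queries_layerCircuit, zero_add, queries,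
    List.countP_flatMap]
  have h1 : ∀ c : Fin r × Bool × Fin t, (List.countP (fun g => g.isQuery) ∘ fun c =>
      ℒ.testCircuit (searchList c.2.1) (validExpr r t b g d c.2.1) (belowExpr r t b g d h c.2.1)
        (fun i => searchQubit c.2.1 (Sum.inl i)) (digit c) (by rw [size_validExpr]; exact hf)
        (corrections c) (2 ^ (t - 1 - c.2.2))) c = 4 * 2 ^ (t - 1 - (c.2.2 : ℕ)) :=
    fun c => ℒ.queries_testCircuit _ _ _ _ _ _ _ _
  rw [List.map_congr_left fun c _ => h1 c, sum_map_testList]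
  simp only [Fintype.sum_prod_type, Finset.sum_const, Finset.card_univ, Fintype.card_fin,
    Fintype.card_bool, smul_eq_mul, ← Finset.mul_sum]
  rw [Fin.sum_univ_eq_sum_range (fun l => 2 ^ (t - 1 - l)),
    Finset.sum_range_reflect (fun l => 2 ^ l), Nat.geomSum_eq le_rfl, Nat.div_one]
  ring

theorem length_estimationCircuit_le (ℒ : Layout (Core r t (indexBits d) b g) d N n m) (h : ℝ)
    (hf : ℒ.flag (4 * indexBits d + 3) ≠ ℒ.flag 0) :
    (estimationCircuit ℒ h hf).length ≤ 2 * (indexBits d + b) + g +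
      2 * r * t * (2 + t + 2 ^ t * (60 * (indexBits d + b + 1))) := by
  have h1 : ∀ c : Fin r × Bool × Fin t, (ℒ.testCircuit (searchList c.2.1)
      (validExpr r t b g d c.2.1) (belowExpr r t b g d h c.2.1)
      (fun i => searchQubit c.2.1 (Sum.inl i)) (digit c) (by rw [size_validExpr]; exact hf)
      (corrections c) (2 ^ (t - 1 - c.2.2))).length ≤
        2 + t + 2 ^ t * (60 * (indexBits d + b + 1)) := by
    intro c
    refine (ℒ.length_testCircuit _ _ _ _ _ _ _ _).trans ?_
    rw [size_validExpr, size_belowExpr, length_searchList]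
    refine add_le_add (Nat.add_le_add_left (length_corrections c) 2) (Nat.mul_le_mul ?_ (by omega))
    exact Nat.pow_le_pow_right (by norm_num) (by omega)
  rw [estimationCircuit, List.length_append, ℒ.length_layerCircuit, List.length_reverse,
    length_uniformList, List.length_flatMap, sum_map_testList]
  refine Nat.add_le_add_left ((Finset.sum_le_sum fun c _ => h1 c).trans (le_of_eq ?_)) _
  simp only [Finset.sum_const, Finset.card_univ, Fintype.card_prod, Fintype.card_fin,
    Fintype.card_bool, smul_eq_mul]
  ring

open Classical in
theorem exists_estimation_algorithm (hd : 0 < d) (h : ℝ)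
    (out : Expr (Core r t (indexBits d) b g)) :
    ∃ 𝒜 : Algorithm d, 𝒜.queryCount = 8 * r * (2 ^ t - 1) ∧
      𝒜.gateCount ≤ 2 * (indexBits d + b) + g +
        2 * r * t * (2 + t + 2 ^ t * (60 * (indexBits d + b + 1))) + 2 * out.size ∧
      ∀ (u v : Fin d → ℝ) (Ou Ov : OracleSpace d ≃ₗᵢ[ℂ] OracleSpace d),
        IsInputOracle Ou u → IsInputOracle Ov v → ∀ S : Set ℝ,
          𝒜.outputProb Ou Ov S = ∑ x, if out.eval x 0 ∈ S then
            ‖finalAmplitude (markedPoint r t b g u v h) x‖ ^ 2 else 0 := by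
  obtain ⟨N, hN⟩ : ∃ N, N = 4 * (indexBits d + b) + 10 + out.size := ⟨_, rfl⟩
  set ℒ := Layout.standard (Core r t (indexBits d) b g) d N
  have hf : ℒ.flag (4 * indexBits d + 3) ≠ ℒ.flag 0 :=
    ℒ.flag_ne (by omega) (by omega) (by omega)
  refine ⟨⟨_, _, estimationCircuit ℒ h hf ++ CGate.gates d (ℒ.compile out 0), ℒ.reg 0⟩,
    ?_, ?_, fun u v Ou Ov hu hv S => ?_⟩
  · change queries _ = _
    rw [queries_append, queries_gates, queries_estimationCircuit, add_zero]
  · refine List.countP_le_length.trans ?_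
    rw [List.length_append, length_gates]
    exact add_le_add (length_estimationCircuit_le ℒ h hf) (ℒ.length_compile out 0)
  · convert run_append_compile (run_estimationCircuit ℒ h hf hd (by omega) hu hv) out (by omega) S

-- For every pair of eigenvectors `success_bound` applies, and `exists_mixture` averages over the
-- pairs. It needs an output that does not read the search registers.
open Classical in
theorem outputProb_ge (u v : Fin d → ℝ) (h s ε : ℝ) (out : Expr (Core r t (indexBits d) b g))
    (hout : ∀ s, ∀ a ∈ searchList s, Indep a fun x => out.eval x 0)
    (hgood : ∀ (σ : Bool → Bool) m w,
      (∀ γ, MostGood (fun s => groverPhase (markedPoint r t b g u v h s) (σ s))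
        (Sum.elim m (Sum.elim w γ) : Core r t (indexBits d) b g → Bool)) →
        ∃ γ, |out.eval (Sum.elim m (Sum.elim w γ)) 0 - s| ≤ ε) :
    (1 - (3 / 4) ^ r) / 2 ^ g ≤ ∑ x, if out.eval x 0 ∈ {y : ℝ | |y - s| ≤ ε} then
      ‖finalAmplitude (markedPoint r t b g u v h) x‖ ^ 2 else 0 := by
  obtain ⟨w, hw0, hw1, hw⟩ := exists_mixture (f := markedPoint r t b g u v h)
    fun s a ha => indep_markedPoint u v h s a ha
  have h1 := hw (fun x => |out.eval x 0 - s| ≤ ε) fun s a ha =>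
    (hout s a ha).comp fun y => |y - _| ≤ ε
  simp only [Set.mem_ofPred_eq]
  rw [h1]
  calc (1 - (3 / 4) ^ r) / 2 ^ g = ∑ a, w a * ((1 - (3 / 4) ^ r) / 2 ^ g : ℝ) := by
        rw [← Finset.sum_mul, hw1, one_mul]
    _ ≤ _ := Finset.sum_le_sum fun a _ => mul_le_mul_of_nonneg_left
        (success_bound _ (hgood fun s => if s then a.1 else a.2)) (hw0 a)

end Estimation

end QuantumIP

namespace QuantumIP

/-! ### Choice of the parameters. -/

section Parameters

variable {d : ℕ}

theorem two_pow_indexBits_le (hd : 0 < d) : 2 ^ indexBits d ≤ 2 * d := by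
  rcases Nat.lt_or_ge 1 d with h | h
  · have h1 := Nat.pow_pred_clog_lt_self (b := 2) (by norm_num) h
    have h2 : 0 < Nat.clog 2 d := Nat.clog_pos (by norm_num) h
    have h3 : 2 ^ Nat.clog 2 d = 2 ^ (Nat.clog 2 d).pred * 2 := by
      rw [← pow_succ, Nat.pred_eq_sub_one, Nat.sub_add_cancel h2]
    rw [indexBits, h3]
    omega
  · obtain rfl : d = 1 := by omega
    simp

theorem abs_sum_mul_le {A B : ℝ} (hA : 0 < A) {u v : Fin d → ℝ} (hu : ‖u‖ ≤ A)
    (hv : l1Norm v ≤ B) : |∑ j, u j * v j| ≤ A * B := by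
  calc |∑ j, u j * v j| ≤ ∑ j, |u j * v j| := Finset.abs_sum_le_sum_abs _ _
    _ ≤ ∑ j, A * |v j| := Finset.sum_le_sum fun j _ => by
        rw [abs_mul]
        exact mul_le_mul_of_nonneg_right ((norm_le_pi_norm u j).trans hu) (abs_nonneg _)
    _ ≤ A * B := by
        rw [← Finset.mul_sum]
        exact mul_le_mul_of_nonneg_left hv hA.le

/-- An upper bound for the number of gates of the estimation algorithm. -/
def gateBound (r t q b g : ℕ) : ℕ :=
  2 * (q + b) + g + 2 * r * t * (2 + t + 2 ^ t * (60 * (q + b + 1))) +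
    2 * (400 * ((r + 1) ^ 2 * (2 ^ t * (t + 1))) + 4 * g)

theorem exists_algorithm {A B ε κ : ℝ} (hd : 0 < d) (hA : 0 < A) (hB : 0 < B) (hε : 0 < ε)
    (r t b g : ℕ)
    (hκ : κ = 2 * (32 / 2 ^ t * (32 / 2 ^ t + 2 / Real.sqrt (2 ^ indexBits d))))
    (h : d * (A * B / 2 ^ b) + 2 ^ indexBits d * (A * B) * (3 * κ) ≤ 2 ^ g * ε) :
    ∃ 𝒜 : Algorithm d, 𝒜.queryCount = 8 * r * (2 ^ t - 1) ∧
      𝒜.gateCount ≤ gateBound r t (indexBits d) b g ∧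
      ∀ u v : Fin d → ℝ, ‖u‖ ≤ A → l1Norm v ≤ B → ∀ Ou Ov : OracleSpace d ≃ₗᵢ[ℂ] OracleSpace d,
        IsInputOracle Ou u → IsInputOracle Ov v →
          (1 - (3 / 4) ^ r) / 2 ^ g ≤ 𝒜.outputProb Ou Ov {x | |x - ∑ j, u j * v j| ≤ ε} := by
  classical
  obtain ⟨𝒜, h1, h2, h3⟩ := exists_estimation_algorithm hd (A * B / 2 ^ b)
    (estimateExpr r t (indexBits d) b g (2 * κ) (2 ^ indexBits d * (A * B)) ε)
  refine ⟨𝒜, h1, h2.trans ?_, fun u v hu hv Ou Ov hOu hOv => ?_⟩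
  · exact Nat.add_le_add_left (Nat.mul_le_mul_left 2 (size_estimateExpr_le _ _ _)) _
  · rw [h3 u v Ou Ov hOu hOv]
    refine outputProb_ge u v _ _ _ _ (fun s a ha => indep_estimateExpr _ _ _ _ ha)
      fun σ m w hm => ?_
    refine exists_good_estimate (f := markedPoint r t b g u v (A * B / 2 ^ b))
      (fun s => density_markedPoint_le hA hB hu hv s) hκ hε (by positivity) ?_ m w hm
    exact (add_le_add_left (density_sub_density hA hB hu hv) _).trans h

/-- With `t = 0` no phase is tested and the output is the random offset alone, which suffices
because the inner product lies between `-(A * B)` and `A * B`. -/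
theorem exists_guessing_algorithm {A B ε : ℝ} (hd : 0 < d) (hA : 0 < A) (hε : 0 < ε)
    (g : ℕ) (h : A * B ≤ 2 ^ g * ε) :
    ∃ 𝒜 : Algorithm d, 𝒜.queryCount = 0 ∧ 𝒜.gateCount ≤ gateBound 1 0 (indexBits d) 0 g ∧
      ∀ u v : Fin d → ℝ, ‖u‖ ≤ A → l1Norm v ≤ B → ∀ Ou Ov : OracleSpace d ≃ₗᵢ[ℂ] OracleSpace d,
        IsInputOracle Ou u → IsInputOracle Ov v →
          1 / 4 / 2 ^ g ≤ 𝒜.outputProb Ou Ov {x | |x - ∑ j, u j * v j| ≤ ε} := by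
  classical
  obtain ⟨𝒜, h1, h2, h3⟩ := exists_estimation_algorithm (r := 1) (t := 0) (b := 0) hd 1
    (offsetExpr 1 0 (indexBits d) 0 g ε)
  refine ⟨𝒜, h1, h2.trans ?_, fun u v hu hv Ou Ov hOu hOv => ?_⟩
  · rw [size_offsetExpr, gateBound]
    omega
  · rw [h3 u v Ou Ov hOu hOv]
    have := outputProb_ge u v 1 (∑ j, u j * v j) ε (offsetExpr 1 0 (indexBits d) 0 g ε)
      (fun s a ha => indep_offsetExpr _ _ ha) fun σ m w hm => by
        obtain ⟨γ, hγ⟩ := exists_guess (g := g) (s := ∑ j, u j * v j) (a := 0) hε (by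
          rw [zero_sub, abs_neg]
          exact (abs_sum_mul_le hA hu hv).trans h)
        refine ⟨γ, ?_⟩
        rw [zero_add] at hγ
        rw [eval_offsetExpr]
        exact hγ
    norm_num at this ⊢
    exact this

theorem exists_trivial_algorithm {ε : ℝ} :
    ∃ 𝒜 : Algorithm d, 𝒜.queryCount = 0 ∧ 𝒜.gateCount = 0 ∧
      ∀ s : ℝ, |s| ≤ ε → ∀ Ou Ov : OracleSpace d ≃ₗᵢ[ℂ] OracleSpace d,
        𝒜.outputProb Ou Ov {x | |x - s| ≤ ε} = 1 := by
  refine ⟨⟨0, 1, [], 0⟩, rfl, rfl, fun s hs Ou Ov => ?_⟩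
  rw [Algorithm.outputProb, tsum_eq_single ((fun _ => false, fun _ => 0) : Label 0 1)]
  · simp [Algorithm.finalState, initial, hs]
  · intro b hb
    simp [Algorithm.finalState, initial, Pi.single_eq_of_ne hb]

/-- The constant `3 / 2` exceeds `1 / log 2`. -/
theorem le_log_of_two_pow_le {n k : ℕ} {W : ℝ} (h : (2 : ℝ) ^ n ≤ W ^ k) :
    (n : ℝ) ≤ 3 / 2 * (k * Real.log W) := by
  have h1 := Real.log_le_log (by positivity) h
  rw [Real.log_pow, Real.log_pow] at h1
  have h2 := Real.log_two_gt_d9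
  nlinarith [Nat.cast_nonneg (α := ℝ) n]

/-- Of the two factors `r`, one is charged to `Λ` and the other to `L`. The condition `1 ≤ 2 * Λ`
absorbs the gates that do not scale with the number of rounds; this is why the gate count has `log
(2 / δ)`. -/
theorem gateBound_le {r t q b g : ℕ} {T Λ L : ℝ} (hT : 1 ≤ T) (hΛ : 1 ≤ 2 * Λ) (hL : 1 ≤ L)
    (hq : (q : ℝ) ≤ 3 * L) (hb : (b : ℝ) ≤ 5 * L) (hg : (g : ℝ) ≤ 3 * L) (ht : (t : ℝ) ≤ 12 * L)
    (hr : (r : ℝ) ≤ 8 * Λ) (hr' : (r : ℝ) ≤ 8 * L) (hM : (2 : ℝ) ^ t ≤ 4096 * T) :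
    (gateBound r t q b g : ℝ) ≤ 10 ^ 10 * (T * Λ) * L ^ 2 := by
  have hΛ0 : 0 < Λ := by linarith
  rw [gateBound]
  push_cast
  have h1 : 2 * ((q : ℝ) + b) + g ≤ 38 * (T * Λ * L ^ 2) := by
    calc 2 * ((q : ℝ) + b) + g ≤ 19 * (1 * 1 * L) := by linarith
      _ ≤ 19 * (T * (2 * Λ) * L ^ 2) := by gcongr; nlinarith
      _ = _ := by ring
  have h2 : 2 * (r : ℝ) * t * (2 + t + 2 ^ t * (60 * (q + b + 1))) ≤
      500000000 * (T * Λ * L ^ 2) := by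
    calc 2 * (r : ℝ) * t * (2 + t + 2 ^ t * (60 * (q + b + 1)))
        ≤ 2 * (8 * Λ) * (12 * L) * (2 * (T * L) + 12 * (T * L) +
          4096 * T * (60 * (3 * L + 5 * L + L))) := by
          gcongr
          · nlinarith
          · nlinarith
      _ = 424673280 * (T * Λ * L ^ 2) + 2688 * (T * Λ * L ^ 2) := by ring
      _ ≤ _ := by
        have : 0 ≤ T * Λ * L ^ 2 := by positivity
        linarith
  have h3 : 2 * (400 * (((r : ℝ) + 1) ^ 2 * (2 ^ t * (t + 1))) + 4 * g) ≤
      8000000000 * (T * Λ * L ^ 2) := by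
    calc 2 * (400 * (((r : ℝ) + 1) ^ 2 * (2 ^ t * (t + 1))) + 4 * g)
        = 800 * (((r : ℝ) + 1) * (r + 1) * (2 ^ t * (t + 1))) + 8 * (1 * 1 * g) := by ring
      _ ≤ 800 * ((8 * Λ + 2 * Λ) * (8 * L + L) * (4096 * T * (12 * L + L))) +
          8 * (T * (2 * Λ) * (3 * (L * L))) := by
          gcongr
          nlinarith
      _ = 3833856048 * (T * Λ * L ^ 2) := by ring
      _ ≤ _ := by
        have : 0 ≤ T * Λ * L ^ 2 := by positivity
        linarith
  have : 0 ≤ T * Λ * L ^ 2 := by positivity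
  linarith

/-- The left side is `192 * (A * B) / M * (32 * D / M + 2 * √D)`. As `R ≤ A * B / ε`, the bound on
`M` also gives `2048 * √d' ≤ M`, so the bracket is at most `4 * √d'`, and `768 / 2048 ≤ 1 / 2`. -/
theorem estimation_error_le {A B ε M R D d' : ℝ} (hA : 0 < A) (hB : 0 < B) (hε : 0 < ε)
    (hR : 0 < R) (hd : 0 < d') (hD : d' ≤ D) (hD' : D ≤ 2 * d') (hP : R ≤ A * B / ε)
    (hM : 2048 * (A * B / ε * Real.sqrt d') / R ≤ M) :
    D * (A * B) * (3 * (2 * (32 / M * (32 / M + 2 / Real.sqrt D)))) ≤ R * ε / 2 := by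
  have hs : 0 < Real.sqrt d' := Real.sqrt_pos.mpr hd
  have hs2 := Real.sq_sqrt hd.le
  have hD0 : 0 < D := hd.trans_le hD
  have hw2 := Real.sq_sqrt hD0.le
  have hw : 0 < Real.sqrt D := Real.sqrt_pos.mpr hD0
  have hM1 : 2048 * Real.sqrt d' ≤ M := by
    refine le_trans ?_ hM
    rw [le_div_iff₀ hR]
    nlinarith
  have hM0 : 0 < M := lt_of_lt_of_le (by positivity) hM1
  have hM2 : 2048 * (A * B) * Real.sqrt d' ≤ M * R * ε := by
    rw [div_le_iff₀ hR] at hM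
    have := mul_le_mul_of_nonneg_right hM hε.le
    refine le_trans (le_of_eq ?_) this
    field_simp
  have h1 : D * (A * B) * (3 * (2 * (32 / M * (32 / M + 2 / Real.sqrt D)))) =
      192 * (A * B) / M * (32 * D / M + 2 * Real.sqrt D) := by
    have : D / Real.sqrt D = Real.sqrt D := Real.div_sqrt
    calc _ = 192 * (A * B) / M * (32 * D / M + 2 * (D / Real.sqrt D)) := by ring
      _ = _ := by rw [this]
  have h2 : 32 * D / M ≤ Real.sqrt d' := by
    rw [div_le_iff₀ hM0]
    nlinarith
  have h3 : Real.sqrt D ≤ 3 / 2 * Real.sqrt d' := by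
    refine Real.sqrt_le_iff.mpr ⟨by positivity, ?_⟩
    nlinarith
  rw [h1]
  calc 192 * (A * B) / M * (32 * D / M + 2 * Real.sqrt D)
      ≤ 192 * (A * B) / M * (4 * Real.sqrt d') := by gcongr; linarith
    _ = 768 * (A * B) * Real.sqrt d' / M := by ring
    _ ≤ R * ε / 2 := by
      rw [div_le_iff₀ hM0]
      have : 0 ≤ M * R * ε := by positivity
      linarith

theorem exists_pow_between {x : ℝ} (hx : 1 ≤ x) : ∃ n : ℕ, x ≤ 2 ^ n ∧ (2 : ℝ) ^ n ≤ 2 * x := by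
  obtain ⟨n, h1, h2⟩ := exists_nat_pow_near hx (one_lt_two : (1 : ℝ) < 2)
  exact ⟨n + 1, h2.le, by rw [pow_succ]; linarith⟩

/-- The tolerance `2 ^ g * ε` is split evenly: `b` makes the rounding error at most one half of it,
`t` the error of the phases. A larger tolerance lowers `2 ^ t` in proportion. -/
theorem exists_algorithm_parameters {A B ε : ℝ} (hd : 0 < d) (hA : 0 < A) (hB : 0 < B)
    (hε : 0 < ε) (r g : ℕ) (hg : (2 : ℝ) ^ g ≤ A * B / ε) :
    ∃ t b : ℕ, (2 : ℝ) ^ t ≤ 4096 * (A * B / ε * Real.sqrt d) / 2 ^ g ∧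
      (2 : ℝ) ^ b ≤ 4 * (d * (A * B / ε)) ∧
      ∃ 𝒜 : Algorithm d, 𝒜.queryCount = 8 * r * (2 ^ t - 1) ∧
      𝒜.gateCount ≤ gateBound r t (indexBits d) b g ∧
      ∀ u v : Fin d → ℝ, ‖u‖ ≤ A → l1Norm v ≤ B → ∀ Ou Ov : OracleSpace d ≃ₗᵢ[ℂ] OracleSpace d,
        IsInputOracle Ou u → IsInputOracle Ov v →
          (1 - (3 / 4) ^ r) / 2 ^ g ≤ 𝒜.outputProb Ou Ov {x | |x - ∑ j, u j * v j| ≤ ε} := by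
  have hR : (1 : ℝ) ≤ 2 ^ g := one_le_pow₀ (by norm_num)
  have hd1 : (1 : ℝ) ≤ d := by exact_mod_cast hd
  have hs1 : 1 ≤ Real.sqrt d := Real.one_le_sqrt.mpr hd1
  obtain ⟨P, hP⟩ : ∃ P, P = A * B / ε := ⟨_, rfl⟩
  have hAB : A * B = P * ε := by rw [hP]; field_simp
  rw [← hP] at hg ⊢
  have hP1 : 1 ≤ P := hR.trans hg
  obtain ⟨t, ht1, ht2⟩ := exists_pow_between (x := 2048 * (P * Real.sqrt d) / 2 ^ g) (by
    rw [le_div_iff₀ (by positivity)]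
    nlinarith)
  obtain ⟨b, hb1, hb2⟩ := exists_pow_between (x := 2 * (d * P)) (by nlinarith)
  refine ⟨t, b, ht2.trans (le_of_eq (by ring)), hb2.trans (le_of_eq (by ring)),
    exists_algorithm hd hA hB hε r t b g rfl ?_⟩
  have h1 : (d : ℝ) * (A * B / 2 ^ b) ≤ 2 ^ g * ε / 2 := by
    calc (d : ℝ) * (A * B / 2 ^ b) ≤ d * (A * B / (2 * (d * P))) := by gcongr
      _ = 1 * ε / 2 := by rw [hAB]; field_simp
      _ ≤ _ := by gcongr
  have h2 := estimation_error_le (M := 2 ^ t) (R := 2 ^ g) (D := 2 ^ indexBits d) (d' := d) hA hB hε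
    (by positivity) (by linarith) (by exact_mod_cast Nat.le_pow_clog (by norm_num) d)
    (by exact_mod_cast two_pow_indexBits_le hd) (hP ▸ hg) (hP ▸ ht1)
  linarith

theorem gateBound_le_of_two_pow_le {P δ : ℝ} {r t b g : ℕ} (hd : 0 < d) (hP : 1 ≤ P) (hδ : 0 < δ)
    (hδ1 : δ < 1) (ht : (2 : ℝ) ^ t ≤ 4096 * (P * Real.sqrt d))
    (hb : (2 : ℝ) ^ b ≤ 4 * (d * P)) (hg : (2 : ℝ) ^ g ≤ 2 * P)
    (hr : (r : ℝ) ≤ 8 * Real.log (1 / δ) ∨ r = 1) :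
    (gateBound r t (indexBits d) b g : ℝ) ≤ 10 ^ 10 * (P * Real.sqrt d * Real.log (2 / δ)) *
      Real.log (2 + (d : ℝ) + P + 1 / δ) ^ 2 := by
  have hδ' : 1 < 1 / δ := by rwa [one_lt_div hδ]
  have hlog1 : 0 < Real.log (1 / δ) := Real.log_pos hδ'
  have hlog2 : Real.log (2 / δ) = Real.log 2 + Real.log (1 / δ) := by
    rw [← Real.log_mul (by norm_num) (by positivity)]; ring_nf
  have hl2 := Real.log_two_gt_d9
  have hd1 : (1 : ℝ) ≤ d := by exact_mod_cast hd
  have hs1 : 1 ≤ Real.sqrt d := Real.one_le_sqrt.mpr hd1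
  have hsd : Real.sqrt d ≤ d := Real.sqrt_le_iff.mpr ⟨by linarith, by nlinarith⟩
  obtain ⟨W, hW⟩ : ∃ W, W = 2 + (d : ℝ) + P + 1 / δ := ⟨_, rfl⟩
  rw [← hW]
  have hW5 : 5 ≤ W := by linarith
  have hL : 1 ≤ Real.log W := by
    rw [Real.le_log_iff_exp_le (by linarith)]
    linarith [Real.exp_one_lt_d9]
  have hdW : (d : ℝ) ≤ W := by linarith
  have hPW : P ≤ W := by linarith
  have hdlog : Real.log (1 / δ) ≤ Real.log W := Real.log_le_log (by positivity) (by linarith)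
  refine gateBound_le (by nlinarith) (by linarith) hL ?_ ?_ ?_ ?_ ?_ ?_ ht
  · have h1 : (2 : ℝ) ^ indexBits d ≤ 2 * d := by exact_mod_cast two_pow_indexBits_le hd
    have := le_log_of_two_pow_le (k := 2) (W := W) (h1.trans (by nlinarith))
    push_cast at this
    linarith
  · have h1 : (d : ℝ) * P ≤ W ^ 2 := by rw [sq]; gcongr
    have := le_log_of_two_pow_le (k := 3) (W := W) (hb.trans (by rw [pow_succ]; nlinarith))
    push_cast at this
    linarith
  · have := le_log_of_two_pow_le (k := 2) (W := W) (hg.trans (by nlinarith))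
    push_cast at this
    linarith
  · have h1 : (4096 : ℝ) ≤ W ^ 6 := by
      calc (4096 : ℝ) ≤ 5 ^ 6 := by norm_num
        _ ≤ W ^ 6 := by gcongr
    have := le_log_of_two_pow_le (k := 8) (W := W) (ht.trans (by
      calc 4096 * (P * Real.sqrt d) ≤ W ^ 6 * (W * W) := by
            gcongr
            exact hsd.trans hdW
        _ = W ^ 8 := by ring))
    push_cast at this
    linarith
  · rcases hr with hr | rfl
    · linarith
    · push_cast; linarith
  · rcases hr with hr | rfl
    · linarith
    · push_cast; linarith

theorem exists_algorithm_of_le {A B ε δ : ℝ} (hd : 0 < d) (hA : 0 < A) (hB : 0 < B) (hε : 0 < ε)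
    (hAB : 1 ≤ A * B / ε) (hδ : 0 < δ) (hδ3 : δ ≤ 3 / 4) :
    ∃ 𝒜 : Algorithm d,
      (𝒜.queryCount : ℝ) ≤ 10 ^ 10 * (A * B * Real.sqrt d / ε * Real.log (1 / δ)) ∧
      (𝒜.gateCount : ℝ) ≤ 10 ^ 10 * (A * B * Real.sqrt d / ε * Real.log (2 / δ)) *
        Real.log (2 + (d : ℝ) + A * B / ε + 1 / δ) ^ 2 ∧
      ∀ u v : Fin d → ℝ, ‖u‖ ≤ A → l1Norm v ≤ B → ∀ Ou Ov : OracleSpace d ≃ₗᵢ[ℂ] OracleSpace d,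
        IsInputOracle Ou u → IsInputOracle Ov v →
          1 - δ ≤ 𝒜.outputProb Ou Ov {x | |x - ∑ j, u j * v j| ≤ ε} := by
  have hT : A * B * Real.sqrt d / ε = A * B / ε * Real.sqrt d := by ring
  rw [hT]
  -- Since `3 / 4 ≤ exp (-1 / 4)`, this many rounds make `(3 / 4) ^ r ≤ δ`. Rounding up is
  -- affordable because `δ ≤ 3 / 4` keeps `log (1 / δ)` above `1 / 4`.
  obtain ⟨r, hr⟩ : ∃ r, r = ⌈4 * Real.log (1 / δ)⌉₊ := ⟨_, rfl⟩
  have hδlog : 1 / 4 ≤ Real.log (1 / δ) := by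
    rw [one_div δ, Real.log_inv]
    linarith [Real.log_le_sub_one_of_pos hδ]
  have hr1 : (r : ℝ) ≤ 8 * Real.log (1 / δ) := by
    rw [hr]
    linarith [(Nat.ceil_lt_add_one (a := 4 * Real.log (1 / δ)) (by linarith)).le]
  have hr2 : (3 / 4 : ℝ) ^ r ≤ δ := by
    have h1 : (3 / 4 : ℝ) ≤ Real.exp (-(1 / 4)) := by
      linarith [Real.add_one_le_exp (-(1 / 4) : ℝ)]
    calc (3 / 4 : ℝ) ^ r ≤ Real.exp (-(1 / 4)) ^ r := by gcongr
      _ = Real.exp (r * -(1 / 4)) := by rw [← Real.exp_nat_mul]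
      _ ≤ Real.exp (Real.log δ) := by
        rw [Real.exp_le_exp]
        have h2 := Nat.le_ceil (4 * Real.log (1 / δ))
        rw [← hr, one_div δ, Real.log_inv] at h2
        linarith
      _ = δ := Real.exp_log hδ
  obtain ⟨t, b, ht, hb, 𝒜, h1, h2, h3⟩ := exists_algorithm_parameters hd hA hB hε r 0 (by
    rw [pow_zero]; exact hAB)
  rw [pow_zero, div_one] at ht
  refine ⟨𝒜, ?_, ?_, fun u v hu hv Ou Ov hOu hOv => ?_⟩
  · rw [h1]
    have h4 : ((2 ^ t - 1 : ℕ) : ℝ) ≤ 2 ^ t := by exact_mod_cast Nat.sub_le _ _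
    rw [Nat.cast_mul, Nat.cast_mul, Nat.cast_ofNat]
    calc 8 * (r : ℝ) * ((2 ^ t - 1 : ℕ) : ℝ) ≤
          8 * (8 * Real.log (1 / δ)) * (4096 * (A * B / ε * Real.sqrt d)) := by
          gcongr
          exact h4.trans ht
      _ = 262144 * (A * B / ε * Real.sqrt d * Real.log (1 / δ)) := by ring
      _ ≤ _ := by
          refine mul_le_mul_of_nonneg_right (by norm_num) (mul_nonneg (by positivity) ?_)
          linarith
  · exact (Nat.cast_le.mpr h2).trans (gateBound_le_of_two_pow_le hd hAB hδ (by linarith) ht hb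
      (by rw [pow_zero]; linarith) (Or.inl hr1))
  · have := h3 u v hu hv Ou Ov hOu hOv
    rw [pow_zero, div_one] at this
    linarith

/-- A success probability of only `η = 1 - δ` is required, and `η ≤ log (1 / δ)`. One round is good
with probability at least `1 / 4`, so `g` random bits with `4 * η * 2 ^ g ≤ 1` are affordable, and
the relaxed tolerance brings the queries down to order `η * A * B * √d / ε`. -/
theorem exists_algorithm_of_gt {A B ε δ : ℝ} (hd : 0 < d) (hA : 0 < A) (hB : 0 < B) (hε : 0 < ε)
    (hAB : 1 ≤ A * B / ε) (hδ3 : 3 / 4 < δ) (hδ1 : δ < 1) :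
    ∃ 𝒜 : Algorithm d,
      (𝒜.queryCount : ℝ) ≤ 10 ^ 10 * (A * B * Real.sqrt d / ε * Real.log (1 / δ)) ∧
      (𝒜.gateCount : ℝ) ≤ 10 ^ 10 * (A * B * Real.sqrt d / ε * Real.log (2 / δ)) *
        Real.log (2 + (d : ℝ) + A * B / ε + 1 / δ) ^ 2 ∧
      ∀ u v : Fin d → ℝ, ‖u‖ ≤ A → l1Norm v ≤ B → ∀ Ou Ov : OracleSpace d ≃ₗᵢ[ℂ] OracleSpace d,
        IsInputOracle Ou u → IsInputOracle Ov v →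
          1 - δ ≤ 𝒜.outputProb Ou Ov {x | |x - ∑ j, u j * v j| ≤ ε} := by
  have hT : A * B * Real.sqrt d / ε = A * B / ε * Real.sqrt d := by ring
  rw [hT]
  have hδ : 0 < δ := by linarith
  obtain ⟨η, hη⟩ : ∃ η, η = 1 - δ := ⟨_, rfl⟩
  have hη0 : 0 < η := by linarith
  have hηlog : η ≤ Real.log (1 / δ) := by
    rw [one_div, Real.log_inv]
    linarith [Real.log_le_sub_one_of_pos hδ]
  have hlog : 0 ≤ Real.log (1 / δ) := hη0.le.trans hηlog
  obtain ⟨g, hg1, hg2⟩ := exists_nat_pow_near (x := 1 / (4 * η)) (by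
    rw [le_div_iff₀ (by positivity)]; linarith) (one_lt_two : (1 : ℝ) < 2)
  have hR : (0 : ℝ) < 2 ^ g := by positivity
  rw [le_div_iff₀ (by positivity)] at hg1
  rw [div_lt_iff₀ (by positivity), pow_succ] at hg2
  rcases le_or_gt ((2 : ℝ) ^ g) (A * B / ε) with hgP | hgP
  · obtain ⟨t, b, ht, hb, 𝒜, h1, h2, h3⟩ := exists_algorithm_parameters hd hA hB hε 1 g hgP
    have ht' : (2 : ℝ) ^ t ≤ 4096 * (A * B / ε * Real.sqrt d) :=
      ht.trans (div_le_self (by positivity) (one_le_pow₀ (by norm_num)))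
    refine ⟨𝒜, ?_, ?_, fun u v hu hv Ou Ov hOu hOv => ?_⟩
    · rw [h1]
      have h4 : ((2 ^ t - 1 : ℕ) : ℝ) ≤ 2 ^ t := by exact_mod_cast Nat.sub_le _ _
      rw [Nat.cast_mul, mul_one, Nat.cast_ofNat]
      calc 8 * ((2 ^ t - 1 : ℕ) : ℝ) ≤ 8 * (4096 * (A * B / ε * Real.sqrt d) / 2 ^ g) := by
            gcongr
            exact h4.trans ht
        _ = 32768 * (A * B / ε * Real.sqrt d) * (1 / 2 ^ g) := by ring
        _ ≤ 32768 * (A * B / ε * Real.sqrt d) * (8 * Real.log (1 / δ)) := by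
            gcongr
            rw [div_le_iff₀ hR]
            nlinarith
        _ = 262144 * (A * B / ε * Real.sqrt d * Real.log (1 / δ)) := by ring
        _ ≤ _ := mul_le_mul_of_nonneg_right (by norm_num) (mul_nonneg (by positivity) hlog)
    · exact (Nat.cast_le.mpr h2).trans (gateBound_le_of_two_pow_le hd hAB hδ hδ1 ht' hb
        (by linarith) (Or.inr rfl))
    · refine le_trans ?_ (h3 u v hu hv Ou Ov hOu hOv)
      rw [le_div_iff₀ hR, ← hη]
      linarith
  -- Here guessing without any query is good enough: `l + 1 ≤ g` bits already cover the whole range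
  -- of the inner product.
  · obtain ⟨l, hl1, hl2⟩ := exists_nat_pow_near hAB (one_lt_two : (1 : ℝ) < 2)
    have hgl : l + 1 ≤ g := by
      have := (pow_lt_pow_iff_right₀ (one_lt_two : (1 : ℝ) < 2)).mp (hl1.trans_lt hgP)
      omega
    obtain ⟨𝒜, h1, h2, h3⟩ := exists_guessing_algorithm (B := B) hd hA hε (l + 1)
      ((div_le_iff₀ hε).mp hl2.le)
    have hT1 : 1 ≤ A * B / ε * Real.sqrt d := one_le_mul_of_one_le_of_one_le hAB
      (Real.one_le_sqrt.mpr (by exact_mod_cast hd))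
    have hdP : 1 ≤ (d : ℝ) * (A * B / ε) :=
      one_le_mul_of_one_le_of_one_le (by exact_mod_cast hd) hAB
    refine ⟨𝒜, ?_, ?_, fun u v hu hv Ou Ov hOu hOv => ?_⟩
    · rw [h1, Nat.cast_zero]
      positivity
    · exact (Nat.cast_le.mpr h2).trans (gateBound_le_of_two_pow_le hd hAB hδ hδ1
        (by rw [pow_zero]; linarith) (by rw [pow_zero]; linarith) (by rw [pow_succ]; linarith)
        (Or.inr rfl))
    · refine le_trans ?_ (h3 u v hu hv Ou Ov hOu hOv)
      have h4 : (2 : ℝ) ^ (l + 1) ≤ 2 ^ g := pow_le_pow_right₀ (by norm_num) hgl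
      rw [le_div_iff₀ (by positivity), ← hη]
      nlinarith

end Parameters

end QuantumIP

theorem mainTheorem4 :
    ∃ (K : ℝ) (k : ℕ), 0 < K ∧
      ∀ (d : ℕ) (A B ε δ : ℝ), 0 < A → 0 < B → 0 < ε → ε < 1 → 0 < δ → δ < 1 →
        ∃ 𝒜 : QuantumIP.Algorithm d,
          (𝒜.queryCount : ℝ) ≤ K * (A * B * Real.sqrt (d : ℝ) / ε * Real.log (1 / δ)) ∧
          (𝒜.gateCount : ℝ) ≤
            K * (A * B * Real.sqrt (d : ℝ) / ε * Real.log (2 / δ)) *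
              Real.log (2 + (d : ℝ) + A * B / ε + 1 / δ) ^ k ∧
          ∀ u v : Fin d → ℝ, u ≠ 0 → v ≠ 0 → ‖u‖ ≤ A → QuantumIP.l1Norm v ≤ B →
            ∀ Ou Ov : QuantumIP.OracleSpace d ≃ₗᵢ[ℂ] QuantumIP.OracleSpace d,
              QuantumIP.IsInputOracle Ou u → QuantumIP.IsInputOracle Ov v →
                1 - δ ≤ 𝒜.outputProb Ou Ov {x : ℝ | |x - ∑ j, u j * v j| ≤ ε} := by
  refine ⟨10 ^ 10, 2, by norm_num, fun d A B ε δ hA hB hε _ hδ hδ1 => ?_⟩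
  -- In these cases the inner product is within `ε` of zero, and the empty circuit outputs zero.
  -- Otherwise `1 < A * B / ε`, as the choice of parameters requires.
  by_cases htriv : d = 0 ∨ A * B / ε ≤ 1
  · obtain ⟨𝒜, h1, h2, h3⟩ := QuantumIP.exists_trivial_algorithm (d := d) (ε := ε)
    have hδ' : 1 < 1 / δ := by rwa [one_lt_div hδ]
    refine ⟨𝒜, ?_, ?_, fun u v _ _ hu hv Ou Ov _ _ => ?_⟩
    · have : 0 < Real.log (1 / δ) := Real.log_pos hδ'
      rw [h1, Nat.cast_zero]
      positivity
    · have : 0 < Real.log (2 / δ) := Real.log_pos (by rw [one_lt_div hδ]; linarith)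
      rw [h2, Nat.cast_zero]
      positivity
    · rw [h3 _ ?_ Ou Ov]
      · linarith
      · rcases htriv with rfl | h
        · simpa using hε.le
        · exact (QuantumIP.abs_sum_mul_le hA hu hv).trans ((div_le_one hε).mp h)
  rw [not_or, not_le] at htriv
  have hd : 0 < d := Nat.pos_of_ne_zero htriv.1
  rcases le_or_gt δ (3 / 4) with hδ3 | hδ3
  · obtain ⟨𝒜, h1, h2, h3⟩ := QuantumIP.exists_algorithm_of_le hd hA hB hε htriv.2.le hδ hδ3
    exact ⟨𝒜, h1, h2, fun u v _ _ => h3 u v⟩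
  · obtain ⟨𝒜, h1, h2, h3⟩ := QuantumIP.exists_algorithm_of_gt hd hA hB hε htriv.2.le hδ3 hδ1
    exact ⟨𝒜, h1, h2, fun u v _ _ => h3 u v⟩
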